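/- Let $\mathbb K$ be an algebraically closed field of characteristic $0$. A diagonal ind-group $G=\varinjlim G_n$ with a fixed exhaustion by simply connected classical groups of one type is given here by the corresponding direct system of Lie algebras, in terms of which all the notions below are defined: it consists of simple classical Lie algebras $\mathfrak g_0\xrightarrow{\delta_0}\mathfrak g_1\xrightarrow{\delta_1}\cdots$, all of the same type $A$, $B$, $C$ or $D$ (that is, $\mathfrak{sl}_{r_n+1}$, $\mathfrak{so}_{2r_n+1}$, $\mathfrak{sp}_{2r_n}$ or $\mathfrak{so}_{2r_n}$), with injective homomorphisms $\delta_n$ that are *diagonal*: the natural representation of $\mathfrak g_{n+1}$, restricted to $\mathfrak g_n$, is a direct sum of copies of the natural representation of $\mathfrak g_n$, of its dual, and of the trivial representation. Let $\mathfrak g=\varinjlim\mathfrak g_n$ be the Lie algebra of $G$. * Call $G$ *pure* if for all large $n$ the natural representation of $\mathfrak g_{n+1}$ contains no trivial $\mathfrak g_n$-constituent. * Fix a Cartan subalgebra $\mathfrak h=\varinjlim\mathfrak h_n$ (the Lie algebra of a Cartan subgroup $H$): each $\mathfrak h_n\subset\mathfrak g_n$ is a Cartan subalgebra and $\mathfrak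 h_n=\mathfrak h_{n+1}\cap\mathfrak g_n$. A *Borel subgroup* $B$ of $G$ (always containing $H$) is given by its Lie algebra $\mathfrak b=\varinjlim\mathfrak b_n$, where $\mathfrak b_n\supset\mathfrak h_n$ is a Borel (maximal solvable) subalgebra of $\mathfrak g_n$ and $\mathfrak b_n=\mathfrak b_{n+1}\cap\mathfrak g_n$. * A *weight* of $G$ is a sequence $\lambda=(\lambda_n)$ of integral weights $\lambda_n\in\mathfrak h_n^*$ of $\mathfrak g_n$ such that $\lambda_{n+1}$ restricts to $\lambda_n$ for every $n$. It is *$B$-dominant* if $\frac{2(\lambda_n,\alpha)}{(\alpha,\alpha)}\in\mathbb Z_{\ge 0}$ for every $n$ and every root $\alpha$ of $\mathfrak b_n$, and *strictly $B$-dominant* if $(\lambda_n,\alpha)>0$ for all such $n$ and $\alpha$, i.e. $\frac{2(\lambda_n,\alpha)}{(\alpha,\alpha)}\in\mathbb Z_{>0}$. Let $\mathcal P_B^+$ be the set of $B$-dominant weights. * An injective homomorphism $\mathfrak k\to\mathfrak k'$ of finite-dimensional reductive Lie algebras is a *root injection* if for any Cartan subalgebra $\mathfrak t$ of $\mathfrak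 k$ there is a Cartan subalgebra $\mathfrak t'$ of $\mathfrak k'$ containing the image of $\mathfrak t$ and such that every $\mathfrak t$-root space of $\mathfrak k$ is mapped into one $\mathfrak t'$-root space of $\mathfrak k'$. A Lie algebra is *root reductive* if it is the union of an increasing sequence of finite-dimensional reductive subalgebras whose successive inclusions are root injections. Then: (i) If $G$ is pure, then for every Borel subgroup $B$ of $G$ the set $\mathcal P_B^+$ contains a nonzero weight. (ii) Whether or not $G$ is pure, there is a Borel subgroup $B$ of $G$ such that $\mathcal P_B^+$ contains a nonzero weight. (iii) If for some Borel subgroup $B$ of $G$ the set $\mathcal P_B^+$ contains a strictly $B$-dominant weight, then $G$ is root reductive: the Lie algebra $\mathfrak g$ is root reductive and, moreover, $\delta_n:\mathfrak g_n\to\mathfrak g_{n+1}$ is a root injection for all sufficiently large $n$. -/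

import Mathlib

namespace DiagonalInd

attribute [local instance] LieRing.ofAssociativeRing

/-- The four classical series. -/
inductive ClassicalType
  | A
  | B
  | C
  | D

/-- Index set of the standard basis of the natural representation of the classical Lie algebra of
the given type and rank `r`; its cardinality is `r + 1`, `2 r + 1`, `2 r`, `2 r` for `A`, `B`, `C`,
`D`. -/
def ClassicalType.Index : ClassicalType → ℕ → Type
  | .A, r => Fin (r + 1)
  | .B, r => Unit ⊕ (Fin r ⊕ Fin r)
  | .C, r => Fin r ⊕ Fin r
  | .D, r => Fin r ⊕ Fin r

instance ClassicalType.instFintypeIndex : (t : ClassicalType) → (r : ℕ) → Fintype (t.Index r)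
  | .A, r => inferInstanceAs (Fintype (Fin (r + 1)))
  | .B, r => inferInstanceAs (Fintype (Unit ⊕ (Fin r ⊕ Fin r)))
  | .C, r => inferInstanceAs (Fintype (Fin r ⊕ Fin r))
  | .D, r => inferInstanceAs (Fintype (Fin r ⊕ Fin r))

instance ClassicalType.instDecidableEqIndex :
    (t : ClassicalType) → (r : ℕ) → DecidableEq (t.Index r)
  | .A, r => inferInstanceAs (DecidableEq (Fin (r + 1)))
  | .B, r => inferInstanceAs (DecidableEq (Unit ⊕ (Fin r ⊕ Fin r)))
  | .C, r => inferInstanceAs (DecidableEq (Fin r ⊕ Fin r))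
  | .D, r => inferInstanceAs (DecidableEq (Fin r ⊕ Fin r))

/-- The classical matrix Lie algebra of rank `r`: `sl (r + 1)`, `so (2 r + 1)`, `sp (2 r)`,
`so (2 r)`. Its natural representation is `t.Index r → K`, a matrix `x` acting by
`v ↦ x.mulVec v`. -/
def classical (K : Type*) [Field K] :
    (t : ClassicalType) → (r : ℕ) → LieSubalgebra K (Matrix (t.Index r) (t.Index r) K)
  | .A, r => LieAlgebra.SpecialLinear.sl (Fin (r + 1)) K
  | .B, r => LieAlgebra.Orthogonal.typeB (Fin r) K
  | .C, r => LieAlgebra.Symplectic.sp (Fin r) K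
  | .D, r => LieAlgebra.Orthogonal.typeD (Fin r) K

/-- A diagonal embedding of classical Lie algebras: an injective homomorphism such that the natural
representation of the target, viewed as a module over the source, is isomorphic to a direct sum
of `k` copies of the natural representation, `l` copies of its dual (in the dual
basis `x` acts on the dual by `-xᵀ`), and `z` copies of the trivial representation. -/
structure IsDiagonal {K : Type*} [Field K] {t : ClassicalType} {r s : ℕ}
    (δ : classical K t r →ₗ⁅K⁆ classical K t s) : Prop where
  injective : Function.Injective δ
  decomposition : ∃ (k l z : ℕ)
    (e : (t.Index s → K) ≃ₗ[K]
      ((Fin k → (t.Index r → K)) × (Fin l → (t.Index r → K)) × (Fin z → K))),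
    ∀ (x : classical K t r) (v : t.Index s → K),
      e ((δ x).1.mulVec v) =
        (fun i => x.1.mulVec ((e v).1 i), fun j => (-x.1.transpose).mulVec ((e v).2.1 j), 0)

/-- A diagonal ind-group, given by the Lie algebras of its fixed exhaustion: a sequence of simple
classical Lie algebras `𝔤ₙ` of one type, diagonal embeddings `δ n : 𝔤ₙ → 𝔤ₙ₊₁`, and the direct
limit `L` of this system with the canonical embeddings `ι n : 𝔤ₙ → L`. -/
structure DiagonalIndAlgebra (K L : Type*) [Field K] [LieRing L] [LieAlgebra K L] where
  type : ClassicalType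
  rank : ℕ → ℕ
  simple : ∀ n, LieAlgebra.IsSimple K (classical K type (rank n))
  δ : ∀ n, classical K type (rank n) →ₗ⁅K⁆ classical K type (rank (n + 1))
  diagonal : ∀ n, IsDiagonal (δ n)
  ι : ∀ n, classical K type (rank n) →ₗ⁅K⁆ L
  ι_injective : ∀ n, Function.Injective (ι n)
  ι_comp_δ : ∀ n x, ι (n + 1) (δ n x) = ι n x
  exhausts : ∀ y : L, ∃ n, y ∈ (ι n).range

/-- An injective homomorphism `f : 𝔤 → 𝔤'` of (finite-dimensional reductive) Lie algebras is a root
injection if for any Cartan subalgebra `𝔥` of `𝔤` there is a Cartan subalgebra `𝔥'` of `𝔤'`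
containing `f 𝔥` such that every `𝔥`-root space is mapped into one `𝔥'`-root space. -/
def IsRootInjection {K g g' : Type*} [Field K] [LieRing g] [LieAlgebra K g] [LieRing g']
    [LieAlgebra K g'] (f : g →ₗ⁅K⁆ g') : Prop :=
  Function.Injective f ∧
    ∀ (h : LieSubalgebra K g) [h.IsCartanSubalgebra],
      ∃ (h' : LieSubalgebra K g') (_ : h'.IsCartanSubalgebra), h.map f ≤ h' ∧
        ∀ α : LieModule.Weight K h g, α.IsNonZero →
          ∃ β : LieModule.Weight K h' g', β.IsNonZero ∧
            ∀ x ∈ LieAlgebra.rootSpace h α, f x ∈ LieAlgebra.rootSpace h' β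

/-- `L` is root reductive if it is the union of an increasing sequence of finite-dimensional
reductive subalgebras whose successive inclusions are root injections. -/
def IsRootReductive (K L : Type*) [Field K] [LieRing L] [LieAlgebra K L] : Prop :=
  ∃ a : ℕ → LieSubalgebra K L,
    (∀ n, FiniteDimensional K (a n) ∧ LieAlgebra.HasCentralRadical K (a n)) ∧
    (∀ n, ∃ hle : a n ≤ a (n + 1), IsRootInjection (LieSubalgebra.inclusion hle)) ∧
    ∀ y : L, ∃ n, y ∈ a n

namespace DiagonalIndAlgebra

variable {K L : Type*} [Field K] [LieRing L] [LieAlgebra K L]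

/-- The `n`-th Lie algebra `𝔤ₙ` of the exhaustion. -/
abbrev g (G : DiagonalIndAlgebra K L) (n : ℕ) : LieSubalgebra K
    (Matrix (G.type.Index (G.rank n)) (G.type.Index (G.rank n)) K) :=
  classical K G.type (G.rank n)

instance instIsSimple (G : DiagonalIndAlgebra K L) (n : ℕ) : LieAlgebra.IsSimple K (G.g n) :=
  G.simple n

/-- `G` is pure if for all large `n` the natural representation of `𝔤ₙ₊₁` contains no trivial
`𝔤ₙ`-constituents, i.e. no nonzero vector annihilated by `𝔤ₙ` (the module is semisimple). -/
def IsPure (G : DiagonalIndAlgebra K L) : Prop :=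
  ∃ N, ∀ n ≥ N, ∀ v : G.type.Index (G.rank (n + 1)) → K,
    (∀ x : G.g n, (G.δ n x).1.mulVec v = 0) → v = 0

/-- A Cartan subalgebra `𝔥 = lim 𝔥ₙ`, where `𝔥ₙ` is a Cartan subalgebra of `𝔤ₙ` and
`𝔥ₙ = 𝔥ₙ₊₁ ∩ 𝔤ₙ`. -/
structure Cartan (G : DiagonalIndAlgebra K L) where
  h : ∀ n, LieSubalgebra K (G.g n)
  isCartan : ∀ n, (h n).IsCartanSubalgebra
  h_eq : ∀ n, h n = (h (n + 1)).comap (G.δ n)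

instance Cartan.instIsCartan {G : DiagonalIndAlgebra K L} (H : G.Cartan) (n : ℕ) :
    (H.h n).IsCartanSubalgebra :=
  H.isCartan n

/-- The embedding `𝔥ₙ → 𝔥ₙ₊₁`. -/
def Cartan.incl {G : DiagonalIndAlgebra K L} (H : G.Cartan) (n : ℕ) (x : H.h n) : H.h (n + 1) :=
  ⟨G.δ n x.1, by
    have hx : ∀ y ∈ H.h n, G.δ n y ∈ H.h (n + 1) := by
      rw [H.h_eq n]
      exact fun y hy => hy
    exact hx x.1 x.2⟩

/-- A Borel subalgebra `𝔟 = lim 𝔟ₙ` containing `𝔥`: each `𝔟ₙ` is a Borel (maximal solvable)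
subalgebra of `𝔤ₙ` containing `𝔥ₙ`, and `𝔟ₙ = 𝔟ₙ₊₁ ∩ 𝔤ₙ`. -/
structure Borel (G : DiagonalIndAlgebra K L) (H : G.Cartan) where
  b : ∀ n, LieSubalgebra K (G.g n)
  isBorel : ∀ n, Maximal (fun s : LieSubalgebra K (G.g n) => LieAlgebra.IsSolvable s) (b n)
  cartan_le : ∀ n, H.h n ≤ b n
  b_eq : ∀ n, b n = (b (n + 1)).comap (G.δ n)

/-- `α` is a root of `𝔟ₙ`. -/
def Borel.IsRoot {G : DiagonalIndAlgebra K L} {H : G.Cartan} (B : G.Borel H) (n : ℕ)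
    (α : LieModule.Weight K (H.h n) (G.g n)) : Prop :=
  α.IsNonZero ∧ ∀ x ∈ LieAlgebra.rootSpace (H.h n) α, x ∈ B.b n

section Weights

variable [IsAlgClosed K] [CharZero K] {G : DiagonalIndAlgebra K L}

/-- `lam` is a weight of `G`: an inverse system of integral weights `lam n` of `𝔤ₙ`. The value of
`lam n` at the coroot of `α` is `2 (lam n, α) / (α, α)`. -/
def IsWeight (H : G.Cartan) (lam : ∀ n, Module.Dual K (H.h n)) : Prop :=
  (∀ n, ∀ α : LieModule.Weight K (H.h n) (G.g n), α.IsNonZero →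
    ∃ c : ℤ, lam n (LieAlgebra.IsKilling.coroot α) = c) ∧
  ∀ n (x : H.h n), lam (n + 1) (H.incl n x) = lam n x

/-- `lam` is a `B`-dominant weight of `G`: `2 (lam n, α) / (α, α)` is a nonnegative integer for
all roots `α` of `𝔟ₙ` and all `n`. -/
def IsDominant {H : G.Cartan} (B : G.Borel H) (lam : ∀ n, Module.Dual K (H.h n)) : Prop :=
  IsWeight H lam ∧ ∀ n, ∀ α : LieModule.Weight K (H.h n) (G.g n), B.IsRoot n α →
    ∃ c : ℤ, 0 ≤ c ∧ lam n (LieAlgebra.IsKilling.coroot α) = c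

/-- `lam` is a strictly `B`-dominant weight of `G`: `(lam n, α) > 0`, equivalently
`2 (lam n, α) / (α, α)` is a positive integer, for all roots `α` of `𝔟ₙ` and all `n`. -/
def IsStrictlyDominant {H : G.Cartan} (B : G.Borel H) (lam : ∀ n, Module.Dual K (H.h n)) : Prop :=
  IsWeight H lam ∧ ∀ n, ∀ α : LieModule.Weight K (H.h n) (G.g n), B.IsRoot n α →
    ∃ c : ℤ, 0 < c ∧ lam n (LieAlgebra.IsKilling.coroot α) = c

end Weights

end DiagonalIndAlgebra

end DiagonalInd

/-! For (i) and (ii) the weights come from eigenvectors of `B.b n` in the natural representation of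
`G.g n` or its dual. By Lie's theorem there is at least one, and only finitely many weights can
occur. By `sl₂`-theory such a weight is integral and dominant, and it is nonzero because a Borel
eigenvector of weight zero would be invariant. A diagonal embedding sends an eigenvector at level `n
+ 1` to one in a natural or dual constituent at level `n`, unless the vector is invariant under `G.g
n`. If from some level on no Borel eigenvector is invariant (`Borel.NoInvariants`), the weights form
an inverse system of nonempty finite sets. A compatible family exists, and it extends to the lower
levels by restriction (`Borel.exists_isDominant`).

Purity excludes invariants for every Borel subalgebra, which gives (i). For (ii) the Borel
subalgebra is defined by regular elements `xₙ` on which all roots are integral, where `xₙ₊₁` is a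
small perturbation of a large multiple of the image of `xₙ`. A Borel eigenvector at level `n + 1`
invariant under `G.g n` has a dominant weight vanishing at the nonzero dominant image of `xₙ`.
Expanding this value over the roots gives a sum of nonnegative terms, so each term is zero.
Simplicity then makes the vector invariant under all of `G.g (n + 1)`, which is impossible
(`IsEigenvector.lie_eq_zero_of_apply_eq_zero`).

For (iii), attach to a root `α` of `B.b n` the ratio `a / T`, where `a` is the value of the weight
on the coroot and `T` is the trace of the squared coroot in the natural representation. Strict
dominance gives `a ≥ 1`. Root vectors of classical algebras have rank at most two, which gives `T ≤
64`; so `a / T ≥ 1 / 64`. If `d` is the number of nontrivial constituents of the embedding, some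
root at the next level has ratio at most `a / (d T)`. Hence `d = 1` from some level on.

The comparison of levels (`exists_root_restricting_le`) is an instability argument. Project the dual
vector of the weight orthogonally to the image `x` of the coroot. If all Borel roots restricting to
`α` were positive on the projection, the image of a root vector of `α` would be strictly positive
for it. Representation theory of `sl₂` and Hall's marriage theorem then show that the projection is
not orthogonal to `x` (`traceForm_ne_zero_of_mem_raisingSpace`), a contradiction.

When `d = 1`, the natural representation is the smaller natural representation or its dual plus a
trivial part. A diagonalizable element with simple spectrum on the trivial part, avoiding its
eigenvalue on the other summand, cuts out the smaller algebra up to a commuting abelian subalgebra.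
Adding that subalgebra to any Cartan subalgebra of the smaller algebra gives the Cartan subalgebra
required for a root injection. -/

namespace DiagonalInd

open LieAlgebra LieModule Module

attribute [local instance] LieRing.ofAssociativeRing

set_option linter.unusedSectionVars false
set_option linter.style.haveILetI false

/-! ### Solvability through derived series in the ambient algebra. -/

section Solvable

variable {K g : Type*} [Field K] [LieRing g] [LieAlgebra K g]

/-- The span of all brackets of elements of a subspace. -/
def bracketSpan (P : Submodule K g) : Submodule K g :=
  Submodule.span K {z | ∃ x ∈ P, ∃ y ∈ P, ⁅x, y⁆ = z}

lemma bracketSpan_le {P Q : Submodule K g} :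
    bracketSpan P ≤ Q ↔ ∀ x ∈ P, ∀ y ∈ P, ⁅x, y⁆ ∈ Q := by
  unfold bracketSpan
  rw [Submodule.span_le]
  constructor
  · intro h x hx y hy
    exact h ⟨x, hx, y, hy, rfl⟩
  · rintro h _ ⟨x, hx, y, hy, rfl⟩
    exact h x hx y hy

lemma lie_mem_bracketSpan {P : Submodule K g} {x y : g} (hx : x ∈ P) (hy : y ∈ P) :
    ⁅x, y⁆ ∈ bracketSpan P :=
  bracketSpan_le.1 le_rfl x hx y hy

lemma bracketSpan_mono : Monotone (bracketSpan : Submodule K g → Submodule K g) := by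
  intro P Q h
  exact bracketSpan_le.2 fun x hx y hy => lie_mem_bracketSpan (h hx) (h hy)

/-- The derived series of a subspace, computed in the ambient Lie algebra. -/
def bracketSeries (P : Submodule K g) : ℕ → Submodule K g
  | 0 => P
  | k + 1 => bracketSpan (bracketSeries P k)

lemma bracketSeries_mono {P Q : Submodule K g} (h : P ≤ Q) (k : ℕ) :
    bracketSeries P k ≤ bracketSeries Q k := by
  induction k with
  | zero => exact h
  | succ k ih => exact bracketSpan_mono ih

lemma bracketSeries_add (P : Submodule K g) (k l : ℕ) :
    bracketSeries P (k + l) = bracketSeries (bracketSeries P k) l := by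
  induction l with
  | zero => rfl
  | succ l ih => exact congrArg bracketSpan ih

lemma bracketSeries_le_self (s : LieSubalgebra K g) (k : ℕ) :
    bracketSeries s.toSubmodule k ≤ s.toSubmodule := by
  induction k with
  | zero => exact le_rfl
  | succ k ih => exact bracketSpan_le.2 fun x hx y hy => s.lie_mem (ih hx) (ih hy)

lemma map_derivedSeries_eq (s : LieSubalgebra K g) (k : ℕ) :
    (derivedSeries K s k).toSubmodule.map s.toSubmodule.subtype =
      bracketSeries s.toSubmodule k := by
  induction k with
  | zero =>
    simp [bracketSeries, derivedSeries_def, derivedSeriesOfIdeal_zero]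
  | succ k ih =>
    rw [bracketSeries, ← ih, derivedSeries_def, derivedSeriesOfIdeal_succ,
      ← derivedSeries_def, LieSubmodule.lieIdeal_oper_eq_linear_span', Submodule.map_span,
      bracketSpan]
    congr 1
    ext z
    constructor
    · rintro ⟨_, ⟨x, hx, y, hy, rfl⟩, rfl⟩
      exact ⟨x, ⟨x, hx, rfl⟩, y, ⟨y, hy, rfl⟩, rfl⟩
    · rintro ⟨_, ⟨x, hx, rfl⟩, _, ⟨y, hy, rfl⟩, rfl⟩
      exact ⟨(⁅(show s from x), (show s from y)⁆ : s), ⟨x, hx, y, hy, rfl⟩, rfl⟩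

/-- Working with subspaces of `g` allows derived series of different subalgebras to be compared by
inclusion and pushed along homomorphisms. -/
lemma isSolvable_iff_bracketSeries (s : LieSubalgebra K g) :
    IsSolvable s ↔ ∃ k, bracketSeries s.toSubmodule k = ⊥ := by
  rw [isSolvable_iff K]
  refine exists_congr fun k => ?_
  rw [← map_derivedSeries_eq, (Submodule.map_injective_of_injective
    (Submodule.subtype_injective s.toSubmodule)).eq_iff' (Submodule.map_bot _),
    LieSubmodule.toSubmodule_eq_bot]

/-- A solvable subalgebra contains no `sl₂`-triple. -/
lemma sl2_not_mem_of_isSolvable [CharZero K] {h e f : g} (t : IsSl2Triple h e f)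
    (s : LieSubalgebra K g) (hs : IsSolvable s) (he : e ∈ s) (hf : f ∈ s) : False := by
  obtain ⟨k, hk⟩ := (isSolvable_iff_bracketSeries s).1 hs
  -- The span of the triple is perfect: `h = ⁅e, f⁆`, and `e`, `f` are brackets with `h` up to the
  -- invertible factor `±2`. It therefore survives in every derived term.
  have key : ∀ k, h ∈ bracketSeries s.toSubmodule k ∧ e ∈ bracketSeries s.toSubmodule k ∧
      f ∈ bracketSeries s.toSubmodule k := by
    intro k
    induction k with
    | zero => exact ⟨t.lie_e_f ▸ s.lie_mem he hf, he, hf⟩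
    | succ k ih =>
      obtain ⟨h1, h2, h3⟩ := ih
      refine ⟨t.lie_e_f ▸ lie_mem_bracketSpan h2 h3, ?_, ?_⟩
      · have := lie_mem_bracketSpan h1 h2
        rw [t.lie_h_e_smul K] at this
        exact (Submodule.smul_mem_iff _ two_ne_zero).1 this
      · have := lie_mem_bracketSpan h1 h3
        rw [t.lie_lie_smul_f K, Submodule.neg_mem_iff] at this
        exact (Submodule.smul_mem_iff _ two_ne_zero).1 this
  have := (key k).1
  rw [hk, Submodule.mem_bot] at this
  exact t.h_ne_zero this

/-- An injective homomorphism pulls solvable subalgebras back to solvable subalgebras. -/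
lemma isSolvable_comap {g' : Type*} [LieRing g'] [LieAlgebra K g'] (f : g →ₗ⁅K⁆ g')
    (hf : Function.Injective f) (s : LieSubalgebra K g') (hs : IsSolvable s) :
    IsSolvable (s.comap f) := by
  obtain ⟨k, hk⟩ := (isSolvable_iff_bracketSeries s).1 hs
  refine (isSolvable_iff_bracketSeries _).2 ⟨k, ?_⟩
  have key : ∀ k, (bracketSeries (s.comap f).toSubmodule k).map (f : g →ₗ[K] g') ≤
      bracketSeries s.toSubmodule k := by
    intro k
    induction k with
    | zero =>
      rintro _ ⟨x, hx, rfl⟩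
      exact hx
    | succ k ih =>
      rw [Submodule.map_le_iff_le_comap] at ih ⊢
      refine bracketSpan_le.2 fun x hx y hy => ?_
      rw [Submodule.mem_comap]
      have := lie_mem_bracketSpan (P := bracketSeries s.toSubmodule k) (x := f x) (y := f y)
        (ih hx) (ih hy)
      rw [LieHom.coe_toLinearMap, LieHom.map_lie]
      exact this
  have := key k
  rw [hk, le_bot_iff] at this
  exact ((Submodule.map_injective_of_injective (f := (f : g →ₗ[K] g')) hf).eq_iff'
    (Submodule.map_bot _)).1 this

end Solvable

/-! ### Lie's theorem. -/

section LieTheorem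

variable {K b V : Type*} [Field K] [IsAlgClosed K] [CharZero K] [LieRing b] [LieAlgebra K b]
  [AddCommGroup V] [Module K V] [FiniteDimensional K V]

/-- Lie's theorem for a representation given as a homomorphism. -/
lemma exists_common_eigenvector [IsSolvable b] [Nontrivial V] (ρ : b →ₗ⁅K⁆ Module.End K V) :
    ∃ χ : Module.Dual K b, ∃ v : V, v ≠ 0 ∧ ∀ x, ρ x v = χ x • v := by
  letI : LieRingModule b V := LieRingModule.compLieHom V ρ
  haveI : LieModule K b V := LieModule.compLieHom V ρ
  obtain ⟨χ, hχ⟩ := LieModule.exists_nontrivial_weightSpace_of_isSolvable K b V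
  obtain ⟨⟨v, hv⟩, hv0⟩ := exists_ne (0 : weightSpace V χ)
  refine ⟨χ, v, fun h => hv0 (by simpa using h), ?_⟩
  rw [mem_weightSpace] at hv
  exact hv

end LieTheorem

/-! ### Maximal solvable subalgebras containing a Cartan subalgebra. -/

section Borel

variable {K g : Type*} [Field K] [IsAlgClosed K] [CharZero K] [LieRing g] [LieAlgebra K g]
  [FiniteDimensional K g] [IsKilling K g] (H : LieSubalgebra K g) [H.IsCartanSubalgebra]

variable {H} in
/-- To check an inclusion of subspaces, the smaller one being stable under a Cartan subalgebra, it
suffices to look at weight vectors. -/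
lemma le_of_forall_weight (U W : Submodule K g) (hU : ∀ y ∈ H, ∀ x ∈ U, ⁅y, x⁆ ∈ U)
    (h : ∀ α : Weight K H g, ∀ x ∈ U, x ∈ rootSpace H α → x ∈ W) : U ≤ W := by
  let N : LieSubmodule K H g := { U with lie_mem := fun {y x} hx => hU y.1 y.2 x hx }
  have hN : N.toSubmodule = U := rfl
  rw [← hN, LieModule.eq_iSup_inf_genWeightSpace K H g N, LieSubmodule.iSup_toSubmodule, iSup_le_iff]
  rintro α x ⟨hx1, hx2⟩
  exact h α x hx1 hx2

variable {H} in
lemma mem_rootSpace_zero_iff {x : g} {α : Weight K H g} (hα : α.IsZero)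
    (hx : x ∈ rootSpace H α) : x ∈ H := by
  have h0 : (α : H → K) = 0 := hα
  rw [h0, rootSpace_zero_eq] at hx
  exact hx

variable {H} in
lemma lie_eq_smul {α : H → K} {x : g} (hx : x ∈ rootSpace H α) (y : H) :
    ⁅(y : g), x⁆ = α y • x :=
  IsKilling.lie_eq_smul_of_mem_rootSpace hx y

-- Root spaces for nonzero roots are one-dimensional, so a single nonzero vector in `U` brings the
-- whole root space with it.
variable {H} in
lemma rootSpace_le_or_disjoint {α : Weight K H g} (hα : α.IsNonZero) (U : Submodule K g) {x : g}
    (hx : x ∈ rootSpace H α) (hx0 : x ≠ 0) (hxU : x ∈ U) : ∀ y ∈ rootSpace H α, y ∈ U := by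
  intro y hy
  have h1 := IsKilling.finrank_rootSpace_eq_one α hα
  obtain ⟨c, hc⟩ := (finrank_eq_one_iff_of_nonzero' (⟨x, hx⟩ : rootSpace H α)
    (fun h => hx0 (by simpa using h))).1 h1 ⟨y, hy⟩
  have : y = c • x := by
    have := congrArg Subtype.val hc
    simpa using this.symm
  rw [this]
  exact U.smul_mem c hxU

variable {H} in
lemma not_isSolvable_of_rootSpaces_le {α : Weight K H g} (hα : α.IsNonZero)
    (s : LieSubalgebra K g) (h1 : ∀ x ∈ rootSpace H α, x ∈ s)
    (h2 : ∀ x ∈ rootSpace H (-α), x ∈ s) : ¬ IsSolvable s := by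
  obtain ⟨h, e, f, t, he, hf⟩ := IsKilling.exists_isSl2Triple_of_weight_isNonZero hα
  exact fun hs => sl2_not_mem_of_isSolvable (K := K) t s hs (h1 e he) (h2 f hf)

/-- The orthogonal complement of a subspace for the Killing form. -/
def killingPerp (U : Submodule K g) : Submodule K g where
  carrier := {x | ∀ y ∈ U, killingForm K g x y = 0}
  add_mem' {a b} ha hb y hy := by simp [ha y hy, hb y hy]
  zero_mem' y _ := by simp
  smul_mem' c x hx y hy := by simp [hx y hy]

lemma lie_mem_killingPerp (b : LieSubalgebra K g) {y x : g} (hy : y ∈ b)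
    (hx : x ∈ killingPerp b.toSubmodule) : ⁅y, x⁆ ∈ killingPerp b.toSubmodule := by
  intro z hz
  have h1 : killingForm K g ⁅x, y⁆ z = killingForm K g x ⁅y, z⁆ :=
    LieModule.traceForm_apply_lie_apply K g g x y z
  rw [← lie_skew, map_neg, LinearMap.neg_apply, h1, hx _ (b.lie_mem hy hz), neg_zero]

/-- A character of a subalgebra containing `H` vanishes on any `H`-stable subspace orthogonal
to `H`. -/
lemma le_of_orthogonal_cartan (J W : Submodule K g)
    (hJ : ∀ y ∈ H, ∀ x ∈ J, ⁅y, x⁆ ∈ J) (hJH : ∀ x ∈ J, ∀ y ∈ H, killingForm K g x y = 0)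
    (hW : ∀ y ∈ H, ∀ x ∈ J, ⁅y, x⁆ ∈ W) : J ≤ W := by
  refine le_of_forall_weight (H := H) J W hJ fun α x hx hxα => ?_
  -- In weight zero the vector lies in `H` and is orthogonal to `H`, hence vanishes. In nonzero
  -- weight it is a multiple of its bracket with some element of `H`.
  by_cases hα : α.IsZero
  · have hxH := mem_rootSpace_zero_iff hα hxα
    have : (⟨x, hxH⟩ : H) = 0 := by
      have hnd := IsKilling.ker_traceForm_eq_bot_of_isCartanSubalgebra K g H
      rw [LinearMap.ker_eq_bot'] at hnd
      apply hnd
      ext y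
      exact hJH x hx y y.2
    have : x = 0 := congrArg Subtype.val this
    simp [this]
  · obtain ⟨y, hy⟩ : ∃ y, α y ≠ 0 := by
      by_contra! hcon
      exact hα (funext hcon)
    have := hW y y.2 x hx
    rw [lie_eq_smul hxα] at this
    exact (W.smul_mem_iff hy).1 this

/-- The orthogonal complement of a maximal solvable subalgebra containing a Cartan subalgebra is
contained in it. -/
lemma killingPerp_le_of_maximal (b : LieSubalgebra K g)
    (hb : Maximal (fun s : LieSubalgebra K g => IsSolvable s) b) (hHb : H ≤ b) :
    killingPerp b.toSubmodule ≤ b.toSubmodule := by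
  -- Lie's theorem for `b` acting on `P / J` provides `x ∈ P` outside `b` with `⁅y, x⁆ ∈ K x + J`
  -- for `y ∈ b`. Then `b + K x` is a larger solvable subalgebra.
  by_contra hle
  haveI : IsSolvable b := hb.1
  set P : Submodule K g := killingPerp b.toSubmodule with hP
  set J : Submodule K g := b.toSubmodule ⊓ P with hJ
  have hPstable : ∀ y ∈ b, ∀ x ∈ P, ⁅y, x⁆ ∈ P := fun y hy x hx => lie_mem_killingPerp b hy hx
  have hJstable : ∀ y ∈ b, ∀ x ∈ J, ⁅y, x⁆ ∈ J := fun y hy x hx =>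
    ⟨b.lie_mem hy hx.1, hPstable y hy x hx.2⟩
  let M : LieSubmodule K b g := { P with lie_mem := fun {y x} hx => hPstable y.1 y.2 x hx }
  let N : LieSubmodule K b M :=
    { b.toSubmodule.comap M.toSubmodule.subtype with
      lie_mem := fun {y x} hx => b.lie_mem y.2 hx }
  have hNtop : N ≠ ⊤ := by
    intro h
    apply hle
    intro x hx
    have : (⟨x, hx⟩ : M) ∈ N := h ▸ LieSubmodule.mem_top _
    exact this
  haveI : Nontrivial (M ⧸ N) := Submodule.Quotient.nontrivial_iff.2 (fun h => hNtop (by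
    rwa [← LieSubmodule.toSubmodule_eq_top]))
  obtain ⟨χ, v, hv0, hv⟩ := exists_common_eigenvector (LieModule.toEnd K b (M ⧸ N))
  obtain ⟨⟨x, hxP⟩, rfl⟩ := LieSubmodule.Quotient.surjective_mk' N v
  have hxb : x ∉ b := fun hx => hv0 ((LieSubmodule.Quotient.mk_eq_zero N).2 hx)
  have hx : ∀ y : b, ⁅(y : g), x⁆ - χ y • x ∈ J := by
    intro y
    have h1 := hv y
    have h2 : LieSubmodule.Quotient.mk' N (⁅y, (⟨x, hxP⟩ : M)⁆ - χ y • (⟨x, hxP⟩ : M)) = 0 := by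
      rw [map_sub, map_smul, LieModuleHom.map_lie, ← LieModule.toEnd_apply_apply K, h1, sub_self]
    exact ⟨(LieSubmodule.Quotient.mk_eq_zero N).1 h2,
      P.sub_mem (hPstable _ y.2 _ hxP) (P.smul_mem _ hxP)⟩
  -- the character vanishes on `J`
  have hχ : ∀ y (hy : y ∈ J), χ ⟨y, hy.1⟩ = 0 := by
    -- `J` is orthogonal to `b`, hence to `H`, and `χ` kills brackets because it is a system of
    -- simultaneous eigenvalues.
    have hle' : J ≤ (LinearMap.ker χ).map b.toSubmodule.subtype := by
      refine le_of_orthogonal_cartan H J _ (fun y hy => hJstable y (hHb hy)) (fun x hx y hy =>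
        hx.2 y (hHb hy)) fun y hy z hz => ?_
      refine ⟨⁅(⟨y, hHb hy⟩ : b), (⟨z, hz.1⟩ : b)⁆, ?_, rfl⟩
      have h1 := hv ⁅(⟨y, hHb hy⟩ : b), (⟨z, hz.1⟩ : b)⁆
      rw [LieHom.map_lie, LieRing.of_associative_ring_bracket, LinearMap.sub_apply,
        Module.End.mul_apply, Module.End.mul_apply, hv, hv, map_smul, map_smul, hv, hv, smul_smul,
        smul_smul, mul_comm, sub_self] at h1
      exact (smul_eq_zero.1 h1.symm).resolve_right hv0
    intro y hy
    obtain ⟨⟨y', hy'⟩, h1, h2⟩ := hle' hy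
    obtain rfl : y' = y := h2
    exact h1
  have hxJ : ∀ y ∈ J, ⁅y, x⁆ ∈ J := by
    intro y hy
    have := hx ⟨y, hy.1⟩
    rwa [hχ y hy, zero_smul, sub_zero] at this
  -- the extension of `b` by `x` is a solvable subalgebra
  set X : Submodule K g := Submodule.span K {x} with hX
  have hxX : x ∈ X := Submodule.mem_span_singleton_self x
  set I : Submodule K g := J ⊔ X with hI
  have hbX : ∀ y ∈ b, ∀ z ∈ X, ⁅y, z⁆ ∈ I := by
    intro y hy z hz
    obtain ⟨c, rfl⟩ := Submodule.mem_span_singleton.1 hz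
    rw [lie_smul]
    refine I.smul_mem c ?_
    rw [← sub_add_cancel ⁅y, x⁆ (χ ⟨y, hy⟩ • x)]
    exact Submodule.add_mem_sup (hx ⟨y, hy⟩) (X.smul_mem _ hxX)
  have hbI : ∀ y ∈ b, ∀ z ∈ I, ⁅y, z⁆ ∈ I := by
    intro y hy z hz
    obtain ⟨z1, h1, z2, h2, rfl⟩ := Submodule.mem_sup.1 hz
    rw [lie_add]
    exact I.add_mem (Submodule.mem_sup_left (hJstable y hy z1 h1)) (hbX y hy z2 h2)
  -- Since `χ` vanishes on `J`, `⁅J, x⁆ ⊆ J`; as `⁅x, x⁆ = 0`, one bracket takes `I` back into `b`.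
  have hII : ∀ y ∈ I, ∀ z ∈ I, ⁅y, z⁆ ∈ J := by
    intro y hy z hz
    obtain ⟨y1, h1, y2, h2, rfl⟩ := Submodule.mem_sup.1 hy
    obtain ⟨z1, h3, z2, h4, rfl⟩ := Submodule.mem_sup.1 hz
    obtain ⟨c, rfl⟩ := Submodule.mem_span_singleton.1 h2
    obtain ⟨d, rfl⟩ := Submodule.mem_span_singleton.1 h4
    simp only [lie_add, add_lie, lie_smul, smul_lie, lie_self, smul_zero, add_zero]
    refine J.add_mem (J.add_mem (hJstable _ h1.1 _ h3) (J.smul_mem _ ?_)) (J.smul_mem _ (hxJ _ h1))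
    rw [← lie_skew]
    exact J.neg_mem (hxJ _ h3)
  have hJb : J ≤ b.toSubmodule := inf_le_left
  have hbrI : ∀ y ∈ b.toSubmodule ⊔ I, ∀ z ∈ b.toSubmodule ⊔ I, ⁅y, z⁆ ∈ b.toSubmodule ⊔ I := by
    intro y hy z hz
    obtain ⟨y1, h1, y2, h2, rfl⟩ := Submodule.mem_sup.1 hy
    obtain ⟨z1, h3, z2, h4, rfl⟩ := Submodule.mem_sup.1 hz
    simp only [lie_add, add_lie]
    refine Submodule.add_mem _ (Submodule.add_mem _ (Submodule.mem_sup_left (b.lie_mem h1 h3))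
      (Submodule.mem_sup_right ?_)) (Submodule.add_mem _ (Submodule.mem_sup_right (hbI _ h1 _ h4))
      (Submodule.mem_sup_left (hJb (hII _ h2 _ h4))))
    rw [← lie_skew]
    exact I.neg_mem (hbI _ h3 _ h2)
  let b' : LieSubalgebra K g :=
    { b.toSubmodule ⊔ I with lie_mem' := fun {y z} hy hz => hbrI y hy z hz }
  have hsolv : IsSolvable b' := by
    obtain ⟨k, hk⟩ := (isSolvable_iff_bracketSeries b).1 hb.1
    have h1 : ∀ k, bracketSeries (b.toSubmodule ⊔ I) k ≤ bracketSeries b.toSubmodule k ⊔ I := by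
      intro k
      induction k with
      | zero => exact le_rfl
      | succ k ih =>
        refine bracketSpan_le.2 fun y hy z hz => ?_
        obtain ⟨y1, h1, y2, h2, rfl⟩ := Submodule.mem_sup.1 (ih hy)
        obtain ⟨z1, h3, z2, h4, rfl⟩ := Submodule.mem_sup.1 (ih hz)
        have h1' := bracketSeries_le_self b k h1
        have h3' := bracketSeries_le_self b k h3
        simp only [lie_add, add_lie]
        refine Submodule.add_mem _ (Submodule.add_mem _
          (Submodule.mem_sup_left (lie_mem_bracketSpan h1 h3))
          (Submodule.mem_sup_right ?_)) (Submodule.add_mem _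
          (Submodule.mem_sup_right (hbI _ h1' _ h4))
          (Submodule.mem_sup_right (Submodule.mem_sup_left (hII _ h2 _ h4))))
        rw [← lie_skew]
        exact I.neg_mem (hbI _ h3' _ h2)
    -- The first `k` steps reach `I`, one more reaches `J ≤ b`, and another `k` steps reach zero.
    refine (isSolvable_iff_bracketSeries b').2 ⟨k + (1 + k), ?_⟩
    rw [bracketSeries_add, bracketSeries_add, eq_bot_iff, ← hk]
    refine bracketSeries_mono ?_ k
    have h2 : bracketSeries b'.toSubmodule k ≤ I := by
      refine (h1 k).trans ?_
      rw [hk, bot_sup_eq]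
    refine bracketSpan_le.2 fun y hy z hz => hJb (hII y (h2 hy) z (h2 hz))
  have hle2 : b' ≤ b := hb.2 hsolv fun y hy => Submodule.mem_sup_left hy
  exact hxb (hle2 (Submodule.mem_sup_right (Submodule.mem_sup_right hxX)))

variable {H} in
/-- For every root `α`, a maximal solvable subalgebra containing a Cartan subalgebra contains the
root space of `α` or that of `-α`. -/
lemma rootSpace_le_or_neg_le (b : LieSubalgebra K g)
    (hb : Maximal (fun s : LieSubalgebra K g => IsSolvable s) b) (hHb : H ≤ b)
    {α : Weight K H g} (hα : α.IsNonZero) :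
    (∀ x ∈ rootSpace H α, x ∈ b) ∨ (∀ x ∈ rootSpace H (-α), x ∈ b) := by
  by_contra! hcon
  obtain ⟨⟨x, hxα, hxb⟩, h2⟩ := hcon
  apply hxb
  refine killingPerp_le_of_maximal H b hb hHb ?_
  -- The Killing form pairs the root space of `α` only with that of `-α`, which meets `b` trivially
  -- by dimension one. So `x` is orthogonal to `b`, and the orthogonal of `b` lies in `b`.
  have hle : b.toSubmodule ≤ LinearMap.ker (killingForm K g x) := by
    refine le_of_forall_weight (H := H) _ _ (fun y hy z hz => b.lie_mem (hHb hy) hz)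
      fun β z hz hzβ => ?_
    rw [LinearMap.mem_ker]
    by_cases hβ : (α : H → K) + β = 0
    · by_contra hne
      have hβ' : β = -α := by
        apply DFunLike.coe_injective
        rw [Weight.coe_neg]
        exact (neg_eq_of_add_eq_zero_right hβ).symm
      have hz0 : z ≠ 0 := by rintro rfl; simp at hne
      obtain ⟨y, hy, hyb⟩ := h2
      subst hβ'
      exact hyb (rootSpace_le_or_disjoint hα.neg b.toSubmodule hzβ hz0 hz y (by simpa using hy))
    · exact killingForm_apply_eq_zero_of_mem_rootSpace_of_add_ne_zero K g H hxα hzβ hβ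
  exact fun y hy => hle hy

end Borel

/-! ### The Killing form on a Cartan subalgebra and on coroots. -/

section Coroots

variable {K g : Type*} [Field K] [IsAlgClosed K] [CharZero K] [LieRing g] [LieAlgebra K g]
  [FiniteDimensional K g] [IsKilling K g] {H : LieSubalgebra K g} [H.IsCartanSubalgebra]

lemma traceForm_cartan_eq_sum (x y : H) :
    traceForm K H g x y = ∑ α ∈ H.root, α x * α y := by
  have h := IsKilling.restrict_killingForm_eq_sum (K := K) (L := g) (H := H)
  have h2 := LinearMap.congr_fun₂ h x y
  simpa [LinearMap.sum_apply] using! h2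

/-- The Killing form takes positive integral values on the coroots. -/
lemma exists_nat_traceForm_coroot {α : Weight K H g} (hα : α.IsNonZero) :
    ∃ N : ℕ, 0 < N ∧ traceForm K H g (IsKilling.coroot α) (IsKilling.coroot α) = N := by
  choose c hc using fun β : Weight K H g =>
    (⟨_, IsKilling.apply_coroot_eq_cast α β⟩ : ∃ c : ℤ, β (IsKilling.coroot α) = c)
  -- On `H` the Killing form is the sum of the squares of the roots. These are integers on a coroot,
  -- and `α` itself contributes `4`.
  refine ⟨(∑ β ∈ H.root, c β ^ 2).toNat, ?_, ?_⟩
  · have h2 : c α = 2 := by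
      have h := hc α
      rw [IsKilling.root_apply_coroot hα] at h
      exact_mod_cast h.symm
    have h1 : c α ^ 2 ≤ ∑ β ∈ H.root, c β ^ 2 :=
      Finset.single_le_sum (f := fun β => c β ^ 2) (fun β _ => sq_nonneg _) (by simpa using hα)
    rw [h2] at h1
    omega
  · rw [traceForm_cartan_eq_sum]
    have h0 : (0 : ℤ) ≤ ∑ β ∈ H.root, c β ^ 2 := Finset.sum_nonneg fun β _ => sq_nonneg _
    have h1 : (((∑ β ∈ H.root, c β ^ 2).toNat : ℕ) : K) = ((∑ β ∈ H.root, c β ^ 2 : ℤ) : K) := by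
      rw [← Int.cast_natCast, Int.toNat_of_nonneg h0]
    rw [h1, Int.cast_sum]
    refine Finset.sum_congr rfl fun β _ => ?_
    rw [hc β]
    push_cast
    ring

/-- Relation between a weight and its dual element for the Killing form. -/
lemma traceForm_coroot_mul_apply {α : Weight K H g} (hα : α.IsNonZero) (lam : Dual K H) :
    traceForm K H g (IsKilling.coroot α) (IsKilling.coroot α) *
      α ((IsKilling.cartanEquivDual H).symm lam) = 2 * lam (IsKilling.coroot α) := by
  set t := (IsKilling.cartanEquivDual H).symm lam with ht
  have h1 : lam (IsKilling.coroot α) = traceForm K H g (IsKilling.coroot α) t := by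
    have : lam = IsKilling.cartanEquivDual H t := by simp [ht]
    rw [LieModule.traceForm_comm, this]
    rfl
  rw [h1, IsKilling.traceForm_coroot, IsKilling.traceForm_coroot, IsKilling.root_apply_coroot hα]
  simp only [nsmul_eq_mul, smul_eq_mul]
  push_cast
  ring

/-- This is the Killing pairing of `x` with the dual vector of `lam`. For dominant `lam` and `x` all
terms are nonnegative, so the vanishing of `lam x` can be exploited root by root. -/
lemma apply_eq_sum_root (lam : Dual K H) (x : H) :
    lam x = ∑ α ∈ H.root, α ((IsKilling.cartanEquivDual H).symm lam) * α x := by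
  rw [← traceForm_cartan_eq_sum]
  have h : lam = IsKilling.cartanEquivDual H ((IsKilling.cartanEquivDual H).symm lam) := by simp
  exact LinearMap.congr_fun h x

lemma exists_root_apply_ne_zero {x : H} (hx : x ≠ 0) :
    ∃ α : Weight K H g, α.IsNonZero ∧ α x ≠ 0 := by
  by_contra! hcon
  apply hx
  have hnd := IsKilling.ker_traceForm_eq_bot_of_isCartanSubalgebra K g H
  rw [LinearMap.ker_eq_bot'] at hnd
  apply hnd
  ext y
  rw [traceForm_cartan_eq_sum]
  refine Finset.sum_eq_zero fun α hα => ?_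
  rw [hcon α (by simpa using hα), zero_mul]

end Coroots

/-! ### Eigenvectors of Borel subalgebras. -/

section BorelEigenvector

variable {K g V : Type*} [Field K] [IsAlgClosed K] [CharZero K] [LieRing g] [LieAlgebra K g]
  [FiniteDimensional K g] [IsKilling K g] {H : LieSubalgebra K g} [H.IsCartanSubalgebra]
  [AddCommGroup V] [Module K V] [FiniteDimensional K V] [LieRingModule g V] [LieModule K g V]

/-- `v` is an eigenvector of the subalgebra `b`, with eigenvalues `χ`. -/
structure IsEigenvector (b : LieSubalgebra K g) (χ : g → K) (v : V) : Prop where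
  ne_zero : v ≠ 0
  lie_eq : ∀ x ∈ b, ⁅x, v⁆ = χ x • v

namespace IsEigenvector

variable {b : LieSubalgebra K g} {χ : g → K} {v : V}

/-- A one-dimensional representation of `b` kills brackets, and a root vector is a multiple of its
bracket with an element of `H`. -/
lemma lie_eq_zero_of_mem_rootSpace (hv : IsEigenvector b χ v) (hHb : H ≤ b)
    {α : Weight K H g} (hα : α.IsNonZero) {x : g} (hxα : x ∈ rootSpace H α) (hxb : x ∈ b) :
    ⁅x, v⁆ = 0 := by
  obtain ⟨y, hy⟩ : ∃ y, α y ≠ 0 := by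
    by_contra! hcon
    exact hα (funext hcon)
  have h1 : ⁅⁅(y : g), x⁆, v⁆ = 0 := by
    rw [lie_lie, hv.lie_eq _ hxb, lie_smul, hv.lie_eq _ (hHb y.2), lie_smul, hv.lie_eq _ hxb,
      smul_smul, smul_smul, mul_comm, sub_self]
  rw [lie_eq_smul hxα, smul_lie] at h1
  exact (smul_eq_zero.1 h1).resolve_left hy

/-- A Borel eigenvector is a highest weight vector for the `sl₂` of every root of `b`; this is the
source of integrality and dominance. -/
lemma exists_primitive (hv : IsEigenvector b χ v) (hHb : H ≤ b)
    {α : Weight K H g} (hα : α.IsNonZero) (hαb : ∀ x ∈ rootSpace H α, x ∈ b) :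
    ∃ (e f : g) (t : IsSl2Triple (IsKilling.coroot α : g) e f), e ∈ rootSpace H α ∧
      f ∈ rootSpace H (-α) ∧ t.HasPrimitiveVectorWith v (χ (IsKilling.coroot α)) := by
  obtain ⟨h, e, f, t, he, hf⟩ := IsKilling.exists_isSl2Triple_of_weight_isNonZero hα
  obtain rfl := t.h_eq_coroot hα he hf
  exact ⟨e, f, t, he, hf, hv.ne_zero, hv.lie_eq _ (hHb (IsKilling.coroot α).2),
    hv.lie_eq_zero_of_mem_rootSpace hHb hα he (hαb e he)⟩

/-- The weight of a Borel eigenvector is dominant. -/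
lemma exists_nat_apply_coroot (hv : IsEigenvector b χ v) (hHb : H ≤ b)
    {α : Weight K H g} (hα : α.IsNonZero) (hαb : ∀ x ∈ rootSpace H α, x ∈ b) :
    ∃ n : ℕ, χ (IsKilling.coroot α) = n := by
  obtain ⟨e, f, t, -, -, P⟩ := hv.exists_primitive hHb hα hαb
  exact P.exists_nat

/-- If the weight of a Borel eigenvector vanishes at the coroot of a root of the Borel, both root
spaces annihilate the vector. -/
lemma lie_eq_zero_of_apply_coroot_eq_zero (hv : IsEigenvector b χ v) (hHb : H ≤ b)
    {α : Weight K H g} (hα : α.IsNonZero) (hαb : ∀ x ∈ rootSpace H α, x ∈ b)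
    (h0 : χ (IsKilling.coroot α) = 0) :
    (∀ x ∈ rootSpace H α, ⁅x, v⁆ = 0) ∧ (∀ x ∈ rootSpace H (-α), ⁅x, v⁆ = 0) := by
  refine ⟨fun x hx => hv.lie_eq_zero_of_mem_rootSpace hHb hα hx (hαb x hx), ?_⟩
  obtain ⟨e, f, t, he, hf, P⟩ := hv.exists_primitive hHb hα hαb
  have hfv : ⁅f, v⁆ = 0 := by
    have := P.pow_toEnd_f_eq_zero_of_eq_nat (n := 0) (by simpa using h0)
    simpa using this
  have hf' : f ∈ rootSpace H (-α : Weight K H g) := by simpa using hf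
  intro x hx
  have hx' : x ∈ rootSpace H (-α : Weight K H g) := by simpa using hx
  let A : Submodule K g :=
    { carrier := {x | ⁅x, v⁆ = 0}
      add_mem' := fun {a b} (ha : ⁅a, v⁆ = 0) (hb : ⁅b, v⁆ = 0) => by
        simp [ha, hb]
      zero_mem' := by simp
      smul_mem' := fun c x (hx : ⁅x, v⁆ = 0) => by simp [hx] }
  exact rootSpace_le_or_disjoint hα.neg A hf' t.f_ne_zero hfv x hx'

variable (hb : Maximal (fun s : LieSubalgebra K g => IsSolvable s) b)
include hb

/-- The weight of a Borel eigenvector is integral. -/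
lemma exists_int_apply_coroot (hv : IsEigenvector b χ v) (hHb : H ≤ b)
    {α : Weight K H g} (hα : α.IsNonZero) :
    ∃ n : ℤ, χ (IsKilling.coroot α) = n := by
  rcases rootSpace_le_or_neg_le b hb hHb hα with h | h
  · obtain ⟨n, hn⟩ := hv.exists_nat_apply_coroot hHb hα h
    exact ⟨n, by simpa using hn⟩
  · obtain ⟨n, hn⟩ := hv.exists_nat_apply_coroot hHb hα.neg (by simpa using h)
    refine ⟨-n, ?_⟩
    have h1 := hv.lie_eq _ (hHb (IsKilling.coroot α).2)
    have h2 := hv.lie_eq _ (hHb (IsKilling.coroot (-α)).2)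
    rw [IsKilling.coroot_neg, NegMemClass.coe_neg, neg_lie, h1, ← neg_smul] at h2
    have h3 := smul_left_injective K hv.ne_zero h2
    rw [IsKilling.coroot_neg, NegMemClass.coe_neg] at hn
    have h4 : -χ (IsKilling.coroot α) = n := h3.trans hn
    push_cast
    linear_combination -h4

/-- One of `α`, `-α` is a root of `b`. Both coroots appear because `χ` is a bare function on `g`,
not assumed linear. -/
lemma lie_eq_zero_of_apply_coroot (hv : IsEigenvector b χ v) (hHb : H ≤ b)
    {α : Weight K H g} (hα : α.IsNonZero) (h0 : χ (IsKilling.coroot α) = 0)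
    (h0' : χ (IsKilling.coroot (-α)) = 0) :
    ∀ x ∈ rootSpace H α, ⁅x, v⁆ = 0 := by
  rcases rootSpace_le_or_neg_le b hb hHb hα with h | h
  · exact (hv.lie_eq_zero_of_apply_coroot_eq_zero hHb hα h h0).1
  · have := (hv.lie_eq_zero_of_apply_coroot_eq_zero hHb hα.neg (by simpa using h) h0').2
    simpa using this

/-- A Borel eigenvector of weight zero is invariant. -/
lemma lie_eq_zero_of_forall_cartan (hv : IsEigenvector b χ v) (hHb : H ≤ b)
    (h0 : ∀ y ∈ H, χ y = 0) (x : g) : ⁅x, v⁆ = 0 := by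
  let A : Submodule K g :=
    { carrier := {x | ⁅x, v⁆ = 0}
      add_mem' := fun {a b} (ha : ⁅a, v⁆ = 0) (hb : ⁅b, v⁆ = 0) => by
        simp [ha, hb]
      zero_mem' := by simp
      smul_mem' := fun c x (hx : ⁅x, v⁆ = 0) => by simp [hx] }
  suffices (⊤ : Submodule K g) ≤ A from this (Submodule.mem_top (x := x))
  refine le_of_forall_weight (H := H) ⊤ A (fun _ _ _ _ => Submodule.mem_top) fun α x _ hx => ?_
  by_cases hα : α.IsZero
  · have hxH := mem_rootSpace_zero_iff hα hx
    change ⁅x, v⁆ = 0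
    rw [hv.lie_eq x (hHb hxH), h0 x hxH, zero_smul]
  · exact hv.lie_eq_zero_of_apply_coroot hb hHb hα (h0 _ (IsKilling.coroot α).2)
      (h0 _ (IsKilling.coroot (-α)).2) x hx

/-- A Borel eigenvector whose weight vanishes at a nonzero dominant element of the Cartan
subalgebra of a simple Lie algebra is invariant. -/
lemma lie_eq_zero_of_apply_eq_zero [IsSimple K g] (hv : IsEigenvector b χ v) (hHb : H ≤ b)
    {x : H} (hx0 : x ≠ 0) (hx : ∀ α : Weight K H g, ∃ m : ℤ, α x = m ∧
      (0 < m → ∀ y ∈ rootSpace H α, y ∈ b)) (hχx : ⁅(x : g), v⁆ = 0) (z : g) : ⁅z, v⁆ = 0 := by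
  -- The eigenvector equation forces `χ` to be linear on `H`.
  have hχadd : ∀ y z : H, χ (y + z : H) = χ y + χ z := by
    intro y z
    have h1 := hv.lie_eq _ (hHb (y + z).2)
    rw [AddMemClass.coe_add, add_lie, hv.lie_eq _ (hHb y.2), hv.lie_eq _ (hHb z.2),
      ← add_smul] at h1
    exact (smul_left_injective K hv.ne_zero h1).symm
  have hχsmul : ∀ (c : K) (y : H), χ (c • y : H) = c * χ y := by
    intro c y
    have h1 := hv.lie_eq _ (hHb (c • y).2)
    rw [SetLike.val_smul, smul_lie, hv.lie_eq _ (hHb y.2), smul_smul] at h1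
    exact (smul_left_injective K hv.ne_zero h1).symm
  let lam : Dual K H := { toFun := fun y => χ y, map_add' := hχadd, map_smul' := hχsmul }
  have hlam : ∀ y : H, lam y = χ y := fun _ => rfl
  have hlamx : lam x = 0 := by
    have h1 := hv.lie_eq _ (hHb x.2)
    rw [hχx] at h1
    exact (smul_eq_zero.1 h1.symm).resolve_right hv.ne_zero
  choose m hm hmb using hx
  choose c hc using fun α : Weight K H g => (show ∃ c : ℤ, α.IsNonZero →
      lam (IsKilling.coroot α) = c by
    by_cases hα : α.IsNonZero
    · obtain ⟨n, hn⟩ := hv.exists_int_apply_coroot hb hHb hα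
      exact ⟨n, fun _ => hn⟩
    · exact ⟨0, fun h => (hα h).elim⟩)
  choose N hN using fun α : Weight K H g => (show ∃ N : ℕ, α.IsNonZero → (0 < N ∧
        traceForm K H g (IsKilling.coroot α) (IsKilling.coroot α) = N) by
    by_cases hα : α.IsNonZero
    · obtain ⟨n, hn⟩ := exists_nat_traceForm_coroot hα
      exact ⟨n, fun _ => hn⟩
    · exact ⟨0, fun h => (hα h).elim⟩)
  have hcneg : ∀ α : Weight K H g, α.IsNonZero → c (-α) = -c α := by
    intro α hα
    have h1 := hc (-α) hα.neg
    rw [IsKilling.coroot_neg, map_neg, hc α hα] at h1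
    exact_mod_cast h1.symm
  have hmneg : ∀ α : Weight K H g, m (-α) = -m α := by
    intro α
    have h1 := hm (-α)
    rw [Weight.coe_neg, Pi.neg_apply, hm α] at h1
    exact_mod_cast h1.symm
  have hcpos : ∀ α : Weight K H g, α.IsNonZero → 0 < m α → 0 ≤ c α := by
    intro α hα hmα
    obtain ⟨n, hn⟩ := hv.exists_nat_apply_coroot hHb hα (hmb α hmα)
    have h1 := hc α hα
    rw [hlam, hn] at h1
    have : (n : ℤ) = c α := by exact_mod_cast h1
    omega
  -- Both factors change sign with `α`, and when `m α > 0` the root `α` belongs to `b`, where `c` is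
  -- nonnegative.
  have hterm : ∀ α : Weight K H g, α.IsNonZero → 0 ≤ m α * c α := by
    intro α hα
    rcases lt_trichotomy (m α) 0 with h | h | h
    · have h1 := hcpos (-α) hα.neg (by rw [hmneg]; omega)
      rw [hcneg α hα] at h1
      exact mul_nonneg_of_nonpos_of_nonpos h.le (by omega)
    · simp [h]
    · exact mul_nonneg h.le (hcpos α hα h)
  -- This is `lam x = 0` expanded over the roots: the value of `α` on the dual vector of `lam` is `2
  -- c α / N α`, with `N α` the Killing norm of the coroot. It is written in `ℚ` to use positivity.
  have hsum : ∑ α ∈ H.root, (2 * (m α * c α : ℤ) / N α : ℚ) = 0 := by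
    have h1 := apply_eq_sum_root lam x
    rw [hlamx] at h1
    have h2 : ((∑ α ∈ H.root, (2 * (m α * c α : ℤ) / N α : ℚ) : ℚ) : K) = 0 := by
      rw [h1]
      push_cast
      refine Finset.sum_congr rfl fun α hα => ?_
      have hα' : α.IsNonZero := by simpa using hα
      have h3 := traceForm_coroot_mul_apply hα' lam
      obtain ⟨h4, h5⟩ := hN α hα'
      have h6 : (N α : K) ≠ 0 := by exact_mod_cast h4.ne'
      rw [h5, hc α hα'] at h3
      rw [hm α, div_eq_iff h6]
      linear_combination -(m α : K) * h3
    exact_mod_cast h2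
  have hzero : ∀ α : Weight K H g, α.IsNonZero → m α ≠ 0 → c α = 0 := by
    intro α hα hmα
    have h1 := (Finset.sum_eq_zero_iff_of_nonneg (fun β hβ => by
      have := hterm β (by simpa using hβ)
      positivity)).1 hsum α (by simpa using hα)
    have h2 : (N α : ℚ) ≠ 0 := by exact_mod_cast (hN α hα).1.ne'
    rw [div_eq_zero_iff, or_iff_left h2] at h1
    have h3 : (m α * c α : ℤ) = 0 := by
      have := (mul_eq_zero.1 h1).resolve_left two_ne_zero
      exact_mod_cast this
    exact (mul_eq_zero.1 h3).resolve_left hmα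
  have hkill : ∀ α : Weight K H g, α.IsNonZero → α x ≠ 0 → ∀ y ∈ rootSpace H α, ⁅y, v⁆ = 0 := by
    intro α hα hαx
    have hmα : m α ≠ 0 := by
      rintro h
      rw [hm α, h] at hαx
      simp at hαx
    have h1 := hzero α hα hmα
    refine hv.lie_eq_zero_of_apply_coroot hb hHb hα ?_ ?_
    · rw [← hlam, hc α hα, h1, Int.cast_zero]
    · rw [← hlam, IsKilling.coroot_neg, map_neg, hc α hα, h1, Int.cast_zero, neg_zero]
  -- the vectors annihilated by these root spaces form a submodule
  let S : Submodule K V :=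
    { carrier := {w | ∀ α : Weight K H g, α.IsNonZero → α x ≠ 0 → ∀ y ∈ rootSpace H α, ⁅y, w⁆ = 0}
      add_mem' := fun {a b} ha hb α h1 h2 y hy => by
        rw [lie_add, ha α h1 h2 y hy, hb α h1 h2 y hy, add_zero]
      zero_mem' := fun α h1 h2 y hy => lie_zero y
      smul_mem' := fun c w hw α h1 h2 y hy => by rw [lie_smul, hw α h1 h2 y hy, smul_zero] }
  -- If `β x = 0`, commuting a root vector of `β` past one of `α` produces a vector of weight `α +
  -- β`, still nonzero on `x`. If `β x ≠ 0`, the root vector already kills `w`.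
  have hS : ∀ z : g, ∀ w ∈ S, ⁅z, w⁆ ∈ S := by
    intro z w hw
    let A : Submodule K g := S.comap ((LieModule.toEnd K g V : g →ₗ[K] Module.End K V).flip w)
    suffices (⊤ : Submodule K g) ≤ A from this (Submodule.mem_top (x := z))
    refine le_of_forall_weight (H := H) ⊤ A (fun _ _ _ _ => Submodule.mem_top)
      fun β z _ hz => ?_
    change ⁅z, w⁆ ∈ S
    by_cases hβx : β x = 0
    · intro α hα hαx y hy
      have h1 : ⁅y, z⁆ ∈ rootSpace H ((α : H → K) + β) :=
        LieAlgebra.lie_mem_genWeightSpace_of_mem_genWeightSpace hy hz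
      have h2 : ⁅⁅y, z⁆, w⁆ = 0 := by
        by_cases h3 : rootSpace H ((α : H → K) + β) = ⊥
        · rw [h3, LieSubmodule.mem_bot] at h1
          rw [h1, zero_lie]
        · let γ : Weight K H g := ⟨(α : H → K) + β, h3⟩
          have hγx : γ x ≠ 0 := by
            change α x + β x ≠ 0
            rwa [hβx, add_zero]
          exact hw γ (fun h => hγx (congrFun h x)) hγx _ h1
      rw [leibniz_lie, h2, hw α hα hαx y hy, lie_zero, add_zero]
    · rw [hw β (fun h => hβx (congrFun h x)) hβx z hz]
      exact S.zero_mem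
  -- The annihilator of the submodule `S` is an ideal. It contains the root vectors nonvanishing on
  -- `x`, and some exist as `x ≠ 0`; simplicity makes it all of `g`.
  let I : LieIdeal K g :=
    { carrier := {z | ∀ w ∈ S, ⁅z, w⁆ = 0}
      add_mem' := fun {a b} ha hb w hw => by rw [add_lie, ha w hw, hb w hw, add_zero]
      zero_mem' := fun w _ => zero_lie w
      smul_mem' := fun c z hz w hw => by rw [smul_lie, hz w hw, smul_zero]
      lie_mem := fun {y z} hz w hw => by
        rw [lie_lie, hz w hw, lie_zero, hz _ (hS y w hw), sub_zero] }
  have hI : I = ⊤ := by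
    refine (IsSimple.eq_bot_or_eq_top I).resolve_left fun hbot => ?_
    obtain ⟨α, hα, hαx⟩ := exists_root_apply_ne_zero hx0
    obtain ⟨e, he, he0⟩ := α.exists_ne_zero
    have : e ∈ I := fun w hw => hw α hα hαx e he
    rw [hbot, LieSubmodule.mem_bot] at this
    exact he0 this
  have hz : z ∈ I := hI ▸ LieSubmodule.mem_top z
  exact hz v hkill

end IsEigenvector

end BorelEigenvector

/-! ### Integrality of eigenvalues for `sl₂`-triples. -/

section Sl2

variable {K g V : Type*} [Field K] [CharZero K] [LieRing g] [LieAlgebra K g]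
  [AddCommGroup V] [Module K V] [FiniteDimensional K V] [LieRingModule g V] [LieModule K g V]

/-- Some power of the raising operator of an `sl₂`-triple annihilates a weight vector. -/
lemma exists_primitive_of_eigenvector {h e f : g} (t : IsSl2Triple h e f) {m : V} (hm0 : m ≠ 0)
    {μ : K} (hm : ⁅h, m⁆ = μ • m) :
    ∃ n : ℕ, t.HasPrimitiveVectorWith ((toEnd K g V e ^ n) m) (μ + 2 * n) := by
  -- Otherwise the vectors `e ^ n m` would be eigenvectors of `h` for infinitely many distinct
  -- eigenvalues `μ + 2 n`.
  have h_exists_zero : ∃ k, (toEnd K g V e ^ k) m = 0 := by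
    by_contra! contra
    let evals (n : ℕ) : K := μ + 2 * (n : K)
    have h_inj : Function.Injective evals := fun a b hab => by
      simpa [evals, add_right_inj, mul_eq_mul_left_iff, Nat.cast_inj] using hab
    have aux (ν : Set.range evals) :
        (toEnd K g V h).HasEigenvector ν ((toEnd K g V e ^ ν.property.choose) m) := by
      set n := ν.property.choose
      refine ⟨?_, contra n⟩
      rw [Module.End.mem_eigenspace_iff, toEnd_apply_apply, ← ν.property.choose_spec]
      exact t.lie_h_pow_toEnd_e hm n
    have _i := ((toEnd K g V h).eigenvectors_linearIndependent (Set.range evals) _ aux).finite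
    exact (Set.infinite_range_of_injective h_inj) (Set.toFinite _)
  obtain ⟨n, hn_ne, hn_zero⟩ := Nat.exists_not_and_succ_of_not_zero_of_exists
    (p := fun k => (toEnd K g V e ^ k) m = 0) hm0 h_exists_zero
  exact ⟨n, hn_ne, t.lie_h_pow_toEnd_e hm n, by rwa [IsSl2Triple.lie_e_pow_toEnd_e n]⟩

/-- The eigenvalues of the semisimple element of an `sl₂`-triple are integers. -/
lemma exists_int_eigenvalue {h e f : g} (t : IsSl2Triple h e f) {m : V} (hm0 : m ≠ 0)
    {μ : K} (hm : ⁅h, m⁆ = μ • m) : ∃ k : ℤ, μ = k := by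
  obtain ⟨n, P⟩ := exists_primitive_of_eigenvector t hm0 hm
  obtain ⟨k, hk⟩ := P.exists_nat
  refine ⟨k - 2 * n, ?_⟩
  push_cast
  linear_combination hk

end Sl2

/-! ### Regular cocharacters. -/

section Regular

variable {K g : Type*} [Field K] [IsAlgClosed K] [CharZero K] [LieRing g] [LieAlgebra K g]
  [FiniteDimensional K g] [IsKilling K g] (H : LieSubalgebra K g) [H.IsCartanSubalgebra]

/-- The group generated by the semisimple elements of the `sl₂`-triples that lie in `H`. -/
def cocharacters : AddSubgroup H :=
  AddSubgroup.closure {h | ∃ e f : g, IsSl2Triple (h : g) e f}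

-- A root takes on a generator an eigenvalue of the semisimple element of a triple. Taking all
-- triples, and not only coroots, makes the group functorial for injective homomorphisms.
variable {H} in
lemma exists_int_of_mem_cocharacters {x : H} (hx : x ∈ cocharacters H) (α : Weight K H g) :
    ∃ m : ℤ, α x = m := by
  induction hx using AddSubgroup.closure_induction with
  | mem x hx =>
    obtain ⟨e, f, t⟩ := hx
    obtain ⟨y, hy, hy0⟩ := α.exists_ne_zero
    exact exists_int_eigenvalue t hy0 (lie_eq_smul hy x)
  | zero => exact ⟨0, by simp⟩
  | add x y _ _ hx hy =>
    obtain ⟨m, hm⟩ := hx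
    obtain ⟨n, hn⟩ := hy
    exact ⟨m + n, by rw [map_add, hm, hn, Int.cast_add]⟩
  | neg x _ hx =>
    obtain ⟨m, hm⟩ := hx
    exact ⟨-m, by rw [map_neg, hm, Int.cast_neg]⟩

variable {H} in
lemma coroot_mem_cocharacters {α : Weight K H g} (hα : α.IsNonZero) :
    IsKilling.coroot α ∈ cocharacters H := by
  obtain ⟨h, e, f, t, he, hf⟩ := IsKilling.exists_isSl2Triple_of_weight_isNonZero hα
  obtain rfl := t.h_eq_coroot hα he hf
  exact AddSubgroup.subset_closure ⟨e, f, t⟩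

/-- There is a cocharacter on which no root vanishes. -/
lemma exists_regular_cocharacter :
    ∃ y ∈ cocharacters H, ∀ α : Weight K H g, α.IsNonZero → α y ≠ 0 := by
  classical
  choose p hp using fun α β : Weight K H g =>
    (⟨_, IsKilling.apply_coroot_eq_cast β α⟩ : ∃ c : ℤ, α (IsKilling.coroot β) = c)
  -- Each root is a functional on rational combinations of coroots, nonzero because it is `2` on its
  -- own coroot. Finitely many nonzero functionals have a common point of nonvanishing.
  let F : H.root → Dual ℚ (H.root → ℚ) := fun α =>
    ∑ β, (p α.1 β.1 : ℚ) • LinearMap.proj β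
  have hF : ∀ α c, F α c = ∑ β, (p α.1 β.1 : ℚ) * c β := by
    intro α c
    simp [F, LinearMap.sum_apply]
  obtain ⟨c, hc⟩ := Module.Dual.exists_forall_ne_zero_of_forall_exists F fun α => by
    refine ⟨Pi.single α 1, ?_⟩
    rw [hF, Finset.sum_eq_single α]
    · have h2 : p α.1 α.1 = 2 := by
        have h := hp α.1 α.1
        rw [IsKilling.root_apply_coroot (LieSubalgebra.isNonZero_coe_root α)] at h
        exact_mod_cast h.symm
      simp [h2]
    · intro β _ hβ
      simp [Pi.single_eq_of_ne hβ]
    · simp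
  -- Clearing denominators turns the rational combination into a cocharacter.
  obtain ⟨D, hD⟩ := IsLocalization.exist_integer_multiples_of_finite (nonZeroDivisors ℤ) c
  choose c' hc' using hD
  have hD0 : ((D : ℤ) : ℚ) ≠ 0 := by exact_mod_cast nonZeroDivisors.ne_zero D.2
  refine ⟨∑ β : H.root, c' β • IsKilling.coroot β.1, ?_, fun α hα h0 => ?_⟩
  · exact AddSubgroup.sum_mem _ fun β _ => AddSubgroup.zsmul_mem _
      (coroot_mem_cocharacters (LieSubalgebra.isNonZero_coe_root β)) _
  · apply hc ⟨α, by simpa using hα⟩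
    have h1 : (∑ β : H.root, p α β.1 * c' β : ℤ) = 0 := by
      have : ((∑ β : H.root, p α β.1 * c' β : ℤ) : K) = 0 := by
        rw [← h0, map_sum]
        push_cast
        refine Finset.sum_congr rfl fun β _ => ?_
        rw [map_zsmul, hp, zsmul_eq_mul, mul_comm]
      exact_mod_cast this
    have h2 : ((D : ℤ) : ℚ) * F ⟨α, by simpa using hα⟩ c = 0 := by
      rw [hF, Finset.mul_sum]
      have h3 : ((∑ β : H.root, p α β.1 * c' β : ℤ) : ℚ) = 0 := by rw [h1, Int.cast_zero]
      rw [← h3]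
      push_cast
      refine Finset.sum_congr rfl fun β _ => ?_
      have h4 := hc' β
      simp only [algebraMap_int_eq, eq_intCast, zsmul_eq_mul] at h4
      rw [h4]
      ring
    exact (mul_eq_zero.1 h2).resolve_left hD0

/-- A cocharacter can be perturbed into a regular one without changing the sign of the roots that
do not vanish on it. -/
lemma exists_regular_refinement {x' : H} (hx' : x' ∈ cocharacters H) :
    ∃ x ∈ cocharacters H, (∀ α : Weight K H g, α.IsNonZero → α x ≠ 0) ∧
      ∀ (α : Weight K H g) (m : ℤ), α x' = m → 0 < m → ∃ m' : ℤ, 0 < m' ∧ α x = m' := by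
  obtain ⟨y, hy, hy0⟩ := exists_regular_cocharacter H
  choose p hp using fun α => exists_int_of_mem_cocharacters hx' α
  choose q hq using fun α => exists_int_of_mem_cocharacters hy α
  -- `N` exceeds all `|q α|`: the sign of a root on `N • x' + y` is that of its value on `x'` when
  -- this is nonzero, and that of `q α` otherwise.
  set N : ℤ := 1 + ∑ α : Weight K H g, |q α| with hN
  have hNq : ∀ α, |q α| < N := by
    intro α
    have := Finset.single_le_sum (f := fun α => |q α|) (fun β _ => abs_nonneg _)
      (Finset.mem_univ α)
    omega
  have hval : ∀ α : Weight K H g, α (N • x' + y) = ((N * p α + q α : ℤ) : K) := by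
    intro α
    rw [map_add, map_zsmul, hp, hq, zsmul_eq_mul]
    push_cast
    ring
  refine ⟨N • x' + y, AddSubgroup.add_mem _ (AddSubgroup.zsmul_mem _ hx' _) hy, ?_, ?_⟩
  · intro α hα h0
    rw [hval] at h0
    have h1 : N * p α + q α = 0 := by exact_mod_cast h0
    have h2 := hNq α
    by_cases hpα : p α = 0
    · rw [hpα] at h1
      apply hy0 α hα
      rw [hq]
      have : q α = 0 := by linarith
      rw [this, Int.cast_zero]
    · have h3 : |q α| = N * |p α| := by
        have : q α = -(N * p α) := by linarith
        rw [this, abs_neg, abs_mul, abs_of_nonneg (le_trans (abs_nonneg _) h2.le)]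
      have h4 : 1 ≤ |p α| := Int.one_le_abs hpα
      nlinarith [abs_nonneg (q α)]
  · intro α m hm hm0
    refine ⟨N * p α + q α, ?_, hval α⟩
    have h1 : p α = m := by
      have := hp α
      rw [hm] at this
      exact_mod_cast this.symm
    have h2 := hNq α
    have h3 := neg_abs_le (q α)
    rw [h1]
    nlinarith [abs_nonneg (q α)]

end Regular

/-! ### The Borel subalgebra of a regular cocharacter. -/

section PositiveBorel

variable {K g : Type*} [Field K] [IsAlgClosed K] [CharZero K] [LieRing g] [LieAlgebra K g]
  [FiniteDimensional K g] [IsKilling K g] {H : LieSubalgebra K g} [H.IsCartanSubalgebra]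

/-- The sum of the root spaces on which `x` takes an integral value `≥ k`. -/
def upperSum (x : H) (k : ℤ) : Submodule K g :=
  ⨆ α : {α : Weight K H g // ∃ m : ℤ, k ≤ m ∧ α x = m}, (rootSpace H α.1).toSubmodule

lemma mem_upperSum {x : H} {k m : ℤ} {α : Weight K H g} (hm : α x = m) (hkm : k ≤ m) {y : g}
    (hy : y ∈ rootSpace H α) : y ∈ upperSum x k :=
  le_iSup (fun α : {α : Weight K H g // ∃ m : ℤ, k ≤ m ∧ α x = m} =>
    (rootSpace H α.1).toSubmodule) ⟨α, m, hkm, hm⟩ hy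

lemma upperSum_le_iff {x : H} {k : ℤ} {W : Submodule K g} :
    upperSum x k ≤ W ↔ ∀ (α : Weight K H g) (m : ℤ), k ≤ m → α x = m →
      ∀ y ∈ rootSpace H α, y ∈ W := by
  rw [upperSum, iSup_le_iff]
  exact ⟨fun h α m hk hm y hy => h ⟨α, m, hk, hm⟩ hy, fun h α y hy =>
    h α.1 α.2.choose α.2.choose_spec.1 α.2.choose_spec.2 y hy⟩

lemma upperSum_anti {x : H} {k l : ℤ} (h : k ≤ l) : upperSum (g := g) x l ≤ upperSum x k :=
  upperSum_le_iff.2 fun _ _ hk hm _ hy => mem_upperSum hm (h.trans hk) hy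

/-- Brackets of `upperSum`s can be checked on root vectors. -/
lemma lie_mem_of_upperSum {x : H} {k l : ℤ} {W : Submodule K g}
    (h : ∀ (α β : Weight K H g) (m n : ℤ), k ≤ m → α x = m → l ≤ n → β x = n →
      ∀ y ∈ rootSpace H α, ∀ z ∈ rootSpace H β, ⁅y, z⁆ ∈ W) :
    ∀ y ∈ upperSum (g := g) x k, ∀ z ∈ upperSum (g := g) x l, ⁅y, z⁆ ∈ W := by
  intro y hy z hz
  have h1 : upperSum x k ≤ W.comap ((ad K g : g →ₗ[K] Module.End K g).flip z) := by
    refine upperSum_le_iff.2 fun α m hk hm y hy => ?_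
    have h2 : upperSum x l ≤ W.comap (ad K g y) :=
      upperSum_le_iff.2 fun β n hl hn z hz => h α β m n hk hm hl hn y hy z hz
    exact h2 hz
  exact h1 hy

lemma lie_mem_upperSum {x : H} {k l : ℤ} {y z : g} (hy : y ∈ upperSum x k)
    (hz : z ∈ upperSum x l) : ⁅y, z⁆ ∈ upperSum x (k + l) := by
  refine lie_mem_of_upperSum (fun α β m n hk hm hl hn y hy z hz => ?_) y hy z hz
  have h1 : ⁅y, z⁆ ∈ rootSpace H ((α : H → K) + β) :=
    LieAlgebra.lie_mem_genWeightSpace_of_mem_genWeightSpace hy hz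
  by_cases h3 : rootSpace H ((α : H → K) + β) = ⊥
  · rw [h3, LieSubmodule.mem_bot] at h1
    rw [h1]
    exact Submodule.zero_mem _
  · let γ : Weight K H g := ⟨(α : H → K) + β, h3⟩
    refine mem_upperSum (α := γ) (m := m + n) ?_ (by omega) h1
    change α x + β x = _
    rw [hm, hn, Int.cast_add]

/-- The subalgebra spanned by `H` and the root spaces on which `x` is positive. -/
def positiveBorel (x : H) : LieSubalgebra K g :=
  { upperSum (g := g) x 0 with
    lie_mem' := fun {y z} hy hz => by
      have := lie_mem_upperSum hy hz
      rwa [add_zero] at this }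

lemma le_positiveBorel (x : H) : H ≤ positiveBorel x := by
  intro y hy
  have hy' : y ∈ rootSpace H (0 : H → K) := by
    rw [rootSpace_zero_eq]
    exact hy
  by_cases h0 : rootSpace H (0 : H → K) = ⊥
  · rw [h0, LieSubmodule.mem_bot] at hy'
    rw [hy']
    exact (positiveBorel x).zero_mem
  · let α : Weight K H g := ⟨0, h0⟩
    exact mem_upperSum (α := α) (m := 0) (by simp [α]) le_rfl hy'

/-- By regularity only `H`, which is abelian, sits in degree zero, so the first bracket has degree
at least one. Each later bracket raises the degree until it exceeds every value of a root. -/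
lemma isSolvable_positiveBorel {x : H} (hx : x ∈ cocharacters H)
    (hreg : ∀ α : Weight K H g, α.IsNonZero → α x ≠ 0) : IsSolvable (positiveBorel x) := by
  have h1 : bracketSeries (positiveBorel x).toSubmodule 1 ≤ upperSum x 1 := by
    refine bracketSpan_le.2 (lie_mem_of_upperSum (k := 0) (l := 0)
      fun α β m n hk hm hl hn y hy z hz => ?_)
    have hpos : ∀ (γ : Weight K H g) (p : ℤ), 0 ≤ p → γ x = p → γ.IsNonZero → 1 ≤ p := by
      intro γ p hp hγ hnz
      have := hreg γ hnz
      rw [hγ] at this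
      have : p ≠ 0 := by
        rintro rfl
        simp at this
      omega
    by_cases hα : α.IsZero
    · by_cases hβ : β.IsZero
      · have h1 := mem_rootSpace_zero_iff hα hy
        have h2 := mem_rootSpace_zero_iff hβ hz
        have h3 : ⁅(⟨y, h1⟩ : H), (⟨z, h2⟩ : H)⁆ = 0 := trivial_lie_zero _ _ _ _
        have h4 : ⁅y, z⁆ = 0 := congrArg Subtype.val h3
        rw [h4]
        exact Submodule.zero_mem _
      · have := lie_mem_upperSum (mem_upperSum (k := 0) hm hk hy)
          (mem_upperSum (k := 1) hn (hpos β n hl hn hβ) hz)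
        rwa [zero_add] at this
    · have := lie_mem_upperSum (mem_upperSum (k := 1) hm (hpos α m hk hm hα) hy)
        (mem_upperSum (k := 0) hn hl hz)
      rwa [add_zero] at this
  have h2 : ∀ k : ℕ, bracketSeries (positiveBorel x).toSubmodule (k + 1) ≤ upperSum x (k + 1) := by
    intro k
    induction k with
    | zero => simpa using h1
    | succ k ih =>
      refine bracketSpan_le.2 fun y hy z hz => ?_
      exact upperSum_anti (by push_cast; omega) (lie_mem_upperSum (ih hy) (ih hz))
  choose p hp using fun α => exists_int_of_mem_cocharacters hx α
  refine (isSolvable_iff_bracketSeries _).2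
    ⟨(∑ α : Weight K H g, |p α|).toNat + 1, eq_bot_iff.2 ((h2 _).trans ?_)⟩
  refine upperSum_le_iff.2 fun α m hk hm y hy => ?_
  exfalso
  have h3 : p α = m := by
    have := hp α
    rw [hm] at this
    exact_mod_cast this.symm
  have h4 := Finset.single_le_sum (f := fun α => |p α|) (fun β _ => abs_nonneg _)
      (Finset.mem_univ α)
  have h5 := le_abs_self (p α)
  have h6 := Int.self_le_toNat (∑ α : Weight K H g, |p α|)
  omega

/-- A larger subalgebra is `H`-stable, so it contains a root space on which `x` is negative together
with the opposite one, hence an `sl₂`-triple. -/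
lemma maximal_positiveBorel {x : H} (hx : x ∈ cocharacters H)
    (hreg : ∀ α : Weight K H g, α.IsNonZero → α x ≠ 0) :
    Maximal (fun s : LieSubalgebra K g => IsSolvable s) (positiveBorel x) := by
  refine ⟨isSolvable_positiveBorel hx hreg, fun s hs hle => ?_⟩
  refine le_of_forall_weight (H := H) s.toSubmodule (upperSum x 0)
    (fun y hy z hz => s.lie_mem (hle (le_positiveBorel x hy)) hz) fun α y hy hyα => ?_
  obtain ⟨m, hm⟩ := exists_int_of_mem_cocharacters hx α
  by_cases hm0 : 0 ≤ m
  · exact mem_upperSum hm hm0 hyα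
  · by_cases hy0 : y = 0
    · rw [hy0]
      exact Submodule.zero_mem _
    · exfalso
      have hα : α.IsNonZero := by
        intro h
        have h1 : α x = 0 := congrFun h x
        rw [hm] at h1
        have : m = 0 := by exact_mod_cast h1
        omega
      refine not_isSolvable_of_rootSpaces_le hα s
        (rootSpace_le_or_disjoint hα s.toSubmodule hyα hy0 hy) (fun z hz => hle ?_) hs
      refine mem_upperSum (α := -α) (m := -m) ?_ (by omega) (by simpa using hz)
      rw [Weight.coe_neg, Pi.neg_apply, hm, Int.cast_neg]

end PositiveBorel

/-! ### Cocharacters and Borel subalgebras under injective homomorphisms. -/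

section Map

variable {K g g' : Type*} [Field K] [IsAlgClosed K] [CharZero K] [LieRing g] [LieAlgebra K g]
  [FiniteDimensional K g] [IsKilling K g] {H : LieSubalgebra K g} [H.IsCartanSubalgebra]
  [LieRing g'] [LieAlgebra K g']
  [FiniteDimensional K g'] [IsKilling K g'] {H' : LieSubalgebra K g'} [H'.IsCartanSubalgebra]

/-- An injective homomorphism maps `sl₂`-triples to `sl₂`-triples. -/
lemma isSl2Triple_map {h e f : g} (t : IsSl2Triple h e f) (φ : g →ₗ⁅K⁆ g')
    (hφ : Function.Injective φ) : IsSl2Triple (φ h) (φ e) (φ f) where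
  h_ne_zero := fun h0 => t.h_ne_zero (hφ (by rw [h0, map_zero]))
  lie_e_f := by rw [← LieHom.map_lie, t.lie_e_f]
  lie_h_e_nsmul := by rw [← LieHom.map_lie, t.lie_h_e_nsmul, map_nsmul]
  lie_h_f_nsmul := by rw [← LieHom.map_lie, t.lie_h_f_nsmul, map_neg, map_nsmul]

/-- The restriction of a homomorphism to Cartan subalgebras. -/
def cartanMap (φ : g →ₗ⁅K⁆ g') (hH : ∀ y ∈ H, φ y ∈ H') : H →ₗ[K] H' :=
  ((φ : g →ₗ[K] g').comp H.toSubmodule.subtype).codRestrict H'.toSubmodule fun y => hH y y.2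

@[simp] lemma coe_cartanMap (φ : g →ₗ⁅K⁆ g') (hH : ∀ y ∈ H, φ y ∈ H') (y : H) :
    (cartanMap φ hH y : g') = φ y := rfl

lemma cartanMap_mem_cocharacters (φ : g →ₗ⁅K⁆ g') (hφ : Function.Injective φ)
    (hH : ∀ y ∈ H, φ y ∈ H') {x : H} (hx : x ∈ cocharacters H) :
    cartanMap φ hH x ∈ cocharacters H' := by
  induction hx using AddSubgroup.closure_induction with
  | mem x hx =>
    obtain ⟨e, f, t⟩ := hx
    exact AddSubgroup.subset_closure ⟨φ e, φ f, isSl2Triple_map t φ hφ⟩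
  | zero => simp
  | add x y _ _ hx hy => simpa using AddSubgroup.add_mem _ hx hy
  | neg x _ hx => simpa using hx

/-- A root vector positive on `x` maps to an eigenvector of `φ x` with positive eigenvalue. Its
components lie in root spaces positive on `φ x`, hence on `x'`. Equality follows from maximality,
the preimage being solvable. -/
lemma positiveBorel_eq_comap (φ : g →ₗ⁅K⁆ g') (hφ : Function.Injective φ)
    (hH : ∀ y ∈ H, φ y ∈ H') {x : H} (hx : x ∈ cocharacters H)
    (hreg : ∀ α : Weight K H g, α.IsNonZero → α x ≠ 0) {x' : H'} (hx' : x' ∈ cocharacters H')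
    (hreg' : ∀ α : Weight K H' g', α.IsNonZero → α x' ≠ 0)
    (hxx' : ∀ (α : Weight K H' g') (m : ℤ), α (cartanMap φ hH x) = m → 0 < m →
      ∃ m' : ℤ, 0 < m' ∧ α x' = m') :
    positiveBorel x = (positiveBorel x').comap φ := by
  have hle : positiveBorel x ≤ (positiveBorel x').comap φ := by
    refine upperSum_le_iff.2 fun α m hm0 hm y hy => ?_
    change φ y ∈ positiveBorel x'
    by_cases hα : α.IsZero
    · exact le_positiveBorel x' (hH y (mem_rootSpace_zero_iff hα hy))
    · have hmpos : 0 < m := by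
        have h1 := hreg α hα
        rw [hm] at h1
        have : m ≠ 0 := by
          rintro rfl
          simp at h1
        omega
      let U : Submodule K g' :=
        { carrier := {z | ⁅φ x, z⁆ = (m : K) • z}
          add_mem' := fun {a b} (ha : ⁅φ x, a⁆ = _) (hb : ⁅φ x, b⁆ = _) => by
            simp [ha, hb]
          zero_mem' := by simp
          smul_mem' := fun c z (hz : ⁅φ x, z⁆ = _) => by
            simp only [Set.mem_ofPred_eq, lie_smul, hz]
            rw [smul_comm] }
      have hyU : φ y ∈ U := by
        change ⁅φ x, φ y⁆ = (m : K) • φ y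
        rw [← LieHom.map_lie, lie_eq_smul hy x, hm, map_smul]
      suffices U ≤ upperSum x' 0 from this hyU
      refine le_of_forall_weight (H := H') U _ (fun w hw z hz => ?_) fun β z hz hzβ => ?_
      · change ⁅φ x, ⁅w, z⁆⁆ = (m : K) • ⁅w, z⁆
        have h1 : ⁅cartanMap φ hH x, (⟨w, hw⟩ : H')⁆ = 0 := trivial_lie_zero _ _ _ _
        have h2 : ⁅φ x, w⁆ = 0 := congrArg Subtype.val h1
        have h3 : ⁅φ x, z⁆ = (m : K) • z := hz
        rw [leibniz_lie, h2, zero_lie, zero_add, h3, lie_smul]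
      · by_cases hz0 : z = 0
        · rw [hz0]
          exact Submodule.zero_mem _
        · have h1 : ⁅φ x, z⁆ = (m : K) • z := hz
          have h2 := lie_eq_smul hzβ (cartanMap φ hH x)
          rw [coe_cartanMap, h1] at h2
          obtain ⟨m', hm', hβ⟩ := hxx' β m (smul_left_injective K hz0 h2).symm hmpos
          exact mem_upperSum hβ hm'.le hzβ
  refine le_antisymm hle ?_
  exact (maximal_positiveBorel hx hreg).2
    (isSolvable_comap φ hφ _ (isSolvable_positiveBorel hx' hreg')) hle

end Map

/-! ### Natural representations of special linear and isometry algebras. -/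

section Natural

open Matrix

variable {K ι : Type*} [Field K] [Fintype ι] [DecidableEq ι]

/-- `g` is the special linear Lie algebra of degree at least two. -/
structure IsSpecialLinear (g : LieSubalgebra K (Matrix ι ι K)) : Prop where
  two_le_card : 2 ≤ Fintype.card ι
  mem_iff : ∀ x, x ∈ g ↔ x.trace = 0

/-- `g` is the Lie algebra of a nondegenerate `ε`-symmetric form `J`. -/
structure IsIsometryAlgebra (g : LieSubalgebra K (Matrix ι ι K)) (J : Matrix ι ι K) (ε : K) :
    Prop where
  two_le_card : 2 ≤ Fintype.card ι
  -- This excludes the orthogonal algebra of a plane, whose natural representation is reducible.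
  three_le_card : ε = 1 → 3 ≤ Fintype.card ι
  isUnit : IsUnit J
  transpose_eq : Jᵀ = ε • J
  sign : ε = 1 ∨ ε = -1
  mem_iff : ∀ x, x ∈ g ↔ xᵀ * J + J * x = 0

lemma exists_dotProduct_eq_one {v : ι → K} (hv : v ≠ 0) : ∃ a : ι → K, a ⬝ᵥ v = 1 := by
  obtain ⟨i, hi⟩ := Function.ne_iff.1 hv
  exact ⟨Pi.single i (v i)⁻¹, by simp [inv_mul_cancel₀ hi]⟩

lemma exists_ne_zero_dotProduct_eq_zero (h : 2 ≤ Fintype.card ι) (c : ι → K) :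
    ∃ u : ι → K, u ≠ 0 ∧ u ⬝ᵥ c = 0 := by
  have h1 : LinearMap.ker (dotProductBilin K K c : (ι → K) →ₗ[K] K) ≠ ⊥ :=
    LinearMap.ker_ne_bot_of_finrank_lt (by simp; omega)
  obtain ⟨u, hu, hu0⟩ := (Submodule.ne_bot_iff _).1 h1
  exact ⟨u, hu0, by rw [dotProduct_comm]; exact hu⟩

lemma IsSpecialLinear.eq_zero_of_mulVec_eq_zero {g : LieSubalgebra K (Matrix ι ι K)}
    (h : IsSpecialLinear g) {v : ι → K} (hv : ∀ x ∈ g, x *ᵥ v = 0) : v = 0 := by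
  by_contra hv0
  obtain ⟨i, hi⟩ := Function.ne_iff.1 hv0
  obtain ⟨j, hj⟩ := Fintype.exists_ne_of_one_lt_card h.two_le_card i
  have := congrFun (hv (Matrix.single j i 1)
    ((h.mem_iff _).2 (trace_single_eq_of_ne _ _ _ hj))) j
  rw [single_mulVec, Function.update_self] at this
  exact hi (by simpa using this)

lemma IsSpecialLinear.eq_zero_of_transpose_mulVec_eq_zero {g : LieSubalgebra K (Matrix ι ι K)}
    (h : IsSpecialLinear g) {v : ι → K} (hv : ∀ x ∈ g, xᵀ *ᵥ v = 0) : v = 0 :=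
  h.eq_zero_of_mulVec_eq_zero fun x hx => by
    have := hv xᵀ ((h.mem_iff _).2 (by rw [trace_transpose]; exact (h.mem_iff _).1 hx))
    rwa [transpose_transpose] at this

namespace IsIsometryAlgebra

variable {g : LieSubalgebra K (Matrix ι ι K)} {J : Matrix ι ι K} {ε : K}

lemma sign_mul_self (h : IsIsometryAlgebra g J ε) : ε * ε = 1 := by
  rcases h.sign with h | h <;> simp [h]

lemma inv_mul_self (h : IsIsometryAlgebra g J ε) : J⁻¹ * J = 1 :=
  nonsing_inv_mul J ((isUnit_iff_isUnit_det J).1 h.isUnit)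

lemma mul_inv_self (h : IsIsometryAlgebra g J ε) : J * J⁻¹ = 1 :=
  mul_nonsing_inv J ((isUnit_iff_isUnit_det J).1 h.isUnit)

lemma inv_transpose_mul (h : IsIsometryAlgebra g J ε) : (J⁻¹)ᵀ * J = ε • (1 : Matrix ι ι K) := by
  have h1 : J = ε • Jᵀ := by rw [h.transpose_eq, smul_smul, h.sign_mul_self, one_smul]
  calc (J⁻¹)ᵀ * J = (J⁻¹)ᵀ * (ε • Jᵀ) := by rw [← h1]
    _ = ε • (J * J⁻¹)ᵀ := by rw [Matrix.mul_smul, transpose_mul]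
    _ = _ := by rw [h.mul_inv_self, transpose_one]

/-- The skew part of a matrix with respect to the form. -/
lemma skew_mem (h : IsIsometryAlgebra g J ε) (M : Matrix ι ι K) : M - J⁻¹ * Mᵀ * J ∈ g := by
  rw [h.mem_iff]
  simp only [transpose_sub, transpose_mul, transpose_transpose, sub_mul, mul_sub]
  rw [h.transpose_eq, ← Matrix.mul_assoc J, ← Matrix.mul_assoc J, h.mul_inv_self, Matrix.one_mul,
    Matrix.mul_assoc, Matrix.mul_assoc, h.inv_transpose_mul]
  simp only [Matrix.mul_smul, Matrix.smul_mul, Matrix.mul_one, smul_smul, h.sign_mul_self,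
    one_smul]
  abel

/-- Elementary skew operators have rank at most two. They serve both for irreducibility and for the
rank bound on root vectors. -/
lemma skew_mulVec (u a v : ι → K) :
    (vecMulVec u a - J⁻¹ * (vecMulVec u a)ᵀ * J) *ᵥ v =
      (a ⬝ᵥ v) • u - (u ⬝ᵥ J *ᵥ v) • (J⁻¹ *ᵥ a) := by
  rw [sub_mulVec, transpose_vecMulVec, ← mulVec_mulVec, ← mulVec_mulVec, vecMulVec_mulVec,
    vecMulVec_mulVec]
  simp [mulVec_smul]

lemma eq_zero_of_mulVec_eq_zero (h : IsIsometryAlgebra g J ε) {v : ι → K}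
    (hv : ∀ x ∈ g, x *ᵥ v = 0) : v = 0 := by
  by_contra hv0
  obtain ⟨a, ha⟩ := exists_dotProduct_eq_one hv0
  obtain ⟨u, hu0, hu⟩ := exists_ne_zero_dotProduct_eq_zero h.two_le_card (J *ᵥ v)
  have := hv _ (h.skew_mem (vecMulVec u a))
  rw [skew_mulVec, ha, hu, zero_smul, sub_zero, one_smul] at this
  exact hu0 this

/-- The form `J` intertwines the natural representation with its dual. -/
lemma transpose_mulVec (h : IsIsometryAlgebra g J ε) {x : Matrix ι ι K} (hx : x ∈ g) (v : ι → K) :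
    (-xᵀ) *ᵥ v = J *ᵥ x *ᵥ J⁻¹ *ᵥ v := by
  have h1 := eq_neg_of_add_eq_zero_right ((h.mem_iff x).1 hx)
  rw [mulVec_mulVec, mulVec_mulVec, h1, neg_mul, Matrix.mul_assoc, h.mul_inv_self, Matrix.mul_one]

lemma eq_zero_of_transpose_mulVec_eq_zero (h : IsIsometryAlgebra g J ε) {v : ι → K}
    (hv : ∀ x ∈ g, xᵀ *ᵥ v = 0) : v = 0 := by
  have h1 : J⁻¹ *ᵥ v = 0 := h.eq_zero_of_mulVec_eq_zero fun x hx => by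
    have h2 := h.transpose_mulVec hx v
    rw [neg_mulVec, hv x hx, neg_zero] at h2
    have h3 := congrArg (J⁻¹ *ᵥ ·) h2.symm
    simpa [mulVec_mulVec, ← Matrix.mul_assoc, h.inv_mul_self] using h3
  have h2 := congrArg (J *ᵥ ·) h1
  simpa [mulVec_mulVec, h.mul_inv_self] using h2

lemma exists_dotProduct_mulVec_ne_zero (h : IsIsometryAlgebra g J ε) {v : ι → K} (hv : v ≠ 0) :
    ∃ w : ι → K, w ⬝ᵥ J *ᵥ v = 1 := by
  refine exists_dotProduct_eq_one fun h0 => hv ?_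
  have := congrArg (J⁻¹ *ᵥ ·) h0
  simpa [mulVec_mulVec, h.inv_mul_self] using this

/-- The natural representation of the isometry algebra of a form is irreducible. -/
lemma eq_top_of_stable (h : IsIsometryAlgebra g J ε) [CharZero K] (W : Submodule K (ι → K))
    (hW : ∀ x ∈ g, ∀ v ∈ W, x *ᵥ v ∈ W) {v : ι → K} (hv : v ∈ W) (hv0 : v ≠ 0) : W = ⊤ := by
  have hJ : ∀ a : ι → K, J⁻¹ *ᵥ (J *ᵥ a) = a := fun a => by
    rw [mulVec_mulVec, h.inv_mul_self, one_mulVec]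
  have hsymm : ∀ a b : ι → K, a ⬝ᵥ J *ᵥ b = ε * (b ⬝ᵥ J *ᵥ a) := by
    intro a b
    rw [dotProduct_mulVec, ← mulVec_transpose, h.transpose_eq, smul_mulVec, smul_dotProduct,
      dotProduct_comm, smul_eq_mul]
  -- the action of the elementary skew matrices
  have key : ∀ v ∈ W, ∀ u w : ι → K,
      (w ⬝ᵥ J *ᵥ v) • u - ε • (u ⬝ᵥ J *ᵥ v) • w ∈ W := by
    intro v hv u w
    have h1 := hW _ (h.skew_mem (vecMulVec u (ε • J *ᵥ w))) v hv
    rw [skew_mulVec, mulVec_smul, hJ, smul_dotProduct, dotProduct_comm, smul_eq_mul, hsymm v w,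
      ← mul_assoc, h.sign_mul_self, one_mul, smul_comm] at h1
    exact h1
  -- With `w` normalized against `v`, the elementary operator sends `v` to any prescribed `u`
  -- orthogonal to `v`; so `W` contains the orthogonal of each of its nonzero vectors.
  have hperp : ∀ v ∈ W, v ≠ 0 → ∀ u, u ⬝ᵥ J *ᵥ v = 0 → u ∈ W := by
    intro v hv hv0 u hu
    obtain ⟨w, hw⟩ := h.exists_dotProduct_mulVec_ne_zero hv0
    have := key v hv u w
    rwa [hw, hu, zero_smul, smul_zero, sub_zero, one_smul] at this
  rw [eq_top_iff]
  rintro u -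
  rcases h.sign with hε | hε
  · -- take a second vector orthogonal to the first one
    have h3 := h.three_le_card hε
    have h1 : LinearMap.ker (((dotProductBilin K K (J *ᵥ v) : (ι → K) →ₗ[K] K).prod
        (dotProductBilin K K (J *ᵥ u) : (ι → K) →ₗ[K] K))) ≠ ⊥ :=
      LinearMap.ker_ne_bot_of_finrank_lt (by simp; omega)
    obtain ⟨w, hw, hw0⟩ := (Submodule.ne_bot_iff _).1 h1
    have hw1 : (J *ᵥ v) ⬝ᵥ w = 0 := congrArg Prod.fst hw
    have hw2 : (J *ᵥ u) ⬝ᵥ w = 0 := congrArg Prod.snd hw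
    rw [dotProduct_comm] at hw1 hw2
    refine hperp w (hperp v hv hv0 w hw1) hw0 u ?_
    rw [hsymm, hw2, mul_zero]
  · -- in the alternating case every vector is obtained from one that is not orthogonal to it
    have hmem : ∀ w : ι → K, w ⬝ᵥ J *ᵥ v ≠ 0 → w ∈ W := by
      intro w hw
      have := key v hv w w
      rw [hε, neg_one_smul, sub_neg_eq_add, ← two_smul K, smul_smul] at this
      exact (W.smul_mem_iff (mul_ne_zero two_ne_zero hw)).1 this
    by_cases hu : u ⬝ᵥ J *ᵥ v = 0
    · exact hperp v hv hv0 u hu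
    · exact hmem u hu

end IsIsometryAlgebra

end Natural

/-! ### Reduction of the four series to two cases. -/

section Classical

open Matrix

variable {K : Type*} [Field K]

lemma isLieAbelian_of_card_le_one {ι : Type*} [Fintype ι] [DecidableEq ι]
    (h : Fintype.card ι ≤ 1) (g : LieSubalgebra K (Matrix ι ι K)) : IsLieAbelian g := by
  haveI := Fintype.card_le_one_iff_subsingleton.1 h
  refine ⟨fun x y => Subtype.ext ?_⟩
  rw [LieSubalgebra.coe_bracket, LieRing.of_associative_ring_bracket]
  ext i j
  have hsum : ∀ f : ι → K, ∑ k, f k = f i := fun f => by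
    rw [Finset.sum_eq_single i (fun k _ hk => (hk (Subsingleton.elim k i)).elim) (by simp)]
  simp [mul_apply, hsum, Subsingleton.elim j i, mul_comm]

lemma mem_skewAdjoint_iff {ι : Type*} [Fintype ι] [DecidableEq ι] (J x : Matrix ι ι K) :
    x ∈ skewAdjointMatricesLieSubalgebra J ↔ xᵀ * J + J * x = 0 := by
  rw [mem_skewAdjointMatricesLieSubalgebra, mem_skewAdjointMatricesSubmodule,
    Matrix.IsSkewAdjoint, Matrix.IsAdjointPair, mul_neg, eq_neg_iff_add_eq_zero]

lemma card_index_B (r : ℕ) : Fintype.card (ClassicalType.B.Index r) = 2 * r + 1 := by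
  have : Fintype.card (Unit ⊕ (Fin r ⊕ Fin r)) = 2 * r + 1 := by
    simp only [Fintype.card_sum, Fintype.card_unit, Fintype.card_fin]
    omega
  exact this

lemma card_index_C (r : ℕ) : Fintype.card (ClassicalType.C.Index r) = 2 * r := by
  have : Fintype.card (Fin r ⊕ Fin r) = 2 * r := by
    simp only [Fintype.card_sum, Fintype.card_fin]
    omega
  exact this

lemma card_index_D (r : ℕ) : Fintype.card (ClassicalType.D.Index r) = 2 * r := card_index_C r

/-- The off-diagonal blocks are skew of size one, hence zero. Simplicity thereby rules out rank one
in type `D`. -/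
lemma isLieAbelian_typeD_one [CharZero K] :
    IsLieAbelian (LieAlgebra.Orthogonal.typeD (Fin 1) K) := by
  refine ⟨fun x y => Subtype.ext ?_⟩
  have key : ∀ x ∈ LieAlgebra.Orthogonal.typeD (Fin 1) K, x = fromBlocks x.toBlocks₁₁ 0 0
      (-x.toBlocks₁₁) := by
    intro x hx
    rw [LieAlgebra.Orthogonal.typeD, mem_skewAdjoint_iff] at hx
    obtain ⟨a, b, c, d, rfl⟩ : ∃ a b c d, x = fromBlocks a b c d :=
      ⟨_, _, _, _, (fromBlocks_toBlocks x).symm⟩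
    rw [LieAlgebra.Orthogonal.JD, fromBlocks_transpose, fromBlocks_multiply,
      fromBlocks_multiply, fromBlocks_add, ← fromBlocks_zero, fromBlocks_inj] at hx
    obtain ⟨h1, h2, -, h4⟩ := hx
    have hs : ∀ m : Matrix (Fin 1) (Fin 1) K, mᵀ = m := fun m => by
      ext i j
      rw [transpose_apply, Subsingleton.elim i j]
    simp only [hs, mul_zero, mul_one, zero_mul, one_mul, zero_add, add_zero] at h1 h2 h4
    have hc : c = 0 := by rw [← two_smul K] at h1; exact (smul_eq_zero.1 h1).resolve_left two_ne_zero
    have hb : b = 0 := by rw [← two_smul K] at h4; exact (smul_eq_zero.1 h4).resolve_left two_ne_zero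
    rw [toBlocks_fromBlocks₁₁, hb, hc, ← neg_eq_of_add_eq_zero_right h2]
  have hcomm : ∀ a b : Matrix (Fin 1) (Fin 1) K, a * b = b * a := fun a b => by
    ext i j
    simp [mul_apply, Subsingleton.elim i 0, Subsingleton.elim j 0, mul_comm]
  rw [LieSubalgebra.coe_bracket, LieRing.of_associative_ring_bracket, key x.1 x.2, key y.1 y.2,
    fromBlocks_multiply, fromBlocks_multiply]
  simp [hcomm y.1.toBlocks₁₁]

lemma isUnit_JD (r : ℕ) : IsUnit (LieAlgebra.Orthogonal.JD (Fin r) K) := by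
  have : LieAlgebra.Orthogonal.JD (Fin r) K * LieAlgebra.Orthogonal.JD (Fin r) K = 1 := by
    simp [LieAlgebra.Orthogonal.JD, fromBlocks_multiply]
  exact IsUnit.of_mul_eq_one _ this

lemma isUnit_JB [CharZero K] (r : ℕ) : IsUnit (LieAlgebra.Orthogonal.JB (Fin r) K) := by
  have : LieAlgebra.Orthogonal.JB (Fin r) K *
      fromBlocks ((2 : K)⁻¹ • 1) 0 0 (LieAlgebra.Orthogonal.JD (Fin r) K) = 1 := by
    simp [LieAlgebra.Orthogonal.JB, LieAlgebra.Orthogonal.JD, fromBlocks_multiply]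
  exact IsUnit.of_mul_eq_one _ this

lemma isUnit_J (r : ℕ) : IsUnit (Matrix.J (Fin r) K) := by
  have : Matrix.J (Fin r) K * (-Matrix.J (Fin r) K) = 1 := by
    rw [mul_neg, J_squared, neg_neg]
  exact IsUnit.of_mul_eq_one _ this

lemma transpose_JD (r : ℕ) :
    (LieAlgebra.Orthogonal.JD (Fin r) K)ᵀ = (1 : K) • LieAlgebra.Orthogonal.JD (Fin r) K := by
  rw [one_smul]
  simp [LieAlgebra.Orthogonal.JD, fromBlocks_transpose]

lemma transpose_JB (r : ℕ) :
    (LieAlgebra.Orthogonal.JB (Fin r) K)ᵀ = (1 : K) • LieAlgebra.Orthogonal.JB (Fin r) K := by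
  rw [one_smul]
  simp [LieAlgebra.Orthogonal.JB, LieAlgebra.Orthogonal.JD, fromBlocks_transpose]

lemma transpose_J (r : ℕ) : (Matrix.J (Fin r) K)ᵀ = (-1 : K) • Matrix.J (Fin r) K := by
  rw [J_transpose, neg_one_smul]

/-- A simple classical Lie algebra is either special linear or the isometry algebra of a form. -/
lemma classical_cases [CharZero K] (t : ClassicalType) (r : ℕ)
    (hs : LieAlgebra.IsSimple K (classical K t r)) :
    (t = .A ∧ IsSpecialLinear (classical K t r)) ∨
      (t ≠ .A ∧ ∃ J ε, IsIsometryAlgebra (classical K t r) J ε) := by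
  have hna := hs.non_abelian
  have hcard : 2 ≤ Fintype.card (t.Index r) := by
    by_contra hlt
    exact hna (isLieAbelian_of_card_le_one (by omega) _)
  match t with
  | .A => exact Or.inl ⟨rfl, hcard, fun x => LinearMap.mem_ker⟩
  | .B =>
    refine Or.inr ⟨by simp, LieAlgebra.Orthogonal.JB (Fin r) K, 1, hcard, fun _ => ?_,
      isUnit_JB r, transpose_JB r, Or.inl rfl, fun x => mem_skewAdjoint_iff _ _⟩
    have := card_index_B r
    omega
  | .C =>
    refine Or.inr ⟨by simp, Matrix.J (Fin r) K, -1, hcard, fun h => ?_, isUnit_J r,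
      transpose_J r, Or.inr rfl, fun x => mem_skewAdjoint_iff _ _⟩
    norm_num [neg_eq_iff_add_eq_zero] at h
  | .D =>
    refine Or.inr ⟨by simp, LieAlgebra.Orthogonal.JD (Fin r) K, 1, hcard, fun _ => ?_,
      isUnit_JD r, transpose_JD r, Or.inl rfl, fun x => mem_skewAdjoint_iff _ _⟩
    have h1 := card_index_D r
    have h2 : r ≠ 1 := by
      rintro rfl
      exact hna isLieAbelian_typeD_one
    omega

lemma eq_zero_of_mulVec_eq_zero [CharZero K] {t : ClassicalType} {r : ℕ}
    (hs : LieAlgebra.IsSimple K (classical K t r)) {v : t.Index r → K}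
    (hv : ∀ x : classical K t r, x.1 *ᵥ v = 0) : v = 0 := by
  rcases classical_cases t r hs with ⟨-, h⟩ | ⟨-, J, ε, h⟩
  · exact h.eq_zero_of_mulVec_eq_zero fun x hx => hv ⟨x, hx⟩
  · exact h.eq_zero_of_mulVec_eq_zero fun x hx => hv ⟨x, hx⟩

lemma eq_zero_of_transpose_mulVec_eq_zero [CharZero K] {t : ClassicalType} {r : ℕ}
    (hs : LieAlgebra.IsSimple K (classical K t r)) {v : t.Index r → K}
    (hv : ∀ x : classical K t r, x.1ᵀ *ᵥ v = 0) : v = 0 := by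
  rcases classical_cases t r hs with ⟨-, h⟩ | ⟨-, J, ε, h⟩
  · exact h.eq_zero_of_transpose_mulVec_eq_zero fun x hx => hv ⟨x, hx⟩
  · exact h.eq_zero_of_transpose_mulVec_eq_zero fun x hx => hv ⟨x, hx⟩

end Classical

/-! ### Lie modules from representations, as a type synonym, since one column space carries both the
natural representation and its dual. -/

section RepModule

variable {K g V : Type*} [Field K] [LieRing g] [LieAlgebra K g] [AddCommGroup V] [Module K V]

/-- The Lie module attached to a representation. -/
def RepModule (_ρ : g →ₗ⁅K⁆ Module.End K V) : Type _ := V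

variable (ρ : g →ₗ⁅K⁆ Module.End K V)

instance : AddCommGroup (RepModule ρ) := inferInstanceAs (AddCommGroup V)

instance : Module K (RepModule ρ) := inferInstanceAs (Module K V)

instance [FiniteDimensional K V] : FiniteDimensional K (RepModule ρ) :=
  inferInstanceAs (FiniteDimensional K V)

instance : LieRingModule g (RepModule ρ) where
  bracket x v := ρ x v
  add_lie x y v := by
    have h := LinearMap.congr_fun (map_add ρ x y) (show V from v)
    exact h
  lie_add x v w := (ρ x).map_add v w
  leibniz_lie x y v := by
    have h : ∀ w : V, ρ x (ρ y w) = ρ ⁅x, y⁆ w + ρ y (ρ x w) := fun w => by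
      rw [LieHom.map_lie, LieRing.of_associative_ring_bracket, LinearMap.sub_apply]
      simp [Module.End.mul_apply]
    exact h v

instance : LieModule K g (RepModule ρ) where
  smul_lie c x v := by
    have h := LinearMap.congr_fun (map_smul ρ c x) (show V from v)
    exact h
  lie_smul c x v := (ρ x).map_smul c v

end RepModule

/-! ### Weights of Borel eigenvectors. -/

section Extremal

variable {K g V : Type*} [Field K] [IsAlgClosed K] [CharZero K] [LieRing g] [LieAlgebra K g]
  [FiniteDimensional K g] (H b : LieSubalgebra K g)
  [AddCommGroup V] [Module K V] [FiniteDimensional K V]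

/-- `lam` is the weight of an eigenvector of `b` in the representation `ρ`. -/
def IsExtremalWeight (ρ : g →ₗ⁅K⁆ Module.End K V) (lam : Dual K H) : Prop :=
  ∃ (χ : g → K) (v : RepModule ρ), IsEigenvector b χ v ∧ ∀ y : H, χ y = lam y

variable {H b}

/-- These are weights of `H` on a finite-dimensional module. Finiteness feeds the inverse limit
argument. -/
lemma finite_isExtremalWeight [H.IsCartanSubalgebra] (hHb : H ≤ b)
    (ρ : g →ₗ⁅K⁆ Module.End K V) : {lam | IsExtremalWeight H b ρ lam}.Finite := by
  have h1 : (Set.range fun α : Weight K H (RepModule ρ) => (α : H → K)).Finite :=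
    Set.finite_range _
  refine (h1.preimage (f := fun lam : Dual K H => (lam : H → K))
    DFunLike.coe_injective.injOn).subset ?_
  rintro lam ⟨χ, v, hv, hlam⟩
  refine ⟨⟨lam, fun hbot => hv.ne_zero ?_⟩, rfl⟩
  have h2 : v ∈ weightSpace (RepModule ρ) (lam : H → K) := by
    rw [mem_weightSpace]
    intro y
    have := hv.lie_eq y (hHb y.2)
    rw [hlam y] at this
    exact this
  have h3 := weightSpace_le_genWeightSpace (RepModule ρ) (lam : H → K) h2
  rwa [hbot, LieSubmodule.mem_bot] at h3

lemma exists_isExtremalWeight [Nontrivial V] (hb : IsSolvable b) (hHb : H ≤ b)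
    (ρ : g →ₗ⁅K⁆ Module.End K V) : ∃ lam, IsExtremalWeight H b ρ lam := by
  classical
  obtain ⟨χ, v, hv, h⟩ := exists_common_eigenvector (ρ.comp b.incl)
  -- The character lives on `b`; its extension by zero is never evaluated outside `b`.
  refine ⟨χ.comp (Submodule.inclusion (show H.toSubmodule ≤ b.toSubmodule from hHb)),
    fun x => if hx : x ∈ b then χ ⟨x, hx⟩ else 0, v, ⟨hv, fun x hx => ?_⟩, fun y => ?_⟩
  · rw [dif_pos hx]
    exact h ⟨x, hx⟩
  · exact dif_pos (hHb y.2)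

/-- Extremal weights restrict to extremal weights along intertwining maps. -/
lemma IsExtremalWeight.of_intertwine {g' V' : Type*} [LieRing g'] [LieAlgebra K g']
    [FiniteDimensional K g'] [AddCommGroup V'] [Module K V'] [FiniteDimensional K V']
    {H' b' : LieSubalgebra K g'} (φ : g →ₗ⁅K⁆ g') (hb : ∀ x ∈ b, φ x ∈ b')
    (hH : ∀ x ∈ H, φ x ∈ H') {ρ : g →ₗ⁅K⁆ Module.End K V} {ρ' : g' →ₗ⁅K⁆ Module.End K V'}
    {lam' : Dual K H'} {χ : g' → K} {v : RepModule ρ'} (hv : IsEigenvector b' χ v)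
    (hlam : ∀ y : H', χ y = lam' y) (T : V' →ₗ[K] V) (hT : ∀ x w, T (ρ' (φ x) w) = ρ x (T w))
    (hTv : T v ≠ 0) : IsExtremalWeight H b ρ (lam'.comp (cartanMap φ hH)) := by
  refine ⟨fun x => χ (φ x), T v, ⟨hTv, fun x hx => ?_⟩, fun y => hlam (cartanMap φ hH y)⟩
  have h1 := hv.lie_eq _ (hb x hx)
  calc ρ x (T v) = T (ρ' (φ x) v) := (hT x v).symm
    _ = T (χ (φ x) • (show V' from v)) := congrArg T h1
    _ = _ := T.map_smul _ _

end Extremal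

/-! ### Natural and dual representations under diagonal embeddings. -/

section NatRep

open Matrix

variable {K : Type*} [Field K]

/-- The natural representation (for `true`) and its dual (for `false`), on matrices. -/
def act {ι : Type*} [Fintype ι] [DecidableEq ι] (σ : Bool) (x : Matrix ι ι K) : Matrix ι ι K :=
  if σ then x else -xᵀ

/-- The natural representation (for `true`) and its dual (for `false`). -/
def natRep {ι : Type*} [Fintype ι] [DecidableEq ι] (g : LieSubalgebra K (Matrix ι ι K))
    (σ : Bool) : g →ₗ⁅K⁆ Module.End K (ι → K) where
  toFun x := Matrix.toLin' (act σ x.1)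
  map_add' x y := by
    cases σ <;> simp [act, add_comm]
  map_smul' c x := by
    cases σ <;> simp [act]
  map_lie' {x y} := by
    cases σ <;> simp [act, LieRing.of_associative_ring_bracket, Module.End.mul_eq_comp,
      ← Matrix.toLin'_mul, sub_eq_add_neg]

lemma act_mulVec_dotProduct {ι : Type*} [Fintype ι] [DecidableEq ι] (τ : Bool)
    (x : Matrix ι ι K) (a u : ι → K) :
    (act τ x *ᵥ a) ⬝ᵥ u = -(a ⬝ᵥ act (!τ) x *ᵥ u) := by
  cases τ
  · simp [act, mulVec_transpose, ← dotProduct_mulVec, neg_mulVec]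
  · simp [act, dotProduct_mulVec, neg_mulVec, dotProduct_neg, vecMul_transpose]

lemma eq_zero_of_natRep [CharZero K] {t : ClassicalType} {r : ℕ}
    (hs : LieAlgebra.IsSimple K (classical K t r)) {σ : Bool} {v : t.Index r → K}
    (hv : ∀ x : classical K t r, act σ x.1 *ᵥ v = 0) : v = 0 := by
  cases σ
  · exact eq_zero_of_transpose_mulVec_eq_zero hs fun x => by
      have := hv x
      simpa [act, neg_mulVec] using this
  · exact eq_zero_of_mulVec_eq_zero hs hv

lemma nontrivial_index [CharZero K] {t : ClassicalType} {r : ℕ}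
    (hs : LieAlgebra.IsSimple K (classical K t r)) : Nontrivial (t.Index r) := by
  rw [← Fintype.one_lt_card_iff_nontrivial]
  rcases classical_cases t r hs with ⟨-, h⟩ | ⟨-, J, ε, h⟩
  · exact h.two_le_card
  · exact h.two_le_card

/-- Under a diagonal embedding every vector of the natural representation or its dual is invariant
or is detected by an intertwiner to the natural representation or its dual. -/
lemma IsDiagonal.exists_intertwiner {t : ClassicalType} {r s : ℕ}
    {δ : classical K t r →ₗ⁅K⁆ classical K t s} (hδ : IsDiagonal δ) (σ : Bool)
    (v : t.Index s → K) :
    (∃ (τ : Bool) (T : (t.Index s → K) →ₗ[K] (t.Index r → K)),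
      (∀ (x : classical K t r) w, T (act σ (δ x).1 *ᵥ w) = act τ x.1 *ᵥ T w) ∧ T v ≠ 0) ∨
    ∀ x : classical K t r, act σ (δ x).1 *ᵥ v = 0 := by
  obtain ⟨k, l, z, e, he⟩ := hδ.decomposition
  -- If all intertwiners kill `v`, then so do the projections to the nontrivial constituents, and
  -- `v` lies in the trivial part.
  refine or_iff_not_imp_left.2 fun hno x => ?_
  push Not at hno
  cases σ
  · -- transposes of the inclusions of the summands
    let T (i : (t.Index r → K) →ₗ[K] (t.Index s → K)) :
        (t.Index s → K) →ₗ[K] (t.Index r → K) := Matrix.toLin' (LinearMap.toMatrix' i)ᵀ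
    have hT : ∀ i w u, T i w ⬝ᵥ u = w ⬝ᵥ i u := fun i w u => by
      simp only [T, toLin'_apply]
      rw [mulVec_transpose, ← dotProduct_mulVec, LinearMap.toMatrix'_mulVec]
    have hTi : ∀ i : (t.Index r → K) →ₗ[K] (t.Index s → K), ∀ τ,
        (∀ x u, i (act (!τ) x.1 *ᵥ u) = (δ x).1 *ᵥ i u) → T i v = 0 := by
      intro i τ hi
      refine hno τ (T i) fun x w => dotProduct_eq _ _ fun u => ?_
      rw [act_mulVec_dotProduct, hT, hT, hi, dotProduct_mulVec]
      simp [act, neg_mulVec, mulVec_transpose]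
    have hk : ∀ (i : Fin k) u, v ⬝ᵥ e.symm (Pi.single i u, 0, 0) = 0 := by
      intro i u
      have h1 := hTi (e.symm.toLinearMap ∘ₗ (LinearMap.inl K _ _) ∘ₗ
        (LinearMap.single K (fun _ => t.Index r → K) i)) false fun x u => by
          simp only [act, LinearMap.comp_apply, LinearMap.inl_apply, LinearMap.coe_single,
            LinearEquiv.coe_coe]
          apply e.injective
          rw [he, e.apply_symm_apply, e.apply_symm_apply]
          refine Prod.ext (funext fun j => ?_) (Prod.ext (funext fun j => ?_) rfl)
          · by_cases hj : j = i
            · subst hj; simp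
            · simp [hj]
          · simp
      have h2 := hT (e.symm.toLinearMap ∘ₗ (LinearMap.inl K _ _) ∘ₗ
        (LinearMap.single K (fun _ => t.Index r → K) i)) v u
      rw [h1, zero_dotProduct] at h2
      exact h2.symm
    have hl : ∀ (i : Fin l) u, v ⬝ᵥ e.symm (0, Pi.single i u, 0) = 0 := by
      intro i u
      have h1 := hTi (e.symm.toLinearMap ∘ₗ (LinearMap.inr K _ _) ∘ₗ (LinearMap.inl K _ _) ∘ₗ
        (LinearMap.single K (fun _ => t.Index r → K) i)) true fun x u => by
          simp only [act, LinearMap.comp_apply, LinearMap.inl_apply, LinearMap.inr_apply,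
            LinearMap.coe_single, LinearEquiv.coe_coe]
          apply e.injective
          rw [he, e.apply_symm_apply, e.apply_symm_apply]
          refine Prod.ext (funext fun j => ?_) (Prod.ext (funext fun j => ?_) rfl)
          · simp
          · by_cases hj : j = i
            · subst hj; simp
            · simp [hj]
      have h2 := hT (e.symm.toLinearMap ∘ₗ (LinearMap.inr K _ _) ∘ₗ (LinearMap.inl K _ _) ∘ₗ
        (LinearMap.single K (fun _ => t.Index r → K) i)) v u
      rw [h1, zero_dotProduct] at h2
      exact h2.symm
    refine dotProduct_eq _ _ fun u => ?_
    have h3 : (act false (δ x).1 *ᵥ v) ⬝ᵥ u = -(v ⬝ᵥ (δ x).1 *ᵥ u) := by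
      simp [act, mulVec_transpose, ← dotProduct_mulVec, neg_mulVec]
    have h4 : (δ x).1 *ᵥ u = ∑ i, e.symm (Pi.single i (x.1 *ᵥ (e u).1 i), 0, 0) +
        ∑ i, e.symm (0, Pi.single i ((-x.1ᵀ) *ᵥ (e u).2.1 i), 0) := by
      apply e.injective
      rw [he, map_add, map_sum, map_sum]
      simp only [e.apply_symm_apply]
      refine Prod.ext ?_ (Prod.ext ?_ ?_)
      · simp only [Prod.fst_add, Prod.fst_sum, Finset.sum_const_zero, add_zero]
        exact (Finset.univ_sum_single _).symm
      · simp only [Prod.snd_add, Prod.fst_add, Prod.snd_sum, Prod.fst_sum, Finset.sum_const_zero,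
          zero_add]
        exact (Finset.univ_sum_single _).symm
      · simp [Prod.snd_sum]
    rw [h3, h4, dotProduct_add, dotProduct_sum, dotProduct_sum, zero_dotProduct]
    simp [hk, hl]
  · have hk : ∀ i, (e v).1 i = 0 := fun i =>
      hno true (LinearMap.proj i ∘ₗ LinearMap.fst K _ _ ∘ₗ e.toLinearMap) fun x w => by
        have := congrArg (fun p => p.1 i) (he x w)
        exact this
    have hl : ∀ i, (e v).2.1 i = 0 := fun i =>
      hno false (LinearMap.proj i ∘ₗ LinearMap.fst K _ _ ∘ₗ LinearMap.snd K _ _ ∘ₗ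
        e.toLinearMap) fun x w => by
          have := congrArg (fun p => p.2.1 i) (he x w)
          exact this
    apply e.injective
    change e ((δ x).1 *ᵥ v) = e 0
    rw [he, map_zero]
    refine Prod.ext (funext fun j => ?_) (Prod.ext (funext fun j => ?_) rfl)
    · simp [hk]
    · simp [hl]

/-- If the natural representation has no invariants, neither has its dual. -/
lemma IsDiagonal.eq_zero_of_pure [CharZero K] {t : ClassicalType} {r s : ℕ}
    {δ : classical K t r →ₗ⁅K⁆ classical K t s} (hδ : IsDiagonal δ)
    (hs : LieAlgebra.IsSimple K (classical K t r))
    (hpure : ∀ v : t.Index s → K, (∀ x : classical K t r, (δ x).1 *ᵥ v = 0) → v = 0)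
    {σ : Bool} {v : t.Index s → K} (hv : ∀ x : classical K t r, act σ (δ x).1 *ᵥ v = 0) :
    v = 0 := by
  cases σ
  · obtain ⟨k, l, z, e, he⟩ := hδ.decomposition
    have hv' : ∀ (x : classical K t r) u, v ⬝ᵥ (δ x).1 *ᵥ u = 0 := fun x u => by
      have h1 := congrArg (· ⬝ᵥ u) (hv x)
      simpa [act, mulVec_transpose, ← dotProduct_mulVec, neg_mulVec] using h1
    -- Purity kills the trivial summand of the decomposition.
    have hz : ∀ w, (e w).2.2 = 0 := by
      intro w
      have h1 := hpure (e.symm (0, 0, (e w).2.2)) fun x => by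
        apply e.injective
        rw [he, e.apply_symm_apply, map_zero]
        refine Prod.ext (funext fun j => ?_) (Prod.ext (funext fun j => ?_) rfl) <;> simp
      have h2 := congrArg (fun y => (e y).2.2) h1
      simpa using h2
    -- An invariant functional `v` restricts on each nontrivial constituent to an invariant of the
    -- dual constituent, hence to zero.
    have hgen : ∀ (i : (t.Index r → K) →ₗ[K] (t.Index s → K)) (τ : Bool),
        (∀ (x : classical K t r) u, i (act τ x.1 *ᵥ u) = (δ x).1 *ᵥ i u) →
        ∀ u, v ⬝ᵥ i u = 0 := by
      intro i τ hi u
      have h1 : (LinearMap.toMatrix' i)ᵀ *ᵥ v = 0 := by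
        refine eq_zero_of_natRep hs (σ := !τ) fun x => dotProduct_eq _ _ fun u => ?_
        rw [act_mulVec_dotProduct, Bool.not_not, mulVec_transpose, ← dotProduct_mulVec,
          LinearMap.toMatrix'_mulVec, hi, hv' x,
          neg_zero, zero_dotProduct]
      have h2 := congrArg (· ⬝ᵥ u) h1
      simpa only [mulVec_transpose, ← dotProduct_mulVec, LinearMap.toMatrix'_mulVec,
        zero_dotProduct] using h2
    refine dotProduct_eq _ _ fun u => ?_
    rw [zero_dotProduct]
    have h4 : u = ∑ i, e.symm (Pi.single i ((e u).1 i), 0, 0) +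
        ∑ i, e.symm (0, Pi.single i ((e u).2.1 i), 0) := by
      apply e.injective
      rw [map_add, map_sum, map_sum]
      simp only [e.apply_symm_apply]
      refine Prod.ext ?_ (Prod.ext ?_ ?_)
      · simp only [Prod.fst_add, Prod.fst_sum, Finset.sum_const_zero, add_zero]
        exact (Finset.univ_sum_single _).symm
      · simp only [Prod.snd_add, Prod.fst_add, Prod.snd_sum, Prod.fst_sum, Finset.sum_const_zero,
          zero_add]
        exact (Finset.univ_sum_single _).symm
      · simp [Prod.snd_sum, hz]
    rw [h4, dotProduct_add, dotProduct_sum, dotProduct_sum,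
      Finset.sum_eq_zero, Finset.sum_eq_zero, add_zero]
    · rintro i -
      refine hgen (e.symm.toLinearMap ∘ₗ (LinearMap.inr K _ _) ∘ₗ (LinearMap.inl K _ _) ∘ₗ
        (LinearMap.single K (fun _ => t.Index r → K) i)) false (fun x u => ?_) _
      simp only [act, LinearMap.comp_apply, LinearMap.inl_apply, LinearMap.inr_apply,
            LinearMap.coe_single, LinearEquiv.coe_coe]
      apply e.injective
      rw [he, e.apply_symm_apply, e.apply_symm_apply]
      refine Prod.ext (funext fun j => ?_) (Prod.ext (funext fun j => ?_) rfl)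
      · simp
      · by_cases hj : j = i
        · subst hj; simp
        · simp [hj]
    · rintro i -
      refine hgen (e.symm.toLinearMap ∘ₗ (LinearMap.inl K _ _) ∘ₗ
        (LinearMap.single K (fun _ => t.Index r → K) i)) true (fun x u => ?_) _
      simp only [act, LinearMap.comp_apply, LinearMap.inl_apply,
            LinearMap.coe_single, LinearEquiv.coe_coe]
      apply e.injective
      rw [he, e.apply_symm_apply, e.apply_symm_apply]
      refine Prod.ext (funext fun j => ?_) (Prod.ext (funext fun j => ?_) rfl)
      · by_cases hj : j = i
        · subst hj; simp
        · simp [hj]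
      · simp
  · exact hpure v hv

end NatRep

open CategoryTheory in
/-- An inverse sequence of nonempty finite types has a compatible family. -/
lemma exists_section_of_finite {X : ℕ → Type*} [∀ n, Finite (X n)] [∀ n, Nonempty (X n)]
    (f : ∀ n, X (n + 1) → X n) : ∃ s : ∀ n, X n, ∀ n, f n (s (n + 1)) = s n := by
  let F : ℕᵒᵖ ⥤ Type _ := CategoryTheory.Functor.ofOpSequence (X := X) (fun n => ↾(f n))
  haveI : ∀ j, Finite (F.obj j) := fun j => inferInstanceAs (Finite (X j.unop))
  haveI : ∀ j, Nonempty (F.obj j) := fun j => inferInstanceAs (Nonempty (X j.unop))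
  obtain ⟨s, hs⟩ := nonempty_sections_of_finite_inverse_system F
  refine ⟨fun n => s ⟨n⟩, fun n => ?_⟩
  have h1 := hs (CategoryTheory.homOfLE (Nat.le_add_right n 1)).op
  have h2 := CategoryTheory.Functor.ofOpSequence_map_homOfLE_succ (X := X) (fun n => ↾(f n)) n
  change (F.map _) _ = _ at h1
  rw [show F.map (CategoryTheory.homOfLE (Nat.le_add_right n 1)).op = ↾(f n) from h2] at h1
  exact h1

lemma exists_weight_isNonZero {K g : Type*} [Field K] [IsAlgClosed K] [CharZero K] [LieRing g]
    [LieAlgebra K g] [FiniteDimensional K g] [IsKilling K g] (H : LieSubalgebra K g)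
    [H.IsCartanSubalgebra] (hg : ¬ IsLieAbelian g) : ∃ α : Weight K H g, α.IsNonZero := by
  by_contra! hcon
  refine hg ⟨fun x y => ?_⟩
  have h1 : (⊤ : Submodule K g) ≤ H.toSubmodule :=
    le_of_forall_weight (H := H) ⊤ H.toSubmodule (fun _ _ _ _ => Submodule.mem_top)
      fun α x _ hx => mem_rootSpace_zero_iff (by simpa using hcon α) hx
  have h2 := trivial_lie_zero H H ⟨x, h1 Submodule.mem_top⟩ ⟨y, h1 Submodule.mem_top⟩
  exact congrArg Subtype.val h2

/-! ### Compatible families of dominant weights: statements (i) and (ii). -/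

namespace DiagonalIndAlgebra

variable {K L : Type*} [Field K] [IsAlgClosed K] [CharZero K] [LieRing L] [LieAlgebra K L]
  {G : DiagonalIndAlgebra K L} {H : G.Cartan}

lemma Cartan.map_mem (H : G.Cartan) (n : ℕ) : ∀ y ∈ H.h n, G.δ n y ∈ H.h (n + 1) := by
  rw [H.h_eq n]
  exact fun y hy => hy

lemma Borel.map_mem (B : G.Borel H) (n : ℕ) : ∀ y ∈ B.b n, G.δ n y ∈ B.b (n + 1) := by
  rw [B.b_eq n]
  exact fun y hy => hy

/-- Restriction of functionals from `𝔥ₙ₊₁` to `𝔥ₙ`. -/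
def Cartan.res (H : G.Cartan) (n : ℕ) (lam : Dual K (H.h (n + 1))) : Dual K (H.h n) :=
  lam.comp (cartanMap (G.δ n) (H.map_mem n))

lemma Cartan.res_apply (H : G.Cartan) (n : ℕ) (lam : Dual K (H.h (n + 1))) (x : H.h n) :
    H.res n lam x = lam (H.incl n x) := rfl

/-- `lam` is an extremal weight of some finite-dimensional representation. -/
def Borel.IsRepWeight (B : G.Borel H) (n : ℕ) (lam : Dual K (H.h n)) : Prop :=
  ∃ (ι : Type) (_ : Fintype ι) (ρ : G.g n →ₗ⁅K⁆ Module.End K (ι → K)),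
    IsExtremalWeight (H.h n) (B.b n) ρ lam

/-- `lam` is an extremal weight of the natural representation or of its dual. -/
def Borel.IsNatWeight (B : G.Borel H) (n : ℕ) (lam : Dual K (H.h n)) : Prop :=
  ∃ σ : Bool, IsExtremalWeight (H.h n) (B.b n) (natRep (G.g n) σ) lam

variable {B : G.Borel H}

lemma Borel.IsNatWeight.isRepWeight {n : ℕ} {lam : Dual K (H.h n)} (h : B.IsNatWeight n lam) :
    B.IsRepWeight n lam := by
  obtain ⟨σ, h⟩ := h
  exact ⟨_, inferInstance, _, h⟩

/-- Restricting the representation keeps the eigenvector, so descent among arbitrary representations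
needs no condition. This reaches the levels below `N`. -/
lemma Borel.IsRepWeight.res {n : ℕ} {lam : Dual K (H.h (n + 1))}
    (h : B.IsRepWeight (n + 1) lam) : B.IsRepWeight n (H.res n lam) := by
  obtain ⟨ι, _, ρ, χ, v, hv, hlam⟩ := h
  exact ⟨ι, inferInstance, ρ.comp (G.δ n), IsExtremalWeight.of_intertwine (G.δ n) (B.map_mem n)
    (H.map_mem n) hv hlam LinearMap.id (fun _ _ => rfl) hv.ne_zero⟩

lemma Borel.IsRepWeight.exists_int {n : ℕ} {lam : Dual K (H.h n)} (h : B.IsRepWeight n lam)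
    {α : LieModule.Weight K (H.h n) (G.g n)} (hα : α.IsNonZero) :
    ∃ c : ℤ, lam (LieAlgebra.IsKilling.coroot α) = c := by
  obtain ⟨ι, _, ρ, χ, v, hv, hlam⟩ := h
  rw [← hlam]
  exact hv.exists_int_apply_coroot (B.isBorel n) (B.cartan_le n) hα

lemma Borel.IsRepWeight.exists_nonneg {n : ℕ} {lam : Dual K (H.h n)} (h : B.IsRepWeight n lam)
    {α : LieModule.Weight K (H.h n) (G.g n)} (hα : B.IsRoot n α) :
    ∃ c : ℤ, 0 ≤ c ∧ lam (LieAlgebra.IsKilling.coroot α) = c := by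
  obtain ⟨ι, _, ρ, χ, v, hv, hlam⟩ := h
  obtain ⟨c, hc⟩ := hv.exists_nat_apply_coroot (B.cartan_le n) hα.1 hα.2
  exact ⟨c, by omega, by rw [← hlam, hc, Int.cast_natCast]⟩

lemma Borel.finite_isNatWeight (B : G.Borel H) (n : ℕ) : {lam | B.IsNatWeight n lam}.Finite := by
  have : {lam | B.IsNatWeight n lam} =
      ⋃ σ, {lam | IsExtremalWeight (H.h n) (B.b n) (natRep (G.g n) σ) lam} := by
    ext lam
    simp [Borel.IsNatWeight]
  rw [this]
  exact Set.finite_iUnion fun σ => finite_isExtremalWeight (B.cartan_le n) _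

lemma Borel.exists_isNatWeight (B : G.Borel H) (n : ℕ) : ∃ lam, B.IsNatWeight n lam := by
  haveI := nontrivial_index (G.simple n)
  obtain ⟨lam, h⟩ := exists_isExtremalWeight (B.isBorel n).prop (B.cartan_le n)
    (natRep (G.g n) true)
  exact ⟨lam, true, h⟩

/-- An eigenvector of weight zero is invariant, while neither the natural representation nor its
dual has nonzero invariants. -/
lemma Borel.IsNatWeight.ne_zero {n : ℕ} {lam : Dual K (H.h n)} (h : B.IsNatWeight n lam) :
    lam ≠ 0 := by
  rintro rfl
  obtain ⟨σ, χ, v, hv, hlam⟩ := h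
  exact hv.ne_zero (eq_zero_of_natRep (G.simple n) (σ := σ) fun x =>
    hv.lie_eq_zero_of_forall_cartan (B.isBorel n) (B.cartan_le n) (fun y hy => hlam ⟨y, hy⟩) x)

/-- No Borel eigenvector of the natural representation or its dual at level `n + 1` is invariant
under the image of level `n`. -/
def Borel.NoInvariants (B : G.Borel H) (n : ℕ) : Prop :=
  ∀ (σ : Bool) (χ : G.g (n + 1) → K) (v : RepModule (natRep (G.g (n + 1)) σ)),
    IsEigenvector (B.b (n + 1)) χ v → ¬ ∀ x : G.g n, ⁅G.δ n x, v⁆ = 0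

/-- Staying inside a natural or dual representation requires an intertwiner that does not kill the
eigenvector; this fails only for invariants. -/
lemma Borel.IsNatWeight.res {n : ℕ} (hn : B.NoInvariants n) {lam : Dual K (H.h (n + 1))}
    (h : B.IsNatWeight (n + 1) lam) : B.IsNatWeight n (H.res n lam) := by
  obtain ⟨σ, χ, v, hv, hlam⟩ := h
  rcases (G.diagonal n).exists_intertwiner σ v with ⟨τ, T, hT, hTv⟩ | h0
  · exact ⟨τ, IsExtremalWeight.of_intertwine (G.δ n) (B.map_mem n) (H.map_mem n) hv hlam T hT hTv⟩
  · exact (hn σ χ v hv h0).elim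

lemma Borel.exists_natWeights {N : ℕ} (hB : ∀ n ≥ N, B.NoInvariants n) :
    ∃ lam : ∀ n, Dual K (H.h n), ∀ n ≥ N, B.IsNatWeight n (lam n) ∧
      H.res n (lam (n + 1)) = lam n := by
  classical
  let S : ∀ n, Set (Dual K (H.h n)) := fun n => {lam | if N ≤ n then B.IsNatWeight n lam else lam = 0}
  have hS : ∀ n, N ≤ n → ∀ lam, lam ∈ S n ↔ B.IsNatWeight n lam := fun n hn lam => by
    simp [S, hn]
  have hS' : ∀ n, ¬ N ≤ n → ∀ lam, lam ∈ S n ↔ lam = 0 := fun n hn lam => by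
    simp [S, hn]
  haveI : ∀ n, Finite (S n) := fun n => by
    by_cases hn : N ≤ n
    · exact ((B.finite_isNatWeight n).subset fun lam h => (hS n hn lam).1 h).to_subtype
    · exact ((Set.finite_singleton (0 : Dual K (H.h n))).subset
        fun lam h => (hS' n hn lam).1 h).to_subtype
  haveI : ∀ n, Nonempty (S n) := fun n => by
    by_cases hn : N ≤ n
    · obtain ⟨lam, h⟩ := B.exists_isNatWeight n
      exact ⟨lam, (hS n hn lam).2 h⟩
    · exact ⟨0, (hS' n hn 0).2 rfl⟩
  let f : ∀ n, S (n + 1) → S n := fun n lam =>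
    if hn : N ≤ n then
      ⟨H.res n lam.1, (hS n hn _).2 (((hS (n + 1) (by omega) _).1 lam.2).res (hB n hn))⟩
    else ⟨0, (hS' n hn 0).2 rfl⟩
  obtain ⟨s, hs⟩ := exists_section_of_finite (X := fun n => S n) f
  refine ⟨fun n => (s n).1, fun n hn => ⟨(hS n hn _).1 (s n).2, ?_⟩⟩
  have h1 := congrArg Subtype.val (hs n)
  simp only [f, dif_pos hn] at h1
  exact h1

/-- A family of weights of representations compatible from some level on extends to all levels. -/
lemma Borel.exists_extend {N : ℕ} (lam : ∀ n, Dual K (H.h n))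
    (h : ∀ n ≥ N, B.IsRepWeight n (lam n) ∧ H.res n (lam (n + 1)) = lam n) :
    ∃ lam' : ∀ n, Dual K (H.h n), (∀ n ≥ N, lam' n = lam n) ∧
      ∀ n, B.IsRepWeight n (lam' n) ∧ H.res n (lam' (n + 1)) = lam' n := by
  induction N generalizing lam with
  | zero => exact ⟨lam, fun _ _ => rfl, fun n => h n (by omega)⟩
  | succ N ih =>
    have hup : ∀ n ≥ N + 1, Function.update lam N (H.res N (lam (N + 1))) n = lam n :=
      fun n hn => Function.update_of_ne (by omega) _ _
    have hN : Function.update lam N (H.res N (lam (N + 1))) N = H.res N (lam (N + 1)) :=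
      Function.update_self ..
    obtain ⟨lam', h1, h2⟩ := ih (Function.update lam N (H.res N (lam (N + 1)))) fun n hn => by
      rw [hup (n + 1) (by omega)]
      rcases hn.eq_or_lt with rfl | hn
      · rw [hN]
        exact ⟨(h (N + 1) le_rfl).1.res, rfl⟩
      · rw [hup n hn]
        exact h n hn
    exact ⟨lam', fun n hn => (h1 n (by omega)).trans (hup n hn), h2⟩

theorem Borel.exists_isDominant {N : ℕ} (hB : ∀ n ≥ N, B.NoInvariants n) :
    ∃ lam : ∀ n, Dual K (H.h n), IsDominant B lam ∧ lam ≠ 0 := by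
  obtain ⟨lam, h⟩ := Borel.exists_natWeights hB
  obtain ⟨lam', h1, h2⟩ := Borel.exists_extend lam fun n hn =>
    ⟨(h n hn).1.isRepWeight, (h n hn).2⟩
  refine ⟨lam', ⟨⟨fun n α hα => (h2 n).1.exists_int hα, fun n x => ?_⟩,
    fun n α hα => (h2 n).1.exists_nonneg hα⟩, fun h0 => ?_⟩
  · rw [← H.res_apply, (h2 n).2]
  · refine (h N le_rfl).1.ne_zero ?_
    rw [← h1 N le_rfl, h0]
    rfl

theorem exists_isDominant_of_isPure (hG : G.IsPure) (B : G.Borel H) :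
    ∃ lam : ∀ n, Dual K (H.h n), IsDominant B lam ∧ lam ≠ 0 := by
  obtain ⟨N, hN⟩ := hG
  refine Borel.exists_isDominant (N := N) fun n hn σ χ v hv h0 => hv.ne_zero ?_
  exact (G.diagonal n).eq_zero_of_pure (G.simple n) (hN n hn) (σ := σ) h0

/-- The regular cocharacters `xₙ` defining a Borel subalgebra, each refining the previous one. -/
noncomputable def Cartan.regularSeq (H : G.Cartan) : ∀ n, cocharacters (H.h n)
  | 0 => ⟨_, (exists_regular_refinement (H.h 0) (zero_mem _)).choose_spec.1⟩
  | n + 1 => ⟨_, (exists_regular_refinement (H.h (n + 1)) (cartanMap_mem_cocharacters (G.δ n)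
      (G.diagonal n).injective (H.map_mem n) (H.regularSeq n).2)).choose_spec.1⟩

lemma Cartan.regularSeq_regular (H : G.Cartan) (n : ℕ) :
    ∀ α : Weight K (H.h n) (G.g n), α.IsNonZero → α (H.regularSeq n).1 ≠ 0 := by
  cases n with
  | zero => exact (exists_regular_refinement (H.h 0) (zero_mem _)).choose_spec.2.1
  | succ n => exact (exists_regular_refinement (H.h (n + 1)) (cartanMap_mem_cocharacters (G.δ n)
      (G.diagonal n).injective (H.map_mem n) (H.regularSeq n).2)).choose_spec.2.1

lemma Cartan.regularSeq_refines (H : G.Cartan) (n : ℕ) :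
    ∀ (α : Weight K (H.h (n + 1)) (G.g (n + 1))) (m : ℤ),
      α (cartanMap (G.δ n) (H.map_mem n) (H.regularSeq n).1) = m → 0 < m →
        ∃ m' : ℤ, 0 < m' ∧ α (H.regularSeq (n + 1)).1 = m' :=
  (exists_regular_refinement (H.h (n + 1)) (cartanMap_mem_cocharacters (G.δ n)
      (G.diagonal n).injective (H.map_mem n) (H.regularSeq n).2)).choose_spec.2.2

/-- The Borel subalgebra of the sequence `regularSeq`. -/
noncomputable def Cartan.regularBorel (H : G.Cartan) : G.Borel H where
  b n := positiveBorel (H.regularSeq n).1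
  isBorel n := maximal_positiveBorel (H.regularSeq n).2 (H.regularSeq_regular n)
  cartan_le _ := le_positiveBorel _
  b_eq n := positiveBorel_eq_comap (G.δ n) (G.diagonal n).injective (H.map_mem n)
    (H.regularSeq n).2 (H.regularSeq_regular n) (H.regularSeq (n + 1)).2
    (H.regularSeq_regular (n + 1)) (H.regularSeq_refines n)

/-- An invariant eigenvector at level `n + 1` is killed by the image of `xₙ`, which is nonzero and
dominant for the next Borel subalgebra by the choice of `xₙ₊₁`. It would then be invariant under the
whole simple algebra, purity playing no role. -/
theorem exists_borel_isDominant (H : G.Cartan) :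
    ∃ B : G.Borel H, ∃ lam : ∀ n, Dual K (H.h n), IsDominant B lam ∧ lam ≠ 0 := by
  refine ⟨H.regularBorel, Borel.exists_isDominant (N := 0) fun n _ σ χ v hv h0 => hv.ne_zero ?_⟩
  refine eq_zero_of_natRep (G.simple (n + 1)) (σ := σ) fun z => ?_
  have hx0 : cartanMap (G.δ n) (H.map_mem n) (H.regularSeq n).1 ≠ 0 := by
    intro h
    have h1 : G.δ n (H.regularSeq n).1 = 0 := congrArg Subtype.val h
    have h2 : (H.regularSeq n).1 = 0 :=
      Subtype.ext ((G.diagonal n).injective (h1.trans (map_zero _).symm))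
    obtain ⟨α, hα⟩ := exists_weight_isNonZero (H.h n) (G.simple n).non_abelian
    exact H.regularSeq_regular n α hα (by rw [h2]; exact map_zero (α.toLinear ..))
  refine hv.lie_eq_zero_of_apply_eq_zero (H.regularBorel.isBorel (n + 1))
    (H.regularBorel.cartan_le (n + 1)) hx0 (fun α => ?_) (h0 _) z
  obtain ⟨m, hm⟩ := exists_int_of_mem_cocharacters (cartanMap_mem_cocharacters (G.δ n)
      (G.diagonal n).injective (H.map_mem n) (H.regularSeq n).2) α
  refine ⟨m, hm, fun hmpos y hy => ?_⟩
  obtain ⟨m', hm', hα⟩ := H.regularSeq_refines n α m hm hmpos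
  exact mem_upperSum hα hm'.le hy

end DiagonalIndAlgebra

/-! ### Injectivity of powers of the raising operator. -/

section Sl2

variable {K g V : Type*} [Field K] [CharZero K] [LieRing g] [LieAlgebra K g]
  [AddCommGroup V] [Module K V] [FiniteDimensional K V] [LieRingModule g V] [LieModule K g V]
  {h e f : g}

lemma lie_h_pow_e (t : IsSl2Triple h e f) {v : V} {μ : K} (hv : ⁅h, v⁆ = μ • v) (k : ℕ) :
    ⁅h, (toEnd K g V e ^ k) v⁆ = (μ + 2 * k) • (toEnd K g V e ^ k) v := by
  induction k with
  | zero => simpa using hv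
  | succ k ih =>
    rw [pow_succ', Module.End.mul_apply, toEnd_apply_apply, leibniz_lie, t.lie_h_e_nsmul, ih,
      lie_smul, nsmul_lie, ← Nat.cast_smul_eq_nsmul K, ← add_smul]
    congr 1
    push_cast
    ring

/-- This is the identity `[e ^ (k + 1), f] = (k + 1) e ^ k (h + k)` on an eigenvector of `h`. -/
lemma pow_succ_e_f (t : IsSl2Triple h e f) {v : V} {μ : K} (hv : ⁅h, v⁆ = μ • v) (k : ℕ) :
    (toEnd K g V e ^ (k + 1)) ⁅f, v⁆ = ⁅f, (toEnd K g V e ^ (k + 1)) v⁆ +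
      ((k + 1) * (μ + k)) • (toEnd K g V e ^ k) v := by
  induction k with
  | zero =>
    simp only [zero_add, pow_one, toEnd_apply_apply, pow_zero, Module.End.one_apply,
      Nat.cast_zero, add_zero, one_mul]
    rw [leibniz_lie e f v, t.lie_e_f, hv, add_comm]
  | succ k ih =>
    have hs : ∀ j, ⁅e, (toEnd K g V e ^ j) v⁆ = (toEnd K g V e ^ (j + 1)) v := fun j => by
      rw [pow_succ', Module.End.mul_apply, toEnd_apply_apply]
    have hrec : (toEnd K g V e ^ (k + 1 + 1)) ⁅f, v⁆ = ⁅e, (toEnd K g V e ^ (k + 1)) ⁅f, v⁆⁆ := by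
      rw [pow_succ', Module.End.mul_apply, toEnd_apply_apply]
    rw [hrec, ih, lie_add, lie_smul, hs,
      leibniz_lie e f, t.lie_e_f, lie_h_pow_e t hv, hs, add_right_comm, add_comm, ← add_smul]
    congr 2
    push_cast
    ring

/-- `e ^ p` is injective on the eigenspace of `h` of eigenvalue `-p`. -/
lemma eq_zero_of_pow_e_eq_zero (t : IsSl2Triple h e f) (p : ℕ) {v : V}
    (hv : ⁅h, v⁆ = (-p : K) • v) (h0 : (toEnd K g V e ^ p) v = 0) : v = 0 := by
  obtain ⟨M, hM⟩ : ∃ M : ℕ, ∀ p ≥ M, ∀ v : V, ⁅h, v⁆ = (-p : K) • v → v = 0 := by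
    have hfin := Module.End.finite_hasEigenvalue (toEnd K g V h)
    have hfin' : {p : ℕ | (toEnd K g V h).HasEigenvalue (-p : K)}.Finite :=
      hfin.preimage (f := fun p : ℕ => (-p : K))
        (fun a _ b _ hab => by simpa using hab)
    obtain ⟨M, hM⟩ := hfin'.bddAbove
    refine ⟨M + 1, fun p hp v hv => by_contra fun hv0 => ?_⟩
    have : p ≤ M := hM (Module.End.hasEigenvalue_of_hasEigenvector
      (Module.End.hasEigenvector_iff.2 ⟨Module.End.mem_eigenspace_iff.2 hv, hv0⟩))
    omega
  obtain ⟨n, hn⟩ : ∃ n, M ≤ p + n := ⟨M, by omega⟩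
  -- Descending induction on `p`, with `f v` of eigenvalue `-(p + 2)`: the commutator identity gives
  -- `e ^ (p + 2) f v = 0`, so `f v = 0`. Then `v` is a lowest weight vector, and `e ^ p` cannot
  -- kill it unless it is zero.
  induction n using Nat.strong_induction_on generalizing p v with
  | _ n ih =>
    by_cases hpM : M ≤ p
    · exact hM p hpM v hv
    by_contra hv0
    have h1 : ⁅h, ⁅f, v⁆⁆ = (-(p + 2 : ℕ) : K) • ⁅f, v⁆ := by
      rw [leibniz_lie, t.lie_h_f_nsmul, hv, lie_smul, neg_lie, nsmul_lie,
        ← Nat.cast_smul_eq_nsmul K, ← neg_smul, ← add_smul]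
      congr 1
      push_cast
      ring
    have hstep : ∀ j, (toEnd K g V e ^ (p + j)) v = 0 := fun j => by
      rw [add_comm, pow_add, Module.End.mul_apply, h0, map_zero]
    have h2 : (toEnd K g V e ^ (p + 2)) ⁅f, v⁆ = 0 := by
      rw [pow_succ_e_f t hv (p + 1), hstep 1, show p + 1 + 1 = p + 2 from rfl, hstep 2, lie_zero,
        smul_zero, add_zero]
    have h3 : ⁅f, v⁆ = 0 := ih (n - 2) (by omega) (p + 2) h1 h2 (by omega)
    have P : t.symm.HasPrimitiveVectorWith v (p : K) :=
      ⟨hv0, by rw [neg_lie, hv, neg_smul, neg_neg], h3⟩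
    exact P.pow_toEnd_f_ne_zero_of_eq_nat rfl le_rfl h0

end Sl2

/-! ### A nonorthogonality criterion from `sl₂` and Hall's theorem. -/

section Destabilize

variable {K g : Type*} [Field K] [IsAlgClosed K] [CharZero K] [LieRing g] [LieAlgebra K g]
  [FiniteDimensional K g] [IsKilling K g] {H : LieSubalgebra K g} [H.IsCartanSubalgebra]

/-- The sum of the root spaces of roots positive on `t` and taking the value `2` on `h`. -/
def raisingSpace (h : H) (r : Weight K H g → ℚ) : Submodule K g :=
  ⨆ β : {β : Weight K H g // 0 < r β ∧ β h = 2}, (rootSpace H β.1).toSubmodule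

lemma raisingSpace_le_iff {h : H} {r : Weight K H g → ℚ} {W : Submodule K g} :
    raisingSpace h r ≤ W ↔ ∀ β : Weight K H g, 0 < r β → β h = 2 → ∀ y ∈ rootSpace H β, y ∈ W := by
  rw [raisingSpace, iSup_le_iff]
  exact ⟨fun H β h1 h2 => H ⟨β, h1, h2⟩, fun H β => H β.1 β.2.1 β.2.2⟩

variable {h t : H} {r : Weight K H g → ℚ} (hr : ∀ γ, γ t = r γ)
include hr

/-- Each application of `e` adds a root that is positive for `r` and equal to `2` on `h`, and `r` is
additive. -/
lemma pow_raising_mem {e : g} (he : e ∈ raisingSpace h r) (γ : Weight K H g) {y : g}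
    (hy : y ∈ rootSpace H γ) (k : ℕ) :
    (toEnd K g g e ^ (k + 1)) y ∈ ⨆ β : {β : Weight K H g // r γ < r β ∧ β h = γ h + 2 * (k + 1)},
      (rootSpace H β.1).toSubmodule := by
  -- one step
  have step : ∀ (β : Weight K H g) (z : g), z ∈ rootSpace H β → ∀ W : Submodule K g,
      (∀ β' : Weight K H g, r β < r β' → β' h = β h + 2 → ∀ w ∈ rootSpace H β', w ∈ W) →
      ⁅e, z⁆ ∈ W := by
    intro β z hz W hW
    have h1 : raisingSpace h r ≤ W.comap ((ad K g : g →ₗ[K] Module.End K g).flip z) := by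
      refine raisingSpace_le_iff.2 fun α hα1 hα2 x hx => ?_
      change ⁅x, z⁆ ∈ W
      have h1 : ⁅x, z⁆ ∈ rootSpace H ((α : H → K) + β) :=
        LieAlgebra.lie_mem_genWeightSpace_of_mem_genWeightSpace hx hz
      by_cases h3 : rootSpace H ((α : H → K) + β) = ⊥
      · rw [h3, LieSubmodule.mem_bot] at h1
        rw [h1]
        exact W.zero_mem
      · refine hW ⟨(α : H → K) + β, h3⟩ ?_ ?_ _ h1
        · have h4 := hr ⟨(α : H → K) + β, h3⟩
          have h5 : α t + β t = (r ⟨(α : H → K) + β, h3⟩ : K) := h4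
          rw [hr α, hr β] at h5
          have h6 : r α + r β = r ⟨(α : H → K) + β, h3⟩ := by exact_mod_cast h5
          linarith
        · change α h + β h = _
          rw [hα2, add_comm]
    exact h1 he
  induction k with
  | zero =>
    simp only [zero_add, pow_one, toEnd_apply_apply]
    refine step γ y hy _ fun β' h1 h2 w hw => ?_
    exact le_iSup (fun β : {β : Weight K H g // r γ < r β ∧ β h = γ h + 2 * ((0 : ℕ) + 1)} =>
      (rootSpace H β.1).toSubmodule) ⟨β', h1, by rw [h2]; push_cast; ring⟩ hw
  | succ k ih =>
    rw [pow_succ', Module.End.mul_apply, toEnd_apply_apply]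
    suffices hle : (⨆ β : {β : Weight K H g // r γ < r β ∧ β h = γ h + 2 * (k + 1)},
        (rootSpace H β.1).toSubmodule) ≤ (⨆ β : {β : Weight K H g // r γ < r β ∧
          β h = γ h + 2 * ((k + 1 : ℕ) + 1)}, (rootSpace H β.1).toSubmodule).comap (ad K g e) from
      hle ih
    refine iSup_le fun β z hz => ?_
    rw [Submodule.mem_comap, ad_apply]
    refine step β.1 z hz _ fun β' h1 h2 w hw => ?_
    exact le_iSup (fun β : {β : Weight K H g // r γ < r β ∧ β h = γ h + 2 * ((k + 1 : ℕ) + 1)} =>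
      (rootSpace H β.1).toSubmodule) ⟨β', β.2.1.trans h1, by
        rw [h2, β.2.2]; push_cast; ring⟩ hw

/-- A matching of the roots of value `p` on `h` produced by the `sl₂`-action. -/
lemma exists_matching {e f : g} (tr : IsSl2Triple (h : g) e f) (he : e ∈ raisingSpace h r) (p : ℕ)
    (hp : 0 < p) : ∃ σ : {γ : Weight K H g // γ h = p} → {γ : Weight K H g // γ h = p},
      Function.Injective σ ∧ ∀ γ, - r γ.1 < r (σ γ).1 := by
  classical
  let R := {γ : Weight K H g // γ h = p}
  have hnz : ∀ γ : R, γ.1.IsNonZero := fun γ h0 => by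
    have h1 := γ.2
    rw [h0, Pi.zero_apply] at h1
    exact hp.ne' (by exact_mod_cast h1.symm)
  choose x hx hx0 using fun γ : Weight K H g => γ.exists_ne_zero
  have hspan : ∀ γ : Weight K H g, γ.IsNonZero → ∀ y ∈ rootSpace H γ, y ∈ Submodule.span K {x γ} :=
    fun γ hγ y hy => by
      have h1 := IsKilling.finrank_rootSpace_eq_one γ hγ
      obtain ⟨c, hc⟩ := (finrank_eq_one_iff_of_nonzero' (⟨x γ, hx γ⟩ : rootSpace H γ)
        (by simpa using hx0 γ)).1 h1 ⟨y, hy⟩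
      exact Submodule.mem_span_singleton.2 ⟨c, congrArg Subtype.val hc⟩
  have hli : LinearIndependent K x :=
    (LieSubmodule.iSupIndep_toSubmodule.2 (iSupIndep_genWeightSpace' K H g)).linearIndependent _
      hx hx0
  have hneg : ∀ γ : Weight K H g, r (-γ) = - r γ := fun γ => by
    have h1 := hr (-γ)
    rw [Weight.coe_neg, Pi.neg_apply, hr γ] at h1
    exact_mod_cast h1.symm
  -- Hall's condition for a set `S` of roots: `e ^ p` is injective on the sum of the root spaces of
  -- `-γ`, `γ ∈ S`. It lands in root spaces of value `p` on `h` whose `r` exceeds some `-r γ`, so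
  -- there are at least as many of these.
  obtain ⟨σ, hσ, hσ'⟩ := (Finset.all_card_le_biUnion_card_iff_exists_injective
    (fun γ : R => Finset.univ.filter fun γ' : R => - r γ.1 < r γ'.1)).1 fun S => by
    set N := S.biUnion fun γ : R => Finset.univ.filter fun γ' : R => - r γ.1 < r γ'.1 with hN
    let T := toEnd K g g e ^ p
    let u : S → g := fun γ => x (-γ.1.1)
    have hu : LinearIndependent K u := hli.comp (fun γ : S => -γ.1.1) fun a b hab =>
      Subtype.ext (Subtype.ext (neg_injective hab))
    have hTu : LinearIndependent K (T ∘ u) := by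
      refine hu.map ?_
      rw [disjoint_comm, Submodule.disjoint_def]
      intro v hv hv'
      refine eq_zero_of_pow_e_eq_zero tr p ?_ hv
      have hle : Submodule.span K (Set.range u) ≤
          Module.End.eigenspace (ad K g (h : g)) (-p : K) := by
        rw [Submodule.span_le]
        rintro _ ⟨γ, rfl⟩
        refine Module.End.mem_eigenspace_iff.2 ?_
        have h1 := lie_eq_smul (hx (-γ.1.1)) h
        rw [Weight.coe_neg, Pi.neg_apply, γ.1.2] at h1
        exact h1
      exact Module.End.mem_eigenspace_iff.1 (hle hv')
    have hle : Submodule.span K (Set.range (T ∘ u)) ≤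
        Submodule.span K ((N.image fun γ : R => x γ.1 : Finset g) : Set g) := by
      rw [Submodule.span_le]
      rintro _ ⟨γ, rfl⟩
      obtain ⟨k, rfl⟩ : ∃ k, p = k + 1 := ⟨p - 1, by omega⟩
      have h1 := pow_raising_mem hr he (-γ.1.1) (hx (-γ.1.1)) k
      refine (iSup_le fun β z hz => ?_ : _ ≤ Submodule.span K _) h1
      have hβ : β.1 h = ((k + 1 : ℕ) : K) := by
        rw [β.2.2, Weight.coe_neg, Pi.neg_apply, γ.1.2]
        push_cast
        ring
      have h2 := hspan β.1 (hnz ⟨β.1, hβ⟩) z hz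
      refine Submodule.span_mono ?_ h2
      rw [Set.singleton_subset_iff, Finset.mem_coe, Finset.mem_image]
      refine ⟨⟨β.1, hβ⟩, ?_, rfl⟩
      rw [hN, Finset.mem_biUnion]
      refine ⟨γ.1, γ.2, ?_⟩
      rw [Finset.mem_filter]
      refine ⟨Finset.mem_univ _, ?_⟩
      exact (hneg γ.1.1).symm.trans_lt β.2.1
    calc S.card = Fintype.card S := (Fintype.card_coe S).symm
      _ = finrank K (Submodule.span K (Set.range (T ∘ u))) := (finrank_span_eq_card hTu).symm
      _ ≤ finrank K (Submodule.span K ((N.image fun γ : R => x γ.1 : Finset g) : Set g)) :=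
        Submodule.finrank_mono hle
      _ ≤ (N.image fun γ : R => x γ.1).card := finrank_span_finset_le_card _
      _ ≤ N.card := Finset.card_image_le
  exact ⟨σ, hσ, fun γ => (Finset.mem_filter.1 (hσ' γ)).2⟩

/-- The semisimple element of an `sl₂`-triple is not orthogonal to an element of the Cartan
subalgebra for which the nilpotent element is strictly positive. -/
theorem traceForm_ne_zero_of_mem_raisingSpace {e f : g} (tr : IsSl2Triple (h : g) e f)
    (he : e ∈ raisingSpace h r) (hint : ∀ γ : Weight K H g, ∃ m : ℤ, γ h = m) :
    traceForm K H g t h ≠ 0 := by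
  classical
  choose m hm using hint
  have hmneg : ∀ γ : Weight K H g, m (-γ) = - m γ := fun γ => by
    have h1 := hm (-γ)
    rw [Weight.coe_neg, Pi.neg_apply, hm γ] at h1
    exact_mod_cast h1.symm
  have hrneg : ∀ γ : Weight K H g, r (-γ) = - r γ := fun γ => by
    have h1 := hr (-γ)
    rw [Weight.coe_neg, Pi.neg_apply, hr γ] at h1
    exact_mod_cast h1.symm
  -- the sum over the roots of a given positive value on `h`
  have hsum : ∀ p : ℤ, 0 < p → (∃ γ, m γ = p) → 0 < ∑ γ with m γ = p, r γ := by
    intro p hp ⟨γ₀, hγ₀⟩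
    lift p to ℕ using hp.le
    obtain ⟨σ, hσ, hσ'⟩ := exists_matching hr tr he p (by exact_mod_cast hp)
    have hiff : ∀ γ : Weight K H g, m γ = p ↔ γ h = p := fun γ => by
      rw [hm γ]
      exact_mod_cast Iff.rfl
    have h1 : ∑ γ with m γ = p, r γ = ∑ γ : {γ : Weight K H g // γ h = p}, r γ.1 := by
      refine (Finset.sum_subtype _ (fun γ => ?_) _)
      rw [Finset.mem_filter]
      simp [hiff γ]
    have h2 : ∑ γ, r (σ γ).1 = ∑ γ : {γ : Weight K H g // γ h = p}, r γ.1 :=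
      (Finite.injective_iff_bijective.1 hσ).sum_comp (fun γ => r γ.1)
    -- `σ` is a permutation, so summing `-r γ < r (σ γ)` compares the sum of `r` with its own
    -- negative.
    have h3 : ∑ γ : {γ : Weight K H g // γ h = p}, - r γ.1 < ∑ γ, r (σ γ).1 :=
      Finset.sum_lt_sum_of_nonempty ⟨⟨γ₀, (hiff γ₀).1 hγ₀⟩, Finset.mem_univ _⟩
        fun γ _ => hσ' γ
    rw [Finset.sum_neg_distrib, h2] at h3
    rw [h1]
    linarith
  have hpos : ∀ p : ℤ, p ∈ Finset.univ.image m → p ≠ 0 → 0 < p * ∑ γ with m γ = p, r γ := by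
    intro p hp hp0
    obtain ⟨γ, -, hγ⟩ := Finset.mem_image.1 hp
    rcases lt_or_gt_of_ne hp0 with hp | hp
    · have h1 := hsum (-p) (by omega) ⟨-γ, by rw [hmneg, hγ]⟩
      have h2 : ∑ γ with m γ = -p, r γ = - ∑ γ with m γ = p, r γ := by
        rw [← Finset.sum_neg_distrib]
        refine Finset.sum_nbij' (fun γ => -γ) (fun γ => -γ) ?_ ?_ ?_ ?_ ?_
        · intro γ hγ
          simp only [Finset.mem_filter, Finset.mem_univ, true_and] at hγ ⊢
          rw [hmneg, hγ, neg_neg]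
        · intro γ hγ
          simp only [Finset.mem_filter, Finset.mem_univ, true_and] at hγ ⊢
          rw [hmneg, hγ]
        · simp
        · simp
        · intro γ _
          rw [hrneg, neg_neg]
      rw [h2] at h1
      have h3 : (p : ℚ) < 0 := by exact_mod_cast hp
      nlinarith
    · exact mul_pos (by exact_mod_cast hp) (hsum p hp ⟨γ, hγ⟩)
  -- some root takes the value `2`
  obtain ⟨β, hβ⟩ : ∃ β : Weight K H g, m β = 2 := by
    by_contra! hcon
    have h1 : raisingSpace (g := g) h r ≤ ⊥ := raisingSpace_le_iff.2 fun β _ h2 => by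
      rw [hm β] at h2
      exact (hcon β (by exact_mod_cast h2)).elim
    exact tr.e_ne_zero (h1 he)
  have htotal : traceForm K H g t h = ((∑ γ : Weight K H g, (m γ : ℚ) * r γ : ℚ) : K) := by
    rw [traceForm_cartan_eq_sum]
    push_cast
    rw [← Finset.sum_subset (Finset.subset_univ H.root)]
    · refine Finset.sum_congr rfl fun γ _ => ?_
      rw [hr γ, hm γ, mul_comm]
    · intro γ _ hγ
      have h0 : γ.IsZero := by simpa using hγ
      have h1 := hm γ
      rw [h0, Pi.zero_apply] at h1
      rw [← h1, zero_mul]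
  -- Group the roots by their value on `h`: each group contributes a nonnegative amount, and the
  -- value `2` contributes a positive one.
  have hposs : 0 < ∑ γ : Weight K H g, (m γ : ℚ) * r γ := by
    rw [← Finset.sum_fiberwise_of_maps_to (s := Finset.univ) (t := Finset.univ.image m) (g := m)
      (fun γ hγ => Finset.mem_image_of_mem m hγ)]
    have h1 : ∀ p : ℤ, ∑ γ with m γ = p, (m γ : ℚ) * r γ = p * ∑ γ with m γ = p, r γ := by
      intro p
      rw [Finset.mul_sum]
      refine Finset.sum_congr rfl fun γ hγ => ?_
      rw [(Finset.mem_filter.1 hγ).2]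
    simp only [h1]
    refine Finset.sum_pos' (fun p hp => ?_) ⟨2, hβ ▸ Finset.mem_image_of_mem m (Finset.mem_univ _),
      hpos 2 (hβ ▸ Finset.mem_image_of_mem m (Finset.mem_univ _)) two_ne_zero⟩
    by_cases hp0 : p = 0
    · simp [hp0]
    · exact (hpos p hp hp0).le
  rw [htotal]
  exact_mod_cast hposs.ne'

end Destabilize

/-! ### Comparing a strictly dominant weight with a subalgebra. -/

section RootBound

variable {K g g' : Type*} [Field K] [IsAlgClosed K] [CharZero K] [LieRing g] [LieAlgebra K g]
  [FiniteDimensional K g] [IsKilling K g] [LieRing g'] [LieAlgebra K g']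
  [FiniteDimensional K g'] [IsKilling K g'] {H : LieSubalgebra K g} [H.IsCartanSubalgebra]
  {H' : LieSubalgebra K g'} [H'.IsCartanSubalgebra]

lemma traceForm_cartanEquivDual_symm (lam : Dual K H) (y : H) :
    traceForm K H g ((IsKilling.cartanEquivDual H).symm lam) y = lam y := by
  have h : lam = IsKilling.cartanEquivDual H ((IsKilling.cartanEquivDual H).symm lam) := by simp
  exact (LinearMap.congr_fun h y).symm

/-- The Killing form is positive on nonzero elements on which all roots are integral. -/
lemma exists_nat_traceForm_of_int {x : H} (hx0 : x ≠ 0) (hx : ∀ γ : Weight K H g, ∃ m : ℤ, γ x = m) :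
    ∃ N : ℕ, 0 < N ∧ traceForm K H g x x = N := by
  choose m hm using hx
  have h0 : (0 : ℤ) ≤ ∑ γ ∈ H.root, m γ ^ 2 := Finset.sum_nonneg fun γ _ => sq_nonneg _
  have h1 : (((∑ γ ∈ H.root, m γ ^ 2).toNat : ℕ) : K) = ((∑ γ ∈ H.root, m γ ^ 2 : ℤ) : K) := by
    rw [← Int.cast_natCast, Int.toNat_of_nonneg h0]
  refine ⟨(∑ γ ∈ H.root, m γ ^ 2).toNat, ?_, ?_⟩
  · obtain ⟨γ, hγ, hγx⟩ := exists_root_apply_ne_zero hx0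
    have hmγ : m γ ≠ 0 := fun h => hγx (by rw [hm, h, Int.cast_zero])
    have h2 : m γ ^ 2 ≤ ∑ γ ∈ H.root, m γ ^ 2 :=
      Finset.single_le_sum (f := fun γ => m γ ^ 2) (fun γ _ => sq_nonneg _) (by simpa using hγ)
    have h3 : 0 < m γ ^ 2 := by positivity
    omega
  · rw [traceForm_cartan_eq_sum, h1, Int.cast_sum]
    refine Finset.sum_congr rfl fun γ _ => ?_
    rw [hm γ]
    push_cast
    ring

/-- A strictly dominant weight takes, relative to the Killing form, its smallest values above a
root of a subalgebra on some root restricting to it. -/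
theorem exists_root_restricting_le (φ : g →ₗ⁅K⁆ g') (hφ : Function.Injective φ)
    (hH : ∀ y ∈ H, φ y ∈ H') {b' : LieSubalgebra K g'} (hH'b : H' ≤ b') {lam : Dual K H'}
    (hint : ∀ β : Weight K H' g', β.IsNonZero → ∃ c : ℤ, lam (IsKilling.coroot β) = c)
    (hpos : ∀ β : Weight K H' g', β.IsNonZero → (∀ x ∈ rootSpace H' β, x ∈ b') →
      ∃ c : ℤ, 0 < c ∧ lam (IsKilling.coroot β) = c)
    {α : Weight K H g} (hα : α.IsNonZero) (hαb : ∀ x ∈ rootSpace H α, φ x ∈ b')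
    {a : ℤ} (ha : lam (cartanMap φ hH (IsKilling.coroot α)) = a) :
    ∃ β : Weight K H' g', β.IsNonZero ∧ (∀ x ∈ rootSpace H' β, x ∈ b') ∧
      ∃ (c : ℤ) (M N : ℕ), 0 < c ∧ 0 < M ∧ 0 < N ∧ lam (IsKilling.coroot β) = c ∧
        traceForm K H' g' (IsKilling.coroot β) (IsKilling.coroot β) = M ∧
        traceForm K H' g' (cartanMap φ hH (IsKilling.coroot α))
          (cartanMap φ hH (IsKilling.coroot α)) = N ∧ c * N ≤ a * M := by
  obtain ⟨h, e, f, t, he, hf⟩ := IsKilling.exists_isSl2Triple_of_weight_isNonZero hα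
  obtain rfl := t.h_eq_coroot hα he hf
  set x := cartanMap φ hH (IsKilling.coroot α) with hx
  have tr : IsSl2Triple (x : g') (φ e) (φ f) := isSl2Triple_map t φ hφ
  have hx0 : x ≠ 0 := fun h0 => tr.h_ne_zero (by rw [h0]; rfl)
  have hxint : ∀ γ : Weight K H' g', ∃ m : ℤ, γ x = m := fun γ =>
    exists_int_of_mem_cocharacters (cartanMap_mem_cocharacters φ hφ hH
      (coroot_mem_cocharacters hα)) γ
  obtain ⟨N, hN0, hN⟩ := exists_nat_traceForm_of_int hx0 hxint
  have hN0' : (N : K) ≠ 0 := by exact_mod_cast hN0.ne'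
  choose p hp using hxint
  -- the values of the weights at the dual of `lam`
  set s := (IsKilling.cartanEquivDual H').symm lam with hs
  have hrat : ∀ γ : Weight K H' g', ∃ q : ℚ, γ s = q := by
    intro γ
    by_cases hγ : γ.IsNonZero
    · obtain ⟨c, hc⟩ := hint γ hγ
      obtain ⟨M, hM0, hM⟩ := exists_nat_traceForm_coroot hγ
      have h1 := traceForm_coroot_mul_apply hγ lam
      rw [hc, hM, ← hs] at h1
      have hM0' : (M : K) ≠ 0 := by exact_mod_cast hM0.ne'
      refine ⟨2 * c / M, ?_⟩
      push_cast
      rw [eq_div_iff hM0', ← h1, mul_comm]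
    · refine ⟨0, ?_⟩
      have : γ.IsZero := by simpa using hγ
      rw [this, Pi.zero_apply, Rat.cast_zero]
  choose q hq using hrat
  -- `s'` is the component of the dual vector of `lam` orthogonal to `x`. The criterion forbids the
  -- image of the root vector from being strictly positive for it.
  set s' : H' := s - ((a / N : ℚ) : K) • x with hs'
  have hr : ∀ γ : Weight K H' g', γ s' = ((q γ - a / N * p γ : ℚ) : K) := by
    intro γ
    have h1 : γ s' = γ s - ((a / N : ℚ) : K) * γ x := by
      have := (Weight.toLinear K H' g' γ).map_sub s (((a / N : ℚ) : K) • x)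
      rw [map_smul] at this
      exact this
    rw [h1, hq γ, hp γ]
    push_cast
    ring
  have hperp : traceForm K H' g' s' x = 0 := by
    rw [hs', map_sub, LinearMap.sub_apply, map_smul, LinearMap.smul_apply, hN, hs,
      traceForm_cartanEquivDual_symm, ha]
    push_cast
    rw [smul_eq_mul, div_mul_cancel₀ _ hN0', sub_self]
  by_contra hcon
  -- otherwise the image of the root vector lies in the raising space
  refine traceForm_ne_zero_of_mem_raisingSpace hr tr ?_ (fun γ => ⟨p γ, hp γ⟩) hperp
  -- The components of `φ e` are root vectors in `b'` for roots that restrict to `α`.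
  let U : Submodule K g' :=
    { carrier := {y | y ∈ b' ∧ ∀ z : H, ⁅φ z, y⁆ = α z • y}
      add_mem' := fun {y z} hy hz => ⟨b'.add_mem hy.1 hz.1, fun w => by
        rw [lie_add, hy.2, hz.2, smul_add]⟩
      zero_mem' := ⟨b'.zero_mem, fun w => by rw [lie_zero, smul_zero]⟩
      smul_mem' := fun c y hy => ⟨b'.smul_mem c hy.1, fun w => by
        rw [lie_smul, hy.2, smul_comm]⟩ }
  have hU : φ e ∈ U := by
    refine ⟨hαb e he, fun z => ?_⟩
    rw [← LieHom.map_lie, lie_eq_smul he, map_smul]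
  refine le_of_forall_weight (H := H') U (raisingSpace x _) ?_ ?_ hU
  · rintro y hy z ⟨hz, hz'⟩
    refine ⟨b'.lie_mem (hH'b hy) hz, fun w => ?_⟩
    have h0 : ⁅φ w, y⁆ = 0 := by
      have := trivial_lie_zero H' H' ⟨φ w, hH w w.2⟩ ⟨y, hy⟩
      exact congrArg Subtype.val this
    rw [leibniz_lie, h0, zero_lie, zero_add, hz', lie_smul]
  · rintro β y ⟨hyb, hyα⟩ hyβ
    by_cases hy0 : y = 0
    · rw [hy0]
      exact Submodule.zero_mem _
    have hβα : ∀ z : H, β (cartanMap φ hH z) = α z := fun z => by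
      have h1 := lie_eq_smul hyβ (cartanMap φ hH z)
      rw [coe_cartanMap, hyα z] at h1
      exact (smul_left_injective K hy0 h1).symm
    have hβ0 : β.IsNonZero := fun h0 => hα (funext fun z => by
      rw [← hβα z, h0]
      rfl)
    have hβb : ∀ z ∈ rootSpace H' β, z ∈ b' :=
      rootSpace_le_or_disjoint hβ0 b'.toSubmodule hyβ hy0 hyb
    refine raisingSpace_le_iff.1 le_rfl β ?_ ?_ y hyβ
    · obtain ⟨c, hc0, hc⟩ := hpos β hβ0 hβb
      obtain ⟨M, hM0, hM⟩ := exists_nat_traceForm_coroot hβ0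
      -- Here `β s = 2 c / M` and `β x = 2`, so `β s' ≤ 0` is exactly `c * N ≤ a * M`.
      by_contra! hle
      refine hcon ⟨β, hβ0, hβb, c, M, N, hc0, hM0, hN0, hc, hM, hN, ?_⟩
      have h1 := traceForm_coroot_mul_apply hβ0 lam
      rw [hc, hM, ← hs, hq β] at h1
      have h2 : (M : ℚ) * q β = 2 * c := by exact_mod_cast h1
      have h3 : p β = 2 := by
        have := hp β
        rw [hx, hβα, IsKilling.root_apply_coroot hα] at this
        exact_mod_cast this.symm
      rw [h3] at hle
      have hM0' : (0 : ℚ) < M := by exact_mod_cast hM0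
      have hN0'' : (0 : ℚ) < N := by exact_mod_cast hN0
      have h4 : q β ≤ a / N * 2 := by push_cast at hle; linarith
      have h5 : (c : ℚ) * N ≤ a * M := by
        have h6 : (M : ℚ) * q β ≤ M * (a / N * 2) := mul_le_mul_of_nonneg_left h4 hM0'.le
        rw [h2] at h6
        have h7 : (c : ℚ) ≤ M * (a / N) := by linarith
        calc (c : ℚ) * N ≤ M * (a / N) * N := mul_le_mul_of_nonneg_right h7 hN0''.le
          _ = a * M := by field_simp
      exact_mod_cast h5
    · rw [hx, hβα, IsKilling.root_apply_coroot hα]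

end RootBound

/-! ### Invariant forms on a simple Lie algebra. -/

section Proportional

variable {K g V : Type*} [Field K] [IsAlgClosed K] [CharZero K] [LieRing g] [LieAlgebra K g]
  [FiniteDimensional K g] [IsKilling K g] [IsSimple K g] [AddCommGroup V] [Module K V]
  [LieRingModule g V] [LieModule K g V]

/-- On a simple Lie algebra every trace form is a multiple of the Killing form. -/
lemma exists_traceForm_eq_smul_killingForm :
    ∃ c : K, ∀ x y : g, traceForm K g V x y = c * killingForm K g x y := by
  haveI : Nontrivial g := by
    by_contra h
    rw [not_nontrivial_iff_subsingleton] at h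
    exact IsSimple.non_abelian (R := K) (L := g) ⟨fun x y => Subsingleton.elim _ _⟩
  let D := LinearMap.BilinForm.toDual (killingForm K g) (IsKilling.killingForm_nondegenerate K g)
  -- `T` expresses the trace form through the Killing form. Invariance of both makes an eigenspace
  -- of `T` an ideal, which simplicity then makes everything.
  let T : g →ₗ[K] g := D.symm.toLinearMap ∘ₗ traceForm K g V
  obtain ⟨c, hc⟩ := Module.End.exists_eigenvalue T
  obtain ⟨v, hv⟩ := hc.exists_hasEigenvector
  let I : LieIdeal K g :=
    { carrier := {x | ∀ y, traceForm K g V x y = c * killingForm K g x y}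
      add_mem' := fun {x z} hx hz y => by
        simp only [map_add, LinearMap.add_apply, hx y, hz y, mul_add]
      zero_mem' := fun y => by simp
      smul_mem' := fun k x hx y => by
        simp only [map_smul, LinearMap.smul_apply, hx y, smul_eq_mul]
        ring
      lie_mem := fun {z x} hx y => by
        rw [← lie_skew, map_neg, map_neg, LinearMap.neg_apply, LinearMap.neg_apply,
          traceForm_apply_lie_apply, hx, killingForm, traceForm_apply_lie_apply, mul_neg] }
  have hvI : v ∈ I := fun y => by
    have h1 : traceForm K g V v = D (T v) := by simp [T]
    rw [h1, hv.apply_eq_smul, map_smul]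
    rfl
  have hI : I = ⊤ := (IsSimple.eq_bot_or_eq_top I).resolve_left fun h0 => by
    rw [h0, LieSubmodule.mem_bot] at hvI
    exact hv.2 hvI
  refine ⟨c, fun x y => ?_⟩
  have hx : x ∈ I := hI ▸ LieSubmodule.mem_top x
  exact hx y

end Proportional

/-! ### Dimensions of independent subspaces. -/

section Dimension

variable {K V : Type*} [Field K] [AddCommGroup V] [Module K V] [FiniteDimensional K V]

lemma sum_finrank_le_of_iSupIndep {ι : Type*} {p : ι → Submodule K V} (hp : iSupIndep p)
    (S : Finset ι) (W : Submodule K V) (hW : ∀ i ∈ S, p i ≤ W) :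
    ∑ i ∈ S, finrank K (p i) ≤ finrank K W := by
  classical
  have key : ∑ i ∈ S, finrank K (p i) = finrank K (S.sup p : Submodule K V) := by
    induction S using Finset.induction_on with
    | empty => rw [Finset.sum_empty, Finset.sup_empty, finrank_bot]
    | insert a s ha ih =>
      rw [Finset.sum_insert ha, ih fun i hi => hW i (Finset.mem_insert_of_mem hi),
        Finset.sup_insert, ← Submodule.finrank_sup_add_finrank_inf_eq]
      have h1 : p a ⊓ s.sup p = ⊥ := by
        rw [← disjoint_iff]
        refine (hp a).mono_right (Finset.sup_le fun i hi => ?_)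
        exact le_iSup₂_of_le i (by rintro rfl; exact ha hi) le_rfl
      rw [h1, finrank_bot, add_zero]
  rw [key]
  exact Submodule.finrank_mono (Finset.sup_le hW)

end Dimension

/-! ### Bounding the trace of a squared semisimple element by ranks. -/

section Sl2Trace

variable {K g V : Type*} [Field K] [IsAlgClosed K] [CharZero K] [LieRing g] [LieAlgebra K g]
  [AddCommGroup V] [Module K V] [FiniteDimensional K V] [LieRingModule g V] [LieModule K g V]
  {h e f : g}

variable (K V) in
/-- The sum of the generalized eigenspaces of `h` of negative integral eigenvalue. -/
def negSpace (h : g) : Submodule K V :=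
  ⨆ p : ℕ, (toEnd K g V h).maxGenEigenspace (-(p + 1 : ℕ) : K)

lemma maxGenEigenspace_le_negSpace (h : g) {p : ℕ} (hp : 0 < p) :
    (toEnd K g V h).maxGenEigenspace (-p : K) ≤ negSpace K V h := by
  obtain ⟨q, rfl⟩ : ∃ q, p = q + 1 := ⟨p - 1, by omega⟩
  exact le_iSup (fun p : ℕ => (toEnd K g V h).maxGenEigenspace (-(p + 1 : ℕ) : K)) q

lemma mem_maxGenEigenspace_of_lie_eq {v : V} {μ : K} (hv : ⁅h, v⁆ = μ • v) :
    v ∈ (toEnd K g V h).maxGenEigenspace μ := by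
  rw [Module.End.mem_maxGenEigenspace]
  refine ⟨1, ?_⟩
  rw [pow_one, LinearMap.sub_apply, LinearMap.smul_apply, Module.End.one_apply, toEnd_apply_apply,
    hv, sub_self]

/-- The intersection is `h`-stable, so a nonzero one would contain a highest weight vector, whose
eigenvalue is a natural number and not negative. -/
lemma disjoint_negSpace_ker (t : IsSl2Triple h e f) :
    negSpace K V h ⊓ LinearMap.ker (toEnd K g V e) = ⊥ := by
  set N := negSpace K V h ⊓ LinearMap.ker (toEnd K g V e) with hN
  by_contra hne
  have hstab : ∀ v ∈ N, toEnd K g V h v ∈ N := by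
    rintro v ⟨hv, hv'⟩
    refine ⟨?_, ?_⟩
    · have hle : negSpace K V h ≤ (negSpace K V h).comap (toEnd K g V h) :=
        iSup_le fun p w hw => le_iSup
          (fun p : ℕ => (toEnd K g V h).maxGenEigenspace (-(p + 1 : ℕ) : K)) p
          (Module.End.mapsTo_maxGenEigenspace_of_comm (Commute.refl _) _ hw)
      exact hle hv
    · have hv0 : ⁅e, v⁆ = 0 := hv'
      change ⁅e, ⁅h, v⁆⁆ = 0
      have h1 : ⁅e, h⁆ = -(2 • e) := by rw [← lie_skew, t.lie_h_e_nsmul]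
      rw [leibniz_lie, h1, hv0, neg_lie, nsmul_lie, hv0, smul_zero, neg_zero, lie_zero, add_zero]
  haveI : Nontrivial N := Submodule.nontrivial_iff_ne_bot.2 hne
  obtain ⟨μ, hμ⟩ := Module.End.exists_eigenvalue ((toEnd K g V h).restrict hstab)
  obtain ⟨⟨v, hvN⟩, hv⟩ := hμ.exists_hasEigenvector
  have hv0 : v ≠ 0 := fun h0 => hv.2 (Subtype.ext h0)
  have hvμ : ⁅h, v⁆ = μ • v := congrArg Subtype.val hv.apply_eq_smul
  obtain ⟨n, hn⟩ := (⟨hv0, hvμ, hvN.2⟩ : t.HasPrimitiveVectorWith v μ).exists_nat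
  have hvg : v ∈ (toEnd K g V h).maxGenEigenspace μ := mem_maxGenEigenspace_of_lie_eq hvμ
  have hdis := (Module.End.independent_maxGenEigenspace (toEnd K g V h)) μ
  refine hv0 ((Submodule.disjoint_def.1 hdis) v hvg ?_)
  refine (iSup_le fun p => ?_ : negSpace K V h ≤ _) hvN.1
  refine le_iSup₂_of_le (-(p + 1 : ℕ) : K) (fun heq => ?_) le_rfl
  rw [hn, neg_eq_iff_add_eq_zero] at heq
  have : p + 1 + n = 0 := by exact_mod_cast heq
  omega

lemma finrank_negSpace_le (t : IsSl2Triple h e f) :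
    finrank K (negSpace K V h) ≤ finrank K (LinearMap.range (toEnd K g V e)) := by
  have hinj : Function.Injective (((toEnd K g V e).domRestrict (negSpace K V h)).codRestrict
      (LinearMap.range (toEnd K g V e)) fun v => ⟨v, rfl⟩) := by
    rw [injective_iff_map_eq_zero]
    rintro ⟨v, hv⟩ hv0
    have : v ∈ negSpace K V h ⊓ LinearMap.ker (toEnd K g V e) :=
      ⟨hv, congrArg Subtype.val hv0⟩
    rw [disjoint_negSpace_ker t, Submodule.mem_bot] at this
    exact Subtype.ext this
  exact LinearMap.finrank_le_finrank_of_injective hinj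

/-- A negative eigenvalue `-p` of `h` forces about `p / 2` dimensions of negative eigenvalues. -/
lemma le_four_of_finrank_negSpace_le (t : IsSl2Triple h e f) (hd : finrank K (negSpace K V h) ≤ 2)
    {p : ℕ} {v : V} (hv0 : v ≠ 0) (hv : ⁅h, v⁆ = (-p : K) • v) : p ≤ 4 := by
  by_contra! hp
  have hev : ∀ (w : V) (q : ℕ), 0 < q → w ≠ 0 → ⁅h, w⁆ = (-q : K) • w → ⁅e, w⁆ ≠ 0 := by
    intro w q hq hw0 hw he
    obtain ⟨n, hn⟩ := (⟨hw0, hw, he⟩ : t.HasPrimitiveVectorWith w (-q : K)).exists_nat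
    rw [neg_eq_iff_add_eq_zero] at hn
    have : q + n = 0 := by exact_mod_cast hn
    omega
  -- For `p ≥ 5` the vectors `v`, `e v`, `e² v` have the distinct negative eigenvalues `-p`, `-p +
  -- 2`, `-p + 4`, too many for a space of dimension two.
  let u : Fin 3 → V := fun i => (toEnd K g V e ^ (i : ℕ)) v
  let μ : Fin 3 → K := fun i => (-(p - 2 * (i : ℕ) : ℕ) : K)
  have hu : ∀ i, ⁅h, u i⁆ = μ i • u i := fun i => by
    have h1 := lie_h_pow_e t hv (i : ℕ)
    have h2 : 2 * (i : ℕ) ≤ p := by omega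
    simp only [u, μ]
    rw [h1, Nat.cast_sub h2]
    congr 1
    push_cast
    ring
  have hsucc : ∀ k, (toEnd K g V e ^ (k + 1)) v = ⁅e, (toEnd K g V e ^ k) v⁆ := fun k => by
    rw [pow_succ', Module.End.mul_apply, toEnd_apply_apply]
  have hu0 : ∀ k : ℕ, k < 3 → (toEnd K g V e ^ k) v ≠ 0 := by
    intro k hk
    induction k with
    | zero => simpa using hv0
    | succ k ih =>
      rw [hsucc]
      exact hev _ (p - 2 * k) (by omega) (ih (by omega)) (hu ⟨k, by omega⟩)
  have hli : LinearIndependent K u := by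
    refine Module.End.eigenvectors_linearIndependent' (toEnd K g V h) μ (fun i j hij => ?_) u
      fun i => Module.End.hasEigenvector_iff.2
        ⟨Module.End.mem_eigenspace_iff.2 (hu i), hu0 i i.2⟩
    have h1 : p - 2 * (i : ℕ) = p - 2 * (j : ℕ) := by
      have := neg_injective hij
      exact_mod_cast this
    exact Fin.ext (by omega)
  have hle : Submodule.span K (Set.range u) ≤ negSpace K V h := by
    rw [Submodule.span_le]
    rintro _ ⟨i, rfl⟩
    exact maxGenEigenspace_le_negSpace h (p := p - 2 * (i : ℕ)) (by omega)
      (mem_maxGenEigenspace_of_lie_eq (hu i))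
  have h3 := Submodule.finrank_mono hle
  rw [finrank_span_eq_card hli, Fintype.card_fin] at h3
  omega

/-- The trace form of a module at the semisimple element of an `sl₂`-triple whose nilpotent elements
have rank at most two. -/
lemma exists_nat_traceForm_le (H : LieSubalgebra K g) [LieRing.IsNilpotent H] {x : H}
    (t : IsSl2Triple (x : g) e f)
    (he : finrank K (LinearMap.range (toEnd K g V e)) ≤ 2)
    (hf : finrank K (LinearMap.range (toEnd K g V f)) ≤ 2) :
    ∃ M : ℕ, M ≤ 64 ∧ traceForm K H V x x = M := by
  classical
  have hev : ∀ χ : Weight K H V, ∃ m : ℤ, χ x = m ∧ ∃ v : V, v ≠ 0 ∧ ⁅(x : g), v⁆ = (m : K) • v := by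
    intro χ
    obtain ⟨v, hv0, hv⟩ := exists_forall_lie_eq_smul K H V χ
    obtain ⟨m, hm⟩ := exists_int_eigenvalue t hv0 (hv x)
    exact ⟨m, hm, v, hv0, by rw [← hm]; exact hv x⟩
  choose m hm v hv0 hv using hev
  have hdn : finrank K (negSpace K V (x : g)) ≤ 2 := (finrank_negSpace_le t).trans he
  have hdp : finrank K (negSpace K V (-x : g)) ≤ 2 := (finrank_negSpace_le t.symm).trans hf
  have hm4 : ∀ χ, m χ ^ 2 ≤ 16 := by
    intro χ
    have h1 : -4 ≤ m χ := by
      by_contra! hlt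
      have h2 := le_four_of_finrank_negSpace_le t hdn (p := (-m χ).toNat) (hv0 χ) (by
        rw [hv χ]
        congr 1
        have : ((-m χ).toNat : ℤ) = - m χ := Int.toNat_of_nonneg (by omega)
        rw [← Int.cast_natCast, this]
        push_cast
        ring)
      omega
    have h2 : m χ ≤ 4 := by
      by_contra! hlt
      have h2 := le_four_of_finrank_negSpace_le t.symm hdp (p := (m χ).toNat) (hv0 χ) (by
        rw [neg_lie, hv χ, ← neg_smul]
        congr 1
        have : ((m χ).toNat : ℤ) = m χ := Int.toNat_of_nonneg (by omega)
        rw [← Int.cast_natCast, this])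
      omega
    nlinarith
  have hind : iSupIndep fun χ : Weight K H V => (genWeightSpace V χ).toSubmodule :=
    LieSubmodule.iSupIndep_toSubmodule.2 (iSupIndep_genWeightSpace' K H V)
  have hle : ∀ χ : Weight K H V, (genWeightSpace V χ).toSubmodule ≤
      (toEnd K g V (x : g)).maxGenEigenspace (m χ : K) := by
    intro χ w hw
    have h1 := genWeightSpace_le_genWeightSpaceOf V x χ hw
    rw [hm χ] at h1
    exact h1
  have hneg : ∑ χ : Weight K H V with m χ < 0, finrank K (genWeightSpace V χ).toSubmodule ≤ 2 := by
    refine (sum_finrank_le_of_iSupIndep hind _ (negSpace K V (x : g)) fun χ hχ => ?_).trans hdn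
    have hχ' : m χ < 0 := (Finset.mem_filter.1 hχ).2
    refine (hle χ).trans ?_
    have h1 : (m χ : K) = (-((-m χ).toNat : ℕ) : K) := by
      have : ((-m χ).toNat : ℤ) = - m χ := Int.toNat_of_nonneg (by omega)
      rw [← Int.cast_natCast, this]
      push_cast
      ring
    rw [h1]
    exact maxGenEigenspace_le_negSpace _ (by omega)
  have hpos : ∑ χ : Weight K H V with 0 < m χ, finrank K (genWeightSpace V χ).toSubmodule ≤ 2 := by
    refine (sum_finrank_le_of_iSupIndep hind _ (negSpace K V (-x : g)) fun χ hχ => ?_).trans hdp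
    have hχ' : 0 < m χ := (Finset.mem_filter.1 hχ).2
    refine (hle χ).trans ?_
    have h1 : ((m χ).toNat : ℤ) = m χ := Int.toNat_of_nonneg (by omega)
    refine le_trans ?_ (maxGenEigenspace_le_negSpace (-x : g) (p := (m χ).toNat) (by omega))
    intro w hw
    rw [Module.End.mem_maxGenEigenspace] at hw ⊢
    obtain ⟨k, hk⟩ := hw
    refine ⟨k, ?_⟩
    have h2 : toEnd K g V (-x : g) - (-((m χ).toNat : ℕ) : K) • (1 : Module.End K V) =
        -(toEnd K g V (x : g) - (m χ : K) • (1 : Module.End K V)) := by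
      rw [map_neg, ← Int.cast_natCast (m χ).toNat, h1, neg_smul]
      abel
    rw [h2, neg_pow, Module.End.mul_apply, hk, map_zero]
  -- At most two dimensions carry negative and two carry positive eigenvalues, each of square at
  -- most `16`; hence `4 * 16`.
  have htotal : ∑ χ : Weight K H V, finrank K (genWeightSpace V χ).toSubmodule * (m χ ^ 2).toNat
      ≤ 64 := by
    have h1 : ∀ χ : Weight K H V, finrank K (genWeightSpace V χ).toSubmodule * (m χ ^ 2).toNat ≤
        16 * ((if m χ < 0 then finrank K (genWeightSpace V χ).toSubmodule else 0) +
          (if 0 < m χ then finrank K (genWeightSpace V χ).toSubmodule else 0)) := by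
      intro χ
      have h2 : (m χ ^ 2).toNat ≤ 16 := by have := hm4 χ; omega
      rcases lt_trichotomy (m χ) 0 with h3 | h3 | h3
      · rw [if_pos h3, if_neg (by omega)]
        nlinarith
      · simp [h3]
      · rw [if_pos h3, if_neg (by omega)]
        nlinarith
    refine (Finset.sum_le_sum fun χ _ => h1 χ).trans ?_
    rw [← Finset.mul_sum, Finset.sum_add_distrib, ← Finset.sum_filter, ← Finset.sum_filter]
    omega
  refine ⟨_, htotal, ?_⟩
  rw [traceForm_eq_sum_finrank_nsmul_mul]
  push_cast
  refine Finset.sum_congr rfl fun χ _ => ?_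
  have h1 : (((m χ ^ 2).toNat : ℕ) : K) = (m χ : K) ^ 2 := by
    rw [← Int.cast_natCast, Int.toNat_of_nonneg (sq_nonneg _)]
    push_cast
    ring
  rw [hm χ, h1, nsmul_eq_mul, pow_two]
  rfl

end Sl2Trace

/-! ### Invariant projections onto classical algebras. -/

section Projection

open Matrix

variable {K ι : Type*} [Field K] [Fintype ι] [DecidableEq ι]

/-- `P` is an invariant projection (up to a scalar) of the matrix algebra onto `g`, taking traceless
matrices of rank one to matrices of rank at most two. -/
structure IsInvariantProjection (g : LieSubalgebra K (Matrix ι ι K))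
    (P : Matrix ι ι K →ₗ[K] Matrix ι ι K) : Prop where
  mem : ∀ M, P M ∈ g
  trace_mul : ∃ k : K, k ≠ 0 ∧ ∀ x ∈ g, ∀ M, (x * P M).trace = k * (x * M).trace
  commutator : ∀ x ∈ g, ∀ M, P (x * M - M * x) = x * P M - P M * x
  rank : ∀ u a : ι → K, a ⬝ᵥ u = 0 → ∃ w₁ w₂ : ι → K, ∀ v,
    P (vecMulVec u a) *ᵥ v ∈ Submodule.span K {w₁, w₂}

/-- The projection subtracts the scalar matrix of equal trace, and so fixes traceless matrices of
rank one. -/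
lemma IsSpecialLinear.exists_projection [CharZero K] {g : LieSubalgebra K (Matrix ι ι K)}
    (h : IsSpecialLinear g) : ∃ P, IsInvariantProjection g P := by
  have hN : (Fintype.card ι : K) ≠ 0 := by
    have := h.two_le_card
    exact_mod_cast (by omega : Fintype.card ι ≠ 0)
  refine ⟨LinearMap.id - ((Fintype.card ι : K)⁻¹ • (traceLinearMap ι K K)).smulRight 1,
    fun M => (h.mem_iff _).2 ?_, ⟨1, one_ne_zero, fun x hx M => ?_⟩, fun x _ M => ?_,
    fun u a hua => ⟨u, u, fun v => ?_⟩⟩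
  · simp only [LinearMap.sub_apply, LinearMap.id_apply, LinearMap.smulRight_apply,
      LinearMap.smul_apply, traceLinearMap_apply, trace_sub, trace_smul, trace_one, smul_eq_mul]
    field_simp
    ring
  · have := (h.mem_iff x).1 hx
    simp [mul_sub, trace_sub, this]
  · have h1 : (x * M - M * x).trace = 0 := by rw [trace_sub, trace_mul_comm, sub_self]
    simp only [LinearMap.sub_apply, LinearMap.id_apply, LinearMap.smulRight_apply,
      LinearMap.smul_apply, traceLinearMap_apply, h1, smul_zero, zero_smul, sub_zero,
      Matrix.mul_sub, Matrix.sub_mul, Matrix.mul_smul, Matrix.smul_mul, Matrix.mul_one,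
      Matrix.one_mul]
    abel
  · have h1 : (vecMulVec u a).trace = 0 := by
      rw [trace_vecMulVec, dotProduct_comm, hua]
    have h2 : vecMulVec u a *ᵥ v = (a ⬝ᵥ v) • u := by
      rw [vecMulVec_mulVec]
      simp
    simp only [LinearMap.sub_apply, LinearMap.id_apply, LinearMap.smulRight_apply,
      LinearMap.smul_apply, traceLinearMap_apply, h1, smul_zero, zero_smul, sub_zero, h2]
    exact Submodule.smul_mem _ _ (Submodule.subset_span (Set.mem_insert _ _))

/-- Skew-symmetrization `M ↦ M - J⁻¹ Mᵀ J` is twice the projection, whence the constant `2` in the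
trace identity. -/
lemma IsIsometryAlgebra.exists_projection [CharZero K] {g : LieSubalgebra K (Matrix ι ι K)}
    {J : Matrix ι ι K} {ε : K} (h : IsIsometryAlgebra g J ε) : ∃ P, IsInvariantProjection g P := by
  have hx1 : ∀ x ∈ g, J * x = -(xᵀ * J) := fun x hx =>
    eq_neg_of_add_eq_zero_right ((h.mem_iff x).1 hx)
  have hx2 : ∀ x ∈ g, x * J⁻¹ = -(J⁻¹ * xᵀ) := fun x hx => by
    calc x * J⁻¹ = J⁻¹ * (J * x) * J⁻¹ := by
          rw [← Matrix.mul_assoc, h.inv_mul_self, Matrix.one_mul]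
      _ = -(J⁻¹ * xᵀ) := by
          rw [hx1 x hx, Matrix.mul_neg, Matrix.neg_mul, Matrix.mul_assoc, Matrix.mul_assoc,
            h.mul_inv_self, Matrix.mul_one]
  let P : Matrix ι ι K →ₗ[K] Matrix ι ι K :=
    { toFun := fun M => M - J⁻¹ * Mᵀ * J
      map_add' := fun M N => by
        rw [transpose_add, Matrix.mul_add, Matrix.add_mul]
        abel
      map_smul' := fun c M => by
        rw [transpose_smul, Matrix.mul_smul, Matrix.smul_mul, ← smul_sub]
        rfl }
  refine ⟨P, h.skew_mem, ⟨2, two_ne_zero, fun x hx M => ?_⟩, fun x hx M => ?_,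
    fun u a _ => ⟨u, J⁻¹ *ᵥ a, fun v => ?_⟩⟩
  · change (x * (M - J⁻¹ * Mᵀ * J)).trace = _
    have h1 : (x * (J⁻¹ * Mᵀ * J)).trace = -(x * M).trace := by
      rw [← Matrix.mul_assoc, ← Matrix.mul_assoc, hx2 x hx, Matrix.neg_mul, Matrix.neg_mul,
        trace_neg, trace_mul_comm, ← Matrix.mul_assoc, ← Matrix.mul_assoc, h.mul_inv_self,
        Matrix.one_mul, ← transpose_mul, trace_transpose, trace_mul_comm]
    rw [Matrix.mul_sub, trace_sub, h1]
    ring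
  · change (x * M - M * x) - J⁻¹ * (x * M - M * x)ᵀ * J =
      x * (M - J⁻¹ * Mᵀ * J) - (M - J⁻¹ * Mᵀ * J) * x
    have h1 : J⁻¹ * (x * M)ᵀ * J = -(J⁻¹ * Mᵀ * J * x) := by
      rw [transpose_mul, Matrix.mul_assoc _ J x, hx1 x hx]
      simp only [Matrix.mul_assoc, Matrix.mul_neg, neg_neg]
    have h2 : J⁻¹ * (M * x)ᵀ * J = -(x * (J⁻¹ * Mᵀ * J)) := by
      rw [transpose_mul, ← Matrix.mul_assoc x, ← Matrix.mul_assoc x, hx2 x hx]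
      simp only [Matrix.mul_assoc, Matrix.neg_mul, neg_neg]
    rw [transpose_sub, Matrix.mul_sub, Matrix.sub_mul, h1, h2, Matrix.mul_sub, Matrix.sub_mul]
    abel
  · change (vecMulVec u a - J⁻¹ * (vecMulVec u a)ᵀ * J) *ᵥ v ∈ _
    rw [skew_mulVec]
    exact Submodule.sub_mem _ (Submodule.smul_mem _ _ (Submodule.subset_span (by simp)))
      (Submodule.smul_mem _ _ (Submodule.subset_span (by simp)))

lemma exists_projection_classical [CharZero K] {t : ClassicalType} {r : ℕ}
    (hs : LieAlgebra.IsSimple K (classical K t r)) :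
    ∃ P, IsInvariantProjection (classical K t r) P := by
  rcases classical_cases t r hs with ⟨-, h⟩ | ⟨-, J, ε, h⟩
  · exact h.exists_projection
  · exact h.exists_projection

variable {g : LieSubalgebra K (Matrix ι ι K)} {P : Matrix ι ι K →ₗ[K] Matrix ι ι K}

lemma IsInvariantProjection.eq_zero_of_trace_mul (hP : IsInvariantProjection g P)
    {x : Matrix ι ι K} (hx : x ∈ g) (h0 : ∀ y ∈ g, (x * y).trace = 0) : x = 0 := by
  obtain ⟨k, hk, htr⟩ := hP.trace_mul
  refine ext_iff_trace_mul_right.2 fun M => ?_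
  have h1 := htr x hx M
  rw [h0 _ (hP.mem M)] at h1
  rw [Matrix.zero_mul, trace_zero]
  exact (mul_eq_zero.1 h1.symm).resolve_left hk

end Projection

/-! ### Nilpotence of differences of commuting operators. -/

section Commuting

/-- If the commuting operators `A` and `B` are nilpotent on `x`, so is `A - B`. -/
lemma sub_pow_apply_eq_zero {K V : Type*} [Field K] [AddCommGroup V] [Module K V]
    {A B : Module.End K V} (hAB : Commute A B) {x : V} {a b : ℕ} (ha : (A ^ a) x = 0)
    (hb : (B ^ b) x = 0) : ((A - B) ^ (a + b)) x = 0 := by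
  have hc : Commute A (-B) := hAB.neg_right
  rw [sub_eq_add_neg, hc.add_pow, LinearMap.sum_apply]
  refine Finset.sum_eq_zero fun i _ => ?_
  rw [← (Nat.cast_commute ((a + b).choose i) _).eq, Module.End.mul_apply]
  suffices h : (A ^ i * (-B) ^ (a + b - i)) x = 0 by rw [h, map_zero]
  by_cases hi : a ≤ i
  · obtain ⟨j, rfl⟩ := Nat.exists_eq_add_of_le hi
    rw [(hc.pow_pow _ _).eq, Module.End.mul_apply, add_comm a j, pow_add, Module.End.mul_apply, ha,
      map_zero, map_zero]
  · obtain ⟨j, hj⟩ : ∃ j, a + b - i = j + b := ⟨a - i, by omega⟩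
    have hb' : ((-B) ^ b) x = 0 := by rw [neg_pow, Module.End.mul_apply, hb, map_zero]
    rw [hj, Module.End.mul_apply, pow_add, Module.End.mul_apply, hb', map_zero, map_zero]

end Commuting

/-! ### Root vectors of classical algebras have rank at most two. -/

section RootVectors

open Matrix

variable {K ι : Type*} [Field K] [IsAlgClosed K] [CharZero K] [Fintype ι] [DecidableEq ι]
  {g : LieSubalgebra K (Matrix ι ι K)} [IsKilling K g] {P : Matrix ι ι K →ₗ[K] Matrix ι ι K}
  {H : LieSubalgebra K g} [H.IsCartanSubalgebra]

/-- The natural module of a matrix Lie algebra. -/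
abbrev NatModule (g : LieSubalgebra K (Matrix ι ι K)) : Type _ := RepModule (natRep g true)

/-- Column vectors as elements of the natural module. -/
def toNat (g : LieSubalgebra K (Matrix ι ι K)) : (ι → K) ≃ₗ[K] NatModule g :=
  LinearEquiv.refl K (ι → K)

lemma natModule_lie (x : g) (v : ι → K) : ⁅x, toNat g v⁆ = toNat g (x.1 *ᵥ v) := rfl

/-- Every root space contains the projection of a traceless matrix of rank one. -/
theorem exists_projection_mem_rootSpace (hP : IsInvariantProjection g P) {β : Weight K H g}
    (hβ : β.IsNonZero) {f : g} (hf : f ∈ rootSpace H (-β)) (hf0 : f ≠ 0) :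
    ∃ u a : ι → K, a ⬝ᵥ u = 0 ∧ P (vecMulVec u a) ≠ 0 ∧
      (⟨P (vecMulVec u a), hP.mem _⟩ : g) ∈ rootSpace H β := by
  -- a weight vector not annihilated by `f`
  have htop : (⨆ χ : H → K, (genWeightSpace (NatModule g) χ).toSubmodule) = ⊤ :=
    LieSubmodule.iSup_toSubmodule_eq_top.2 (iSup_genWeightSpace_eq_top K H (NatModule g))
  obtain ⟨μ, u, hu, hfu⟩ : ∃ μ : H → K, ∃ u ∈ genWeightSpace (NatModule g) μ, ⁅f, u⁆ ≠ 0 := by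
    by_contra! hcon
    have h1 : (⊤ : Submodule K (NatModule g)) ≤ LinearMap.ker (toEnd K g (NatModule g) f) := by
      rw [← htop]
      exact iSup_le fun χ w hw => hcon χ w hw
    apply hf0
    refine Subtype.ext (Matrix.toLin'.injective (LinearMap.ext fun w => ?_))
    have h2 : (toEnd K g (NatModule g) f) (toNat g w) = 0 := h1 Submodule.mem_top
    rw [ZeroMemClass.coe_zero, map_zero]
    exact h2
  obtain ⟨u, rfl⟩ := (toNat g).surjective u
  have hfu' : ⁅f, toNat g u⁆ ∈ genWeightSpace (NatModule g) (-β + μ : H → K) :=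
    LieAlgebra.lie_mem_genWeightSpace_of_mem_genWeightSpace hf hu
  set ν : H → K := -β + μ with hν
  have hνμ : μ ≠ ν := by
    intro h
    apply hβ
    have h1 : μ = -(β : H → K) + μ := h
    have h2 : -(β : H → K) = 0 := by
      have := congrArg (· - μ) h1
      simpa using this.symm
    exact neg_eq_zero.1 h2
  -- a functional of weight `-ν` not vanishing there
  let W : Submodule K (NatModule g) :=
    ⨆ χ : {χ : H → K // χ ≠ ν}, (genWeightSpace (NatModule g) χ.1).toSubmodule
  have hW : ∀ χ : H → K, χ ≠ ν → (genWeightSpace (NatModule g) χ).toSubmodule ≤ W := fun χ hχ =>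
    le_iSup (fun χ : {χ : H → K // χ ≠ ν} => (genWeightSpace (NatModule g) χ.1).toSubmodule) ⟨χ, hχ⟩
  have hfuW : ⁅f, toNat g u⁆ ∉ W := by
    intro hmem
    have h1 := (LieSubmodule.iSupIndep_toSubmodule.2
      (iSupIndep_genWeightSpace K H (NatModule g))) ν
    refine hfu (Submodule.disjoint_def.1 h1 _ hfu' ?_)
    refine (iSup_le fun χ => ?_ : W ≤ _) hmem
    exact le_iSup₂_of_le χ.1 χ.2 le_rfl
  obtain ⟨φ, hφ, hφW⟩ := Submodule.exists_le_ker_of_notMem hfuW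
  obtain ⟨a, ha⟩ : ∃ a : ι → K, ∀ w : ι → K, φ (toNat g w) = a ⬝ᵥ w := by
    refine ⟨fun i => φ (toNat g (Pi.single i (1 : K))), fun w => ?_⟩
    have h1 := LinearMap.pi_apply_eq_sum_univ (φ ∘ₗ (toNat g).toLinearMap) w
    refine h1.trans ?_
    simp only [dotProduct, smul_eq_mul]
    refine Finset.sum_congr rfl fun i _ => ?_
    rw [mul_comm]
    have h2 : (fun j => if i = j then (1 : K) else 0) = Pi.single i 1 := by
      ext j
      simp [Pi.single_apply, eq_comm]
    rw [h2]
    rfl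
  have hau : a ⬝ᵥ u = 0 := by
    rw [← ha]
    exact hφW (hW μ hνμ hu)
  set X := vecMulVec u a with hX
  refine ⟨u, a, hau, fun h0 => ?_, ?_⟩
  · obtain ⟨k, hk, htr⟩ := hP.trace_mul
    have h1 := htr f.1 f.2 X
    rw [h0, Matrix.mul_zero, trace_zero, hX, mul_vecMulVec, trace_vecMulVec, dotProduct_comm,
      ← ha, ← natModule_lie] at h1
    exact mul_ne_zero hk hφ h1.symm
  · -- the generalized weight of the rank one matrix
    rw [rootSpace, mem_genWeightSpace]
    intro y
    -- The rank one matrix has weight `μ - ν = β`: on all matrices `ad y - β y` is `L - R`, a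
    -- difference of commuting operators each nilpotent on `X`.
    let L : Module.End K (Matrix ι ι K) := LinearMap.mulLeft K (y.1.1 - μ y • 1)
    let R : Module.End K (Matrix ι ι K) := LinearMap.mulRight K (y.1.1 - ν y • 1)
    have hLR : Commute L R := LinearMap.commute_mulLeft_right _ _
    have hy : ∀ (c : K) (w : ι → K) (k : ℕ), ((toEnd K H (NatModule g) y - c • 1) ^ k)
        (toNat g w) = toNat g (((y.1.1 - c • 1) ^ k) *ᵥ w) := by
      intro c w k
      induction k with
      | zero => simp
      | succ k ih =>
        rw [pow_succ', pow_succ', Module.End.mul_apply, ih, ← mulVec_mulVec, sub_mulVec,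
          smul_mulVec, one_mulVec]
        rfl
    obtain ⟨m, hm⟩ := (mem_genWeightSpace _ _ _).1 hu y
    have hLX : (L ^ m) X = 0 := by
      rw [hy, LinearEquiv.map_eq_zero_iff] at hm
      rw [LinearMap.pow_mulLeft, LinearMap.mulLeft_apply, hX, mul_vecMulVec, hm]
      exact zero_vecMulVec _
    obtain ⟨n, hn⟩ : ∃ n : ℕ, (R ^ n) X = 0 := by
      refine ⟨finrank K (NatModule g), ?_⟩
      rw [LinearMap.pow_mulRight, LinearMap.mulRight_apply, hX, vecMulVec_mul]
      set N := finrank K (NatModule g)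
      have h1 : a ᵥ* ((y.1.1 - ν y • 1) ^ N) = 0 := by
        refine dotProduct_eq _ _ fun w => ?_
        rw [← dotProduct_mulVec, ← ha, ← hy, zero_dotProduct]
        have h2 : (⊤ : Submodule K (NatModule g)) ≤ LinearMap.ker
            (φ ∘ₗ ((toEnd K H (NatModule g) y - ν y • 1) ^ N)) := by
          rw [← htop]
          refine iSup_le fun χ z hz => ?_
          change φ _ = 0
          by_cases hχ : χ = ν
          · rw [hχ] at hz
            have h3 := genWeightSpace_le_genWeightSpaceOf (NatModule g) y ν hz
            have h4 : z ∈ (toEnd K H (NatModule g) y).maxGenEigenspace (ν y) := h3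
            rw [Module.End.maxGenEigenspace_eq_genEigenspace_finrank,
              Module.End.mem_genEigenspace_nat, LinearMap.mem_ker] at h4
            rw [h4, map_zero]
          · refine hφW (hW χ hχ ?_)
            have h5 : ∀ (k : ℕ), ((toEnd K H (NatModule g) y - ν y • 1) ^ k) z ∈
                genWeightSpace (NatModule g) χ := by
              intro k
              induction k with
              | zero => simpa using hz
              | succ k ih =>
                rw [pow_succ', Module.End.mul_apply, LinearMap.sub_apply, LinearMap.smul_apply,
                  Module.End.one_apply]
                exact sub_mem (LieSubmodule.lie_mem _ ih)
                  ((genWeightSpace (NatModule g) χ).smul_mem _ ih)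
            exact h5 N
        exact h2 Submodule.mem_top
      rw [h1, vecMulVec_zero]
    have hLRX := sub_pow_apply_eq_zero hLR hLX hn
    refine ⟨m + n, ?_⟩
    have hstep : ∀ (k : ℕ), ∃ hk : P (((L - R) ^ k) X) ∈ g,
        ((toEnd K H g y - β y • (1 : Module.End K g)) ^ k) ⟨P X, hP.mem X⟩ =
          ⟨P (((L - R) ^ k) X), hk⟩ := by
      intro k
      refine ⟨hP.mem _, ?_⟩
      induction k with
      | zero => simp
      | succ k ih =>
        rw [pow_succ', Module.End.mul_apply, ih]
        refine Subtype.ext ?_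
        rw [pow_succ', Module.End.mul_apply]
        set Z := ((L - R) ^ k) X
        have h1 : (L - R) Z = (y.1.1 * Z - Z * y.1.1) - β y • Z := by
          have h2 : ν y = -β y + μ y := rfl
          rw [LinearMap.sub_apply, LinearMap.mulLeft_apply, LinearMap.mulRight_apply,
            Matrix.sub_mul, Matrix.mul_sub, Matrix.smul_mul, Matrix.mul_smul, Matrix.one_mul,
            Matrix.mul_one, h2, add_smul, neg_smul]
          abel
        have h2 : P ((L - R) Z) = (y.1.1 * P Z - P Z * y.1.1) - β y • P Z := by
          rw [h1, map_sub, map_smul, hP.commutator _ y.1.2]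
        exact h2.symm
    obtain ⟨hk, h1⟩ := hstep (m + n)
    rw [h1]
    refine Subtype.ext ?_
    change P _ = 0
    rw [hLRX, map_zero]

/-- Root vectors of a classical Lie algebra have rank at most two. -/
theorem finrank_range_rootVector_le (hP : IsInvariantProjection g P) {β : Weight K H g}
    (hβ : β.IsNonZero) {e : g} (he : e ∈ rootSpace H β) :
    finrank K (LinearMap.range (toEnd K g (NatModule g) e)) ≤ 2 := by
  classical
  obtain ⟨f, hf, hf0⟩ := (-β).exists_ne_zero
  obtain ⟨u, a, hua, hne, hmem⟩ := exists_projection_mem_rootSpace hP hβ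
    (by rwa [Weight.coe_neg] at hf) hf0
  have h1 := IsKilling.finrank_rootSpace_eq_one β hβ
  obtain ⟨c, hc⟩ := (finrank_eq_one_iff_of_nonzero' (⟨_, hmem⟩ : rootSpace H β)
    (fun h => hne (congrArg (fun z : rootSpace H β => z.1.1) h))).1 h1 ⟨e, he⟩
  have hc' : e.1 = c • P (vecMulVec u a) := (congrArg (fun z : rootSpace H β => z.1.1) hc).symm
  obtain ⟨w₁, w₂, hw⟩ := hP.rank u a hua
  have hle : LinearMap.range (toEnd K g (NatModule g) e) ≤
      Submodule.span K (({toNat g w₁, toNat g w₂} : Finset (NatModule g)) : Set (NatModule g)) := by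
    rintro _ ⟨v, rfl⟩
    obtain ⟨v, rfl⟩ := (toNat g).surjective v
    rw [toEnd_apply_apply, natModule_lie, hc', smul_mulVec, map_smul]
    refine Submodule.smul_mem _ _ ?_
    rw [Finset.coe_pair]
    exact hw v
  exact (Submodule.finrank_mono hle).trans ((finrank_span_finset_le_card _).trans
    Finset.card_le_two)

/-- The trace form of the natural module on coroots is a bounded natural number. -/
theorem exists_nat_trace_coroot_le (hP : IsInvariantProjection g P) {β : Weight K H g}
    (hβ : β.IsNonZero) : ∃ M : ℕ, M ≤ 64 ∧
      traceForm K g (NatModule g) (IsKilling.coroot β : H).1 (IsKilling.coroot β : H).1 = M := by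
  obtain ⟨h, e, f, t, he, hf⟩ := IsKilling.exists_isSl2Triple_of_weight_isNonZero hβ
  obtain rfl := t.h_eq_coroot hβ he hf
  have hf' : f ∈ rootSpace H (-β : Weight K H g) := by rwa [Weight.coe_neg]
  obtain ⟨M, hM, h1⟩ := exists_nat_traceForm_le (V := NatModule g) H t
    (finrank_range_rootVector_le hP hβ he) (finrank_range_rootVector_le hP hβ.neg hf')
  exact ⟨M, hM, h1⟩

end RootVectors

/-! ### Trace forms under diagonal embeddings. -/

section NatTrace

open Matrix

variable {K ι : Type*} [Field K] [Fintype ι] [DecidableEq ι]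
  {g : LieSubalgebra K (Matrix ι ι K)}

lemma traceForm_natModule (x y : g) : traceForm K g (NatModule g) x y = (x.1 * y.1).trace := by
  have h1 : LinearMap.trace K (ι → K) (Matrix.toLin' (x.1 * y.1)) = (x.1 * y.1).trace :=
    Matrix.trace_toLin'_eq ..
  rw [← h1, Matrix.toLin'_mul]
  rfl

/-- The trace form of the natural module is a nonzero multiple of the Killing form. -/
lemma exists_trace_eq_mul_killingForm [IsAlgClosed K] [CharZero K] [IsSimple K g]
    {P : Matrix ι ι K →ₗ[K] Matrix ι ι K} (hP : IsInvariantProjection g P) :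
    ∃ c : K, c ≠ 0 ∧ ∀ x y : g, (x.1 * y.1).trace = c * killingForm K g x y := by
  obtain ⟨c, hc⟩ := exists_traceForm_eq_smul_killingForm (K := K) (g := g) (V := NatModule g)
  simp only [traceForm_natModule] at hc
  refine ⟨c, fun h0 => ?_, hc⟩
  refine IsSimple.non_abelian (R := K) (L := g) ⟨fun x y => ?_⟩
  have h1 : ∀ z : g, z = 0 := fun z => Subtype.ext
    (hP.eq_zero_of_trace_mul z.2 fun y hy => by
      have := hc z ⟨y, hy⟩
      rw [this, h0, zero_mul])
  rw [h1 ⁅x, y⁆]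

variable {t : ClassicalType} {r s : ℕ}

/-- Compatibility of the trace forms with a diagonal embedding. -/
lemma trace_mul_of_decomposition {δ : classical K t r →ₗ⁅K⁆ classical K t s} {k l z : ℕ}
    (e : (t.Index s → K) ≃ₗ[K]
      ((Fin k → (t.Index r → K)) × (Fin l → (t.Index r → K)) × (Fin z → K)))
    (he : ∀ (x : classical K t r) (v : t.Index s → K),
      e ((δ x).1.mulVec v) =
        (fun i => x.1.mulVec ((e v).1 i), fun j => (-x.1.transpose).mulVec ((e v).2.1 j), 0))
    (x y : classical K t r) :
    ((δ x).1 * (δ y).1).trace = ((k + l : ℕ) : K) * (x.1 * y.1).trace := by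
  let A : Module.End K (t.Index s → K) := Matrix.toLin' ((δ x).1 * (δ y).1)
  let p (i : Fin k) : (t.Index s → K) →ₗ[K] (t.Index r → K) :=
    LinearMap.proj i ∘ₗ LinearMap.fst K _ _ ∘ₗ e.toLinearMap
  let q (i : Fin l) : (t.Index s → K) →ₗ[K] (t.Index r → K) :=
    LinearMap.proj i ∘ₗ LinearMap.fst K _ _ ∘ₗ LinearMap.snd K _ _ ∘ₗ e.toLinearMap
  let p' (i : Fin k) : (t.Index r → K) →ₗ[K] (t.Index s → K) :=
    e.symm.toLinearMap ∘ₗ (LinearMap.inl K _ _) ∘ₗ (LinearMap.single K (fun _ => t.Index r → K) i)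
  let q' (i : Fin l) : (t.Index r → K) →ₗ[K] (t.Index s → K) :=
    e.symm.toLinearMap ∘ₗ (LinearMap.inr K _ _) ∘ₗ (LinearMap.inl K _ _) ∘ₗ
      (LinearMap.single K (fun _ => t.Index r → K) i)
  -- Trivial constituents contribute nothing, and in a product the two signs of the dual action
  -- cancel, so natural and dual constituents count alike.
  have hA : A = ∑ i, p' i ∘ₗ Matrix.toLin' (x.1 * y.1) ∘ₗ p i +
      ∑ i, q' i ∘ₗ Matrix.toLin' (x.1ᵀ * y.1ᵀ) ∘ₗ q i := by
    refine LinearMap.ext fun v => e.injective ?_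
    simp only [A, LinearMap.add_apply, LinearMap.sum_apply, LinearMap.comp_apply, map_add, map_sum,
      toLin'_apply, p, q, p', q', LinearEquiv.coe_coe, e.apply_symm_apply]
    rw [← mulVec_mulVec, he, he]
    refine Prod.ext ?_ (Prod.ext ?_ ?_)
    · simp only [Prod.fst_add, Prod.fst_sum, LinearMap.inl_apply, LinearMap.inr_apply,
        Finset.sum_const_zero, add_zero, LinearMap.coe_single]
      rw [Finset.univ_sum_single]
      simp [mulVec_mulVec]
    · simp only [Prod.snd_add, Prod.snd_sum, Prod.fst_sum, LinearMap.inl_apply,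
        LinearMap.inr_apply, Finset.sum_const_zero, zero_add, LinearMap.coe_single]
      rw [Finset.univ_sum_single]
      simp [mulVec_mulVec, neg_mulVec, mulVec_neg]
    · simp [Prod.snd_sum]
  have htr : ((δ x).1 * (δ y).1).trace = LinearMap.trace K _ A :=
    (Matrix.trace_toLin'_eq ..).symm
  have h1 : ∀ i, LinearMap.trace K _ (p' i ∘ₗ Matrix.toLin' (x.1 * y.1) ∘ₗ p i) =
      (x.1 * y.1).trace := fun i => by
    rw [LinearMap.trace_comp_comm', LinearMap.comp_assoc]
    have : p i ∘ₗ p' i = LinearMap.id := LinearMap.ext fun v => by simp [p, p']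
    rw [this, LinearMap.comp_id]
    exact Matrix.trace_toLin'_eq ..
  have h2 : ∀ i, LinearMap.trace K _ (q' i ∘ₗ Matrix.toLin' (x.1ᵀ * y.1ᵀ) ∘ₗ q i) =
      (x.1 * y.1).trace := fun i => by
    rw [LinearMap.trace_comp_comm', LinearMap.comp_assoc]
    have : q i ∘ₗ q' i = LinearMap.id := LinearMap.ext fun v => by simp [q, q']
    rw [this, LinearMap.comp_id, ← transpose_mul]
    refine (Matrix.trace_toLin'_eq ..).trans ?_
    rw [trace_transpose, trace_mul_comm]
  rw [htr, hA, map_add, map_sum, map_sum, Finset.sum_congr rfl fun i _ => h1 i,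
    Finset.sum_congr rfl fun i _ => h2 i]
  simp [add_mul]

end NatTrace

/-! ### Strict dominance forces multiplicity one. -/

namespace DiagonalIndAlgebra

variable {K L : Type*} [Field K] [IsAlgClosed K] [CharZero K] [LieRing L] [LieAlgebra K L]
  {G : DiagonalIndAlgebra K L} {H : G.Cartan}

/-- The numbers `a = lam n (coroot α)` and `T = tr ((coroot α)²)` of a root `α` of `𝔟ₙ`. -/
structure Borel.HasRatio (B : G.Borel H) (lam : ∀ n, Dual K (H.h n)) (n : ℕ) (a T : ℕ) : Prop where
  exists_root : ∃ α : Weight K (H.h n) (G.g n), B.IsRoot n α ∧ lam n (IsKilling.coroot α) = a ∧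
    ((IsKilling.coroot α).1.1 * (IsKilling.coroot α).1.1).trace = (T : K)
  pos : 0 < a
  trace_pos : 0 < T
  trace_le : T ≤ 64

/-- The bound comes from the rank of root vectors; positivity holds because the trace form is a
nonzero multiple of the Killing form. -/
lemma exists_nat_trace_coroot (n : ℕ) {α : Weight K (H.h n) (G.g n)} (hα : α.IsNonZero) :
    ∃ T : ℕ, 0 < T ∧ T ≤ 64 ∧
      ((IsKilling.coroot α).1.1 * (IsKilling.coroot α).1.1).trace = (T : K) := by
  obtain ⟨P, hP⟩ := exists_projection_classical (G.simple n)
  obtain ⟨M, hM, h1⟩ := exists_nat_trace_coroot_le hP hα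
  rw [traceForm_natModule] at h1
  refine ⟨M, Nat.pos_of_ne_zero fun h0 => ?_, hM, h1⟩
  obtain ⟨c, hc, h2⟩ := exists_trace_eq_mul_killingForm hP
  obtain ⟨N, hN0, hN⟩ := exists_nat_traceForm_coroot hα
  rw [h2, h0, Nat.cast_zero] at h1
  have h3 : killingForm K (G.g n) (IsKilling.coroot α).1 (IsKilling.coroot α).1 = N := hN
  rw [h3] at h1
  have h4 := (mul_eq_zero.1 h1).resolve_left hc
  exact hN0.ne' (by exact_mod_cast h4)

variable {B : G.Borel H} {lam : ∀ n, Dual K (H.h n)}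

lemma exists_hasRatio_zero (hlam : IsStrictlyDominant B lam) : ∃ a T, B.HasRatio lam 0 a T := by
  obtain ⟨α, hα, hαB⟩ : ∃ α : Weight K (H.h 0) (G.g 0), α.IsNonZero ∧
      ∀ x ∈ rootSpace (H.h 0) α, x ∈ B.b 0 := by
    obtain ⟨α, hα⟩ := exists_weight_isNonZero (H.h 0) (G.simple 0).non_abelian
    rcases rootSpace_le_or_neg_le (B.b 0) (B.isBorel 0) (B.cartan_le 0) hα with h | h
    · exact ⟨α, hα, h⟩
    · exact ⟨-α, hα.neg, by simpa using h⟩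
  obtain ⟨c, hc0, hc⟩ := hlam.2 0 α ⟨hα, hαB⟩
  obtain ⟨T, hT0, hT, h1⟩ := exists_nat_trace_coroot 0 hα
  lift c to ℕ using hc0.le
  exact ⟨c, T, ⟨α, ⟨hα, hαB⟩, by simpa using hc, h1⟩, by exact_mod_cast hc0, hT0, hT⟩

/-- The ratio `a / T` drops by a factor of at least `d`: the Killing form inequality is transferred
to the natural trace form, which the embedding scales exactly by `d`. -/
lemma Borel.HasRatio.succ (hlam : IsStrictlyDominant B lam) {n a T : ℕ}
    (h : B.HasRatio lam n a T) {d : ℕ}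
    (hd : ∀ x y : G.g n, ((G.δ n x).1 * (G.δ n y).1).trace = (d : K) * (x.1 * y.1).trace) :
    ∃ a' T', B.HasRatio lam (n + 1) a' T' ∧ a' * d * T ≤ a * T' := by
  obtain ⟨α, hα, ha, hT⟩ := h.exists_root
  have ha' : lam (n + 1) (cartanMap (G.δ n) (H.map_mem n) (IsKilling.coroot α)) = (a : ℤ) := by
    rw [Int.cast_natCast, ← ha]
    exact hlam.1.2 n _
  obtain ⟨β, hβ, hβb, c, M, N, hc0, hM0, hN0, hc, hM, hN, hle⟩ :=
    exists_root_restricting_le (G.δ n) (G.diagonal n).injective (H.map_mem n)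
      (B.cartan_le (n + 1)) (fun β hβ => hlam.1.1 (n + 1) β hβ)
      (fun β hβ hβb => hlam.2 (n + 1) β ⟨hβ, hβb⟩) hα.1
      (fun x hx => B.map_mem n x (hα.2 x hx)) ha'
  obtain ⟨T', hT0', hT', hT1⟩ := exists_nat_trace_coroot (n + 1) hβ
  obtain ⟨P, hP⟩ := exists_projection_classical (G.simple (n + 1))
  obtain ⟨k, hk, h2⟩ := exists_trace_eq_mul_killingForm hP
  lift c to ℕ using hc0.le
  refine ⟨c, T', ⟨⟨β, ⟨hβ, hβb⟩, by simpa using hc, hT1⟩, by exact_mod_cast hc0, hT0', hT'⟩, ?_⟩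
  have h3 : killingForm K (G.g (n + 1)) (IsKilling.coroot β).1 (IsKilling.coroot β).1 = M := hM
  have h4 : killingForm K (G.g (n + 1)) (G.δ n (IsKilling.coroot α).1)
    (G.δ n (IsKilling.coroot α).1) = N := hN
  have h5 : (T' : K) = k * M := by rw [← h3, ← h2, hT1]
  have h6 : (d : K) * T = k * N := by rw [← h4, ← h2, hd, hT]
  have h7 : T' * N = M * (d * T) := by
    have : (T' : K) * N = M * (d * T) := by
      rw [h5, h6]
      ring
    exact_mod_cast this
  have h8 : c * N ≤ a * M := by exact_mod_cast hle
  refine Nat.le_of_mul_le_mul_left ?_ hM0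
  calc M * (c * d * T) = c * N * T' := by
        rw [show M * (c * d * T) = c * (M * (d * T)) by ring, ← h7]
        ring
    _ ≤ a * M * T' := Nat.mul_le_mul_right _ h8
    _ = M * (a * T') := by ring

/-- If there is a strictly dominant weight then the multiplicity of the embeddings is eventually
one. -/
theorem exists_forall_multiplicity_eq_one (hlam : IsStrictlyDominant B lam) {d : ℕ → ℕ}
    (hd : ∀ n, ∀ x y : G.g n,
      ((G.δ n x).1 * (G.δ n y).1).trace = (d n : K) * (x.1 * y.1).trace) :
    ∃ N, ∀ n ≥ N, d n = 1 := by
  have hd0 : ∀ n, 0 < d n := fun n => Nat.pos_of_ne_zero fun h0 => by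
    obtain ⟨α, hα⟩ := exists_weight_isNonZero (H.h n) (G.simple n).non_abelian
    obtain ⟨P, hP⟩ := exists_projection_classical (G.simple (n + 1))
    obtain ⟨k, hk, h2⟩ := exists_trace_eq_mul_killingForm hP
    have hcomem := cartanMap_mem_cocharacters (G.δ n) (G.diagonal n).injective (H.map_mem n)
      (coroot_mem_cocharacters hα)
    have hne : cartanMap (G.δ n) (H.map_mem n) (IsKilling.coroot α) ≠ 0 := fun h => by
      have h3 : G.δ n (IsKilling.coroot α).1 = 0 := congrArg Subtype.val h
      have h4 : (IsKilling.coroot α).1 = 0 :=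
        (G.diagonal n).injective (h3.trans (map_zero _).symm)
      have h5 := IsKilling.root_apply_coroot hα
      rw [show IsKilling.coroot α = 0 from Subtype.ext h4] at h5
      have h6 : α (0 : H.h n) = 0 := map_zero (Weight.toLinear K (H.h n) (G.g n) α)
      rw [h6] at h5
      exact two_ne_zero h5.symm
    obtain ⟨N, hN0, hN⟩ := exists_nat_traceForm_of_int hne
      fun γ => exists_int_of_mem_cocharacters hcomem γ
    have h3 : killingForm K (G.g (n + 1)) (G.δ n (IsKilling.coroot α).1)
      (G.δ n (IsKilling.coroot α).1) = N := hN
    have h4 := hd n (IsKilling.coroot α).1 (IsKilling.coroot α).1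
    rw [h2, h3, h0, Nat.cast_zero, zero_mul] at h4
    have h5 := (mul_eq_zero.1 h4).resolve_left hk
    exact hN0.ne' (by exact_mod_cast h5)
  by_contra! hcon
  obtain ⟨a₀, T₀, h₀⟩ := exists_hasRatio_zero hlam
  -- Along any stretch of levels the ratio `a / T` can be kept from increasing.
  have hprop : ∀ n a T, B.HasRatio lam n a T → ∀ m, ∃ a' T', B.HasRatio lam (n + m) a' T' ∧
      a' * T ≤ a * T' := by
    intro n a T h m
    induction m with
    | zero => exact ⟨a, T, h, le_rfl⟩
    | succ m ih =>
      obtain ⟨a', T', h', hle⟩ := ih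
      obtain ⟨a'', T'', h'', hle'⟩ := h'.succ hlam (hd (n + m))
      refine ⟨a'', T'', h'', Nat.le_of_mul_le_mul_left ?_ h'.trace_pos⟩
      have h1 : a'' * T' ≤ a' * T'' := by
        refine le_trans ?_ hle'
        rw [mul_assoc]
        exact Nat.mul_le_mul_left _ (Nat.le_mul_of_pos_left _ (hd0 _))
      calc T' * (a'' * T) = (a'' * T') * T := by ring
        _ ≤ (a' * T'') * T := Nat.mul_le_mul_right _ h1
        _ = (a' * T) * T'' := by ring
        _ ≤ (a * T') * T'' := Nat.mul_le_mul_right _ hle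
        _ = T' * (a * T'') := by ring
  -- Each further level with `d ≥ 2` halves the ratio at least once more.
  have hgrow : ∀ j : ℕ, ∃ n a T, B.HasRatio lam n a T ∧ 2 ^ j * a * T₀ ≤ a₀ * T := by
    intro j
    induction j with
    | zero => exact ⟨0, a₀, T₀, h₀, by simp⟩
    | succ j ih =>
      obtain ⟨n, a, T, h, hle⟩ := ih
      obtain ⟨n', hn', hdn⟩ := hcon n
      obtain ⟨m, rfl⟩ := Nat.exists_eq_add_of_le hn'
      obtain ⟨a', T', h', hle'⟩ := hprop n a T h m
      obtain ⟨a'', T'', h'', hle''⟩ := h'.succ hlam (hd (n + m))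
      refine ⟨n + m + 1, a'', T'', h'',
        Nat.le_of_mul_le_mul_left ?_ (Nat.mul_pos h'.trace_pos h.trace_pos)⟩
      have hd2 : 2 ≤ d (n + m) := by have := hd0 (n + m); omega
      have h1 : a'' * 2 * T' ≤ a' * T'' :=
        (Nat.mul_le_mul_right _ (Nat.mul_le_mul_left _ hd2)).trans hle''
      calc T' * T * (2 ^ (j + 1) * a'' * T₀) = 2 ^ j * T₀ * T * (a'' * 2 * T') := by ring
        _ ≤ 2 ^ j * T₀ * T * (a' * T'') := Nat.mul_le_mul_left _ h1
        _ = 2 ^ j * T₀ * T'' * (a' * T) := by ring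
        _ ≤ 2 ^ j * T₀ * T'' * (a * T') := Nat.mul_le_mul_left _ hle'
        _ = (2 ^ j * a * T₀) * (T' * T'') := by ring
        _ ≤ (a₀ * T) * (T' * T'') := Nat.mul_le_mul_right _ hle
        _ = T' * T * (a₀ * T'') := by ring
  -- Since `a ≥ 1`, `T₀ ≥ 1` and `T ≤ 64`, `j` halvings force `2 ^ j ≤ 64 * a₀`, which fails at `j =
  -- 64 * a₀`.
  obtain ⟨n, a, T, h, hle⟩ := hgrow (a₀ * 64)
  have h1 : 2 ^ (a₀ * 64) ≤ a₀ * 64 :=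
    calc 2 ^ (a₀ * 64) ≤ 2 ^ (a₀ * 64) * (a * T₀) :=
          Nat.le_mul_of_pos_right _ (Nat.mul_pos h.pos h₀.trace_pos)
      _ = 2 ^ (a₀ * 64) * a * T₀ := by ring
      _ ≤ a₀ * T := hle
      _ ≤ a₀ * 64 := Nat.mul_le_mul_left _ h.trace_le
  exact absurd h1 (not_le.2 Nat.lt_two_pow_self)

end DiagonalIndAlgebra

/-! ### Split embeddings are root injections. -/

section Split

variable {K g g' : Type*} [Field K] [LieRing g] [LieAlgebra K g] [LieRing g'] [LieAlgebra K g']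

/-- The image of `f`, together with a commuting abelian subalgebra, is the centralizer of a
semisimple element. -/
def IsSplitEmbedding (f : g →ₗ⁅K⁆ g') : Prop :=
  ∃ (A : Submodule K g') (S : g'), S ∈ A ∧ (∀ a ∈ A, ∀ b ∈ A, ⁅a, b⁆ = 0) ∧
    (∀ a ∈ A, ∀ x, ⁅a, f x⁆ = 0) ∧ (∀ y : g', ⁅S, y⁆ = 0 → ∃ x, ∃ a ∈ A, y = f x + a) ∧
    ∀ y : g', ⁅S, ⁅S, y⁆⁆ = 0 → ⁅S, y⁆ = 0

lemma IsSplitEmbedding.comp_equiv {f : g →ₗ⁅K⁆ g'} (hf : IsSplitEmbedding f) {k k' : Type*}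
    [LieRing k] [LieAlgebra K k] [LieRing k'] [LieAlgebra K k'] (e : g ≃ₗ⁅K⁆ k)
    (e' : g' ≃ₗ⁅K⁆ k') (φ : k →ₗ⁅K⁆ k') (hφ : ∀ x, φ (e x) = e' (f x)) : IsSplitEmbedding φ := by
  obtain ⟨A, S, hS, hA, hAf, hcent, hss⟩ := hf
  refine ⟨A.map (e' : g' →ₗ[K] k'), e' S, ⟨S, hS, rfl⟩, ?_, ?_, fun y hy => ?_, fun y hy => ?_⟩
  · rintro _ ⟨a, ha, rfl⟩ _ ⟨b, hb, rfl⟩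
    change ⁅e' a, e' b⁆ = 0
    rw [← LieEquiv.map_lie, hA a ha b hb, map_zero]
  · rintro _ ⟨a, ha, rfl⟩ x
    obtain ⟨x, rfl⟩ : ∃ w, e w = x := e.surjective x
    change ⁅e' a, φ (e x)⁆ = 0
    rw [hφ, ← LieEquiv.map_lie, hAf a ha, map_zero]
  · obtain ⟨y, rfl⟩ : ∃ w, e' w = y := e'.surjective y
    rw [← LieEquiv.map_lie] at hy
    obtain ⟨x, a, ha, rfl⟩ := hcent y (e'.injective (hy.trans (map_zero e').symm))
    exact ⟨e x, e' a, ⟨a, ha, rfl⟩, by rw [map_add, hφ]⟩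
  · obtain ⟨y, rfl⟩ : ∃ w, e' w = y := e'.surjective y
    rw [← LieEquiv.map_lie, ← LieEquiv.map_lie] at hy
    rw [← LieEquiv.map_lie, hss y (e'.injective (hy.trans (map_zero e').symm)), map_zero]

/-- The Cartan subalgebra is `f h + A`. A normalizing element `y` has `⁅S, ⁅S, y⁆⁆ = 0`, so it
centralizes `S` and has the form `f x + a`, where `x` normalizes `h`. Roots extend by zero on `A`,
which commutes with the image of `f`. -/
lemma IsSplitEmbedding.isRootInjection [IsAlgClosed K] [CharZero K] [FiniteDimensional K g]
    [LieAlgebra.IsKilling K g] {f : g →ₗ⁅K⁆ g'} (hf : IsSplitEmbedding f)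
    (hinj : Function.Injective f) : IsRootInjection f := by
  obtain ⟨A, S, hS, hA, hAf, hcent, hss⟩ := hf
  refine ⟨hinj, fun h hh => ?_⟩
  have hcomm : ∀ x ∈ h, ∀ y ∈ h, ⁅x, y⁆ = 0 := fun x hx y hy =>
    congrArg Subtype.val (trivial_lie_zero h h (⟨x, hx⟩ : h) ⟨y, hy⟩)
  -- Such an `x` is central, and the center is zero.
  have hfA : ∀ x, f x ∈ A → x = 0 := by
    intro x hx
    have h1 : x ∈ LieAlgebra.center K g := by
      rw [LieModule.mem_maxTrivSubmodule]
      intro y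
      apply hinj
      rw [LieHom.map_lie, ← lie_skew, hAf _ hx, neg_zero, map_zero]
    rwa [LieAlgebra.center_eq_bot, LieSubmodule.mem_bot] at h1
  let h' : LieSubalgebra K g' :=
    { h.toSubmodule.map (f : g →ₗ[K] g') ⊔ A with
      lie_mem' := by
        intro y z hy hz
        obtain ⟨_, ⟨u, hu, rfl⟩, a, ha, rfl⟩ := Submodule.mem_sup.1 hy
        obtain ⟨_, ⟨v, hv, rfl⟩, b, hb, rfl⟩ := Submodule.mem_sup.1 hz
        have : ⁅f u + a, f v + b⁆ = 0 := by
          rw [add_lie, lie_add, lie_add, ← LieHom.map_lie, hcomm u hu v hv, hAf a ha, hA a ha b hb,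
            ← lie_skew, hAf b hb]
          simp
        exact this ▸ Submodule.zero_mem _ }
  have hmem : ∀ y, y ∈ h' ↔ ∃ x ∈ h, ∃ a ∈ A, f x + a = y := by
    intro y
    refine Submodule.mem_sup.trans ⟨?_, ?_⟩
    · rintro ⟨_, ⟨x, hx, rfl⟩, a, ha, rfl⟩
      exact ⟨x, hx, a, ha, rfl⟩
    · rintro ⟨x, hx, a, ha, rfl⟩
      exact ⟨_, ⟨x, hx, rfl⟩, a, ha, rfl⟩
  have hfh : ∀ x ∈ h, f x ∈ h' := fun x hx => (hmem _).2 ⟨x, hx, 0, A.zero_mem, add_zero _⟩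
  have hAh : ∀ a ∈ A, a ∈ h' := fun a ha =>
    (hmem _).2 ⟨0, h.zero_mem, a, ha, by rw [map_zero, zero_add]⟩
  have hcomm' : ∀ y ∈ h', ∀ z ∈ h', ⁅y, z⁆ = 0 := by
    intro y hy z hz
    obtain ⟨u, hu, a, ha, rfl⟩ := (hmem _).1 hy
    obtain ⟨v, hv, b, hb, rfl⟩ := (hmem _).1 hz
    rw [add_lie, lie_add, lie_add, ← LieHom.map_lie, hcomm u hu v hv, hAf a ha, hA a ha b hb,
      ← lie_skew, hAf b hb]
    simp
  haveI : IsLieAbelian h' := ⟨fun y z => Subtype.ext (hcomm' y y.2 z z.2)⟩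
  have hcartan : h'.IsCartanSubalgebra := by
    refine ⟨inferInstance, le_antisymm (fun y hy => ?_) h'.le_normalizer⟩
    have hy' := (h'.mem_normalizer_iff' y).1 hy
    have h1 : ⁅S, y⁆ = 0 := hss y (hcomm' S (hAh S hS) _ (hy' S (hAh S hS)))
    obtain ⟨x, a, ha, rfl⟩ := hcent y h1
    refine (hmem _).2 ⟨x, ?_, a, ha, rfl⟩
    rw [← hh.self_normalizing]
    refine (h.mem_normalizer_iff' x).2 fun z hz => ?_
    have h2 := hy' _ (hfh z hz)
    rw [lie_add, ← lie_skew _ a, hAf a ha, neg_zero, add_zero, ← LieHom.map_lie] at h2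
    obtain ⟨w, hw, b, hb, hwb⟩ := (hmem _).1 h2
    have h3 : ⁅z, x⁆ - w = 0 := hfA _ (by rwa [map_sub, ← hwb, add_sub_cancel_left])
    rwa [sub_eq_zero.1 h3]
  refine ⟨h', hcartan, ?_, fun α hα => ?_⟩
  · rintro _ ⟨x, hx, rfl⟩
    exact hfh x hx
  choose p hp q hq hpq using fun y : h' => (hmem y).1 y.2
  have key : ∀ x ∈ LieAlgebra.rootSpace h α, ∀ y : h', ⁅(y : g'), f x⁆ = α ⟨p y, hp y⟩ • f x := by
    intro x hx y
    rw [← hpq, add_lie, hAf _ (hq y), add_zero, ← LieHom.map_lie, ← map_smul]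
    exact congrArg f (lie_eq_smul hx ⟨p y, hp y⟩)
  have hroot : ∀ x ∈ LieAlgebra.rootSpace h α,
      f x ∈ LieAlgebra.rootSpace h' fun y => α ⟨p y, hp y⟩ := fun x hx =>
    LieModule.weightSpace_le_genWeightSpace _ _ ((LieModule.mem_weightSpace _ _).2 (key x hx))
  obtain ⟨x, hx, hx0⟩ := α.exists_ne_zero
  have hfx : f x ≠ 0 := fun h0 => hx0 (hinj (h0.trans (map_zero f).symm))
  refine ⟨⟨fun y => α ⟨p y, hp y⟩, fun hbot => hfx ?_⟩, fun hzero => hα ?_, hroot⟩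
  · have := hroot x hx
    rwa [LieAlgebra.rootSpace, hbot, LieSubmodule.mem_bot] at this
  · funext z
    have h1 := key x hx ⟨f z, hfh z z.2⟩
    have h2 : α ⟨p ⟨f z, hfh z z.2⟩, hp _⟩ = 0 := congrFun hzero ⟨f z, hfh z z.2⟩
    have h3 : ⁅f z, f x⁆ = α z • f x := by
      rw [← LieHom.map_lie, ← map_smul]
      exact congrArg f (lie_eq_smul hx z)
    change α z = 0
    rw [h2, zero_smul] at h1
    exact (smul_eq_zero.1 (h3.symm.trans h1)).resolve_right hfx

end Split

/-! ### Block diagonal embeddings. -/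

section Blocks

open Matrix

variable {K ι ι' τ : Type*} [Field K] [Fintype ι] [DecidableEq ι] [Fintype ι'] [DecidableEq ι']
  [Fintype τ] [DecidableEq τ]

lemma conj_mul {ν : Type*} [Fintype ν] [DecidableEq ν] {M : Matrix ι' ν K} {N : Matrix ν ι' K}
    (hMN : M * N = 1) (x y : Matrix ι' ι' K) : N * (x * y) * M = N * x * M * (N * y * M) := by
  calc N * (x * y) * M = N * x * (1 : Matrix ι' ι' K) * y * M := by simp only [Matrix.mul_assoc, Matrix.one_mul]
    _ = _ := by rw [← hMN]; simp only [Matrix.mul_assoc]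

lemma conj_injective {ν : Type*} [Fintype ν] [DecidableEq ν] {M : Matrix ι' ν K}
    {N : Matrix ν ι' K} (hMN : M * N = 1) :
    Function.Injective fun x : Matrix ι' ι' K => N * x * M := by
  intro x y hxy
  have h : ∀ z : Matrix ι' ι' K, M * (N * z * M) * N = z := fun z => by
    calc M * (N * z * M) * N = (M * N) * z * (M * N) := by simp only [Matrix.mul_assoc]
      _ = z := by rw [hMN, Matrix.one_mul, Matrix.mul_one]
  rw [← h x, ← h y]
  exact congrArg (fun z => M * z * N) hxy

lemma diagonal_sum_elim (c : K) (d : τ → K) :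
    (diagonal (Sum.elim (fun _ : ι => c) d) : Matrix (ι ⊕ τ) (ι ⊕ τ) K) =
      fromBlocks (c • 1) 0 0 (diagonal d) := by
  rw [smul_one_eq_diagonal, fromBlocks_diagonal]

/-- A block diagonal embedding whose complement is split by a diagonalizable element with simple
eigenvalues. -/
theorem isSplitEmbedding_of_blocks {g : Type*} [LieRing g] [LieAlgebra K g]
    {g' : LieSubalgebra K (Matrix ι' ι' K)} (f : g →ₗ⁅K⁆ g') {M : Matrix ι' (ι ⊕ τ) K}
    {N : Matrix (ι ⊕ τ) ι' K} (hNM : N * M = 1) (hMN : M * N = 1) (θ : g → Matrix ι ι K)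
    (hf : ∀ x, N * (f x).1 * M = fromBlocks (θ x) 0 0 0) {c₀ : K} {s : τ → K}
    (hs : Function.Injective s) (hc : ∀ i, s i ≠ c₀)
    (hS : M * fromBlocks (c₀ • (1 : Matrix ι ι K)) 0 0 (diagonal s) * N ∈ g')
    (hcent : ∀ y ∈ g', ∀ Y d, N * y * M = fromBlocks Y 0 0 (diagonal d) →
      ∃ x, ∃ c : K, Y = θ x + c • 1) : IsSplitEmbedding f := by
  have hψS : N * (M * fromBlocks (c₀ • (1 : Matrix ι ι K)) 0 0 (diagonal s) * N) * M =
      fromBlocks (c₀ • (1 : Matrix ι ι K)) 0 0 (diagonal s) := by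
    calc N * (M * fromBlocks (c₀ • (1 : Matrix ι ι K)) 0 0 (diagonal s) * N) * M
        = (N * M) * fromBlocks (c₀ • (1 : Matrix ι ι K)) 0 0 (diagonal s) * (N * M) := by
          simp only [Matrix.mul_assoc]
      _ = _ := by rw [hNM, Matrix.one_mul, Matrix.mul_one]
  have hlie : ∀ x y : g', N * (⁅x, y⁆ : g').1 * M =
      N * x.1 * M * (N * y.1 * M) - N * y.1 * M * (N * x.1 * M) := by
    intro x y
    rw [LieSubalgebra.coe_bracket, LieRing.of_associative_ring_bracket, Matrix.mul_sub,
      Matrix.sub_mul, conj_mul hMN, conj_mul hMN]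
  have hzero : ∀ x : g', N * x.1 * M = 0 → x = 0 := fun x hx => Subtype.ext
    (conj_injective hMN (show N * x.1 * M = N * 0 * M by rw [hx, Matrix.mul_zero, Matrix.zero_mul]))
  let D : ι ⊕ τ → K := Sum.elim (fun _ => c₀) s
  -- Bracketing with `S` multiplies the matrix entry `(i, j)` by `D i - D j`. This determines the
  -- centralizer of `S` and shows that a double bracket vanishes only if the single one does.
  have hSlie : ∀ (y : g') i j, (N * (⁅(⟨_, hS⟩ : g'), y⁆ : g').1 * M) i j =
      (D i - D j) * (N * y.1 * M) i j := by
    intro y i j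
    rw [hlie, hψS, ← diagonal_sum_elim, Matrix.sub_apply, diagonal_mul, mul_diagonal]
    ring
  let A : Submodule K g' :=
    { carrier := {a | ∃ (c : K) (d : τ → K), N * a.1 * M = fromBlocks (c • (1 : Matrix ι ι K)) 0 0 (diagonal d)}
      zero_mem' := ⟨0, 0, by simp⟩
      add_mem' := by
        rintro a b ⟨c, d, h⟩ ⟨c', d', h'⟩
        refine ⟨c + c', d + d', ?_⟩
        rw [show (a + b).1 = a.1 + b.1 from rfl, Matrix.mul_add, Matrix.add_mul, h, h', fromBlocks_add,
          add_smul, add_zero, add_zero, diagonal_add]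
        rfl
      smul_mem' := by
        rintro k a ⟨c, d, h⟩
        refine ⟨k * c, k • d, ?_⟩
        rw [show (k • a).1 = k • a.1 from rfl, Matrix.mul_smul, Matrix.smul_mul, h, fromBlocks_smul,
          mul_smul, smul_zero, smul_zero, diagonal_smul] }
  refine ⟨A, ⟨_, hS⟩, ⟨c₀, s, hψS⟩, ?_, ?_, fun y hy => ?_, fun y hy => ?_⟩
  · rintro a ⟨c, d, h⟩ b ⟨c', d', h'⟩
    apply hzero
    rw [hlie, h, h', fromBlocks_multiply, fromBlocks_multiply]
    simp [mul_comm, smul_smul]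
  · rintro a ⟨c, d, h⟩ x
    apply hzero
    rw [hlie, h, hf, fromBlocks_multiply, fromBlocks_multiply]
    simp
  · have h0 : ∀ i j, D i ≠ D j → (N * y.1 * M) i j = 0 := by
      intro i j hij
      have h1 := hSlie y i j
      rw [hy] at h1
      simpa [sub_eq_zero, hij] using h1
    have h1 : N * y.1 * M = fromBlocks (N * y.1 * M).toBlocks₁₁ 0 0
        (diagonal fun i => (N * y.1 * M) (Sum.inr i) (Sum.inr i)) := by
      ext i j
      rcases i with i | i <;> rcases j with j | j
      · rfl
      · exact h0 _ _ (hc j).symm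
      · exact h0 _ _ (hc i)
      · rw [fromBlocks_apply₂₂]
        by_cases hij : i = j
        · rw [hij, diagonal_apply_eq]
        · rw [diagonal_apply_ne _ hij]
          exact h0 _ _ fun h => hij (hs h)
    obtain ⟨x, c, hx⟩ := hcent _ y.2 _ _ h1
    refine ⟨x, y - f x, ⟨c, fun i => (N * y.1 * M) (Sum.inr i) (Sum.inr i), ?_⟩,
      (add_sub_cancel _ _).symm⟩
    rw [show (y - f x).1 = y.1 - (f x).1 from rfl, Matrix.mul_sub, Matrix.sub_mul, hf]
    conv_lhs => rw [h1]
    rw [sub_eq_iff_eq_add, fromBlocks_add, hx]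
    simp [add_comm]
  · apply hzero
    ext i j
    have h1 := hSlie ⁅(⟨_, hS⟩ : g'), y⁆ i j
    rw [hy, hSlie] at h1
    rw [hSlie]
    simpa using h1

end Blocks

/-! ### Hyperbolic bases for symmetric and alternating forms. -/

section Hyperbolic

variable {K V : Type*} [Field K] [AddCommGroup V] [Module K V]

/-- `p` and `q` are the two halves of a system of hyperbolic pairs for `B`. -/
structure IsHyperbolicSystem (B : V →ₗ[K] V →ₗ[K] K) {j : ℕ} (p q : Fin j → V) : Prop where
  left : ∀ i i', B (p i) (p i') = 0
  right : ∀ i i', B (q i) (q i') = 0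
  pair : ∀ i i', B (p i) (q i') = if i = i' then 1 else 0

variable {B : V →ₗ[K] V →ₗ[K] K} {ε : K}

lemma exists_isotropic [IsAlgClosed K] [CharZero K] (hε : ε = 1 ∨ ε = -1)
    (hB : ∀ x y, B x y = ε * B y x) (U : Submodule K V) (hU : 2 ≤ finrank K U) :
    ∃ v ∈ U, v ≠ 0 ∧ B v v = 0 := by
  haveI : Module.Finite K U := Module.finite_of_finrank_pos (by omega)
  obtain ⟨b, hb⟩ := exists_linearIndependent_of_le_finrank hU
  have hne : ∀ c d : K, c • (b 0 : V) + d • (b 1 : V) = 0 → c = 0 ∧ d = 0 := by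
    intro c d h
    have h1 : LinearIndependent K ![b 0, b 1] := by
      rwa [show ![b 0, b 1] = b from by ext i; fin_cases i <;> rfl]
    exact LinearIndependent.pair_iff.1 h1 c d (Subtype.ext h)
  rcases hε with rfl | rfl
  · by_cases h1 : B (b 1) (b 1) = 0
    · refine ⟨b 1, (b 1).2, fun h0 => one_ne_zero (hne 0 1 (by simp [h0])).2, h1⟩
    · obtain ⟨r, hr⟩ := IsAlgClosed.exists_eq_mul_self
        (B (b 0) (b 1) * B (b 0) (b 1) - B (b 0) (b 0) * B (b 1) (b 1))
      refine ⟨b 0 + ((r - B (b 0) (b 1)) / B (b 1) (b 1)) • b 1,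
        U.add_mem (b 0).2 (U.smul_mem _ (b 1).2), fun h0 =>
        one_ne_zero (hne 1 _ (by rw [one_smul]; exact h0)).1, ?_⟩
      have h2 : B (b 1) (b 0) = B (b 0) (b 1) := by rw [hB, one_mul]
      simp only [map_add, LinearMap.add_apply, map_smul, LinearMap.smul_apply, smul_eq_mul, h2]
      field_simp
      linear_combination -hr
  · refine ⟨b 0, (b 0).2, fun h0 => one_ne_zero (hne 1 0 (by simp [h0])).1, ?_⟩
    have := hB (b 0) (b 0)
    exact self_eq_neg.1 (by linear_combination this)

lemma IsHyperbolicSystem.linearIndependent {j : ℕ}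
    {p q : Fin j → V} (h : IsHyperbolicSystem B p q) : LinearIndependent K (Sum.elim p q) := by
  rw [Fintype.linearIndependent_iff]
  intro c hc
  rw [Fintype.sum_sum_type] at hc
  simp only [Sum.elim_inl, Sum.elim_inr] at hc
  rintro (i | i)
  · have h1 := congrArg (fun v => B v (q i)) hc
    simpa [map_sum, LinearMap.sum_apply, h.pair, h.right] using h1
  · have h1 := congrArg (fun v => B (p i) v) hc
    simpa [map_sum, h.pair, h.left] using h1

lemma IsHyperbolicSystem.exists_succ [IsAlgClosed K] [CharZero K] [FiniteDimensional K V]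
    (hε : ε = 1 ∨ ε = -1) (hB : ∀ x y, B x y = ε * B y x)
    (hnd : ∀ x, x ≠ 0 → ∃ y, B x y = 1) {j : ℕ} {p q : Fin j → V}
    (h : IsHyperbolicSystem B p q) (hj : 2 * (j + 1) ≤ finrank K V) :
    ∃ p' q' : Fin (j + 1) → V, IsHyperbolicSystem B p' q' := by
  have hεε : ε * ε = 1 := by rcases hε with h | h <;> simp [h]
  let φ : V →ₗ[K] (Fin j ⊕ Fin j → K) :=
    LinearMap.pi fun i => B (Sum.elim p q i)
  have hφ : ∀ v, v ∈ LinearMap.ker φ ↔ (∀ i, B (p i) v = 0) ∧ ∀ i, B (q i) v = 0 := by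
    intro v
    rw [LinearMap.mem_ker, funext_iff, Sum.forall]
    rfl
  have hdim : 2 ≤ finrank K (LinearMap.ker φ) := by
    have h1 := LinearMap.finrank_range_add_finrank_ker φ
    have h2 := Submodule.finrank_le (LinearMap.range φ)
    rw [finrank_fintype_fun_eq_card, Fintype.card_sum, Fintype.card_fin] at h2
    omega
  obtain ⟨v, hv, hv0, hvv⟩ := exists_isotropic hε hB _ hdim
  obtain ⟨hpv, hqv⟩ := (hφ v).1 hv
  have hvp : ∀ i, B v (p i) = 0 := fun i => by rw [hB, hpv, mul_zero]
  have hvq : ∀ i, B v (q i) = 0 := fun i => by rw [hB, hqv, mul_zero]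
  obtain ⟨w, hw⟩ := hnd v hv0
  have hqp : ∀ i i', B (q i) (p i') = if i = i' then ε else 0 := fun i i' => by
    rw [hB, h.pair]
    by_cases hi : i = i'
    · rw [if_pos hi, if_pos hi.symm, mul_one]
    · rw [if_neg hi, if_neg (Ne.symm hi), mul_zero]
  obtain ⟨u, hu, hvu⟩ : ∃ u, ((∀ i, B (p i) u = 0) ∧ ∀ i, B (q i) u = 0) ∧ B v u = 1 := by
    -- Project `w` off the existing pairs; the factor `ε` compensates `B (q i) (p i) = ε`.
    refine ⟨w - ∑ i, (ε * B (q i) w) • p i - ∑ i, B (p i) w • q i, ⟨fun i => ?_, fun i => ?_⟩, ?_⟩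
    · simp [map_sub, map_sum, h.left, h.pair]
    · simp only [map_sub, map_sum, map_smul, smul_eq_mul, h.right, hqp, mul_zero,
        Finset.sum_const_zero, sub_zero, mul_ite, Finset.sum_ite_eq, Finset.mem_univ, if_true]
      linear_combination -(B (q i) w) * hεε
    · simp [map_sub, map_sum, hvp, hvq, hw]
  obtain ⟨u', hu', hvu', huu⟩ : ∃ u', ((∀ i, B (p i) u' = 0) ∧ ∀ i, B (q i) u' = 0) ∧
      B v u' = 1 ∧ B u' u' = 0 := by
    -- Since `v` is isotropic and paired to `1` with `u`, this makes `u` isotropic without changing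
    -- the pairing; in the alternating case the correction is zero.
    refine ⟨u - (B u u / 2) • v, ⟨fun i => ?_, fun i => ?_⟩, ?_, ?_⟩
    · simp [hu.1, hpv]
    · simp [hu.2, hqv]
    · simp [hvu, hvv]
    · have h1 : B u v = ε := by rw [hB, hvu, mul_one]
      simp only [map_sub, map_smul, LinearMap.sub_apply, LinearMap.smul_apply, smul_eq_mul, hvu,
        hvv, h1]
      rcases hε with rfl | rfl
      · ring
      · have h2 := hB u u
        linear_combination h2 / 2
  have hup : ∀ i, B u' (p i) = 0 := fun i => by rw [hB, hu'.1, mul_zero]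
  have huq : ∀ i, B u' (q i) = 0 := fun i => by rw [hB, hu'.2, mul_zero]
  refine ⟨Fin.cons v p, Fin.cons u' q, ?_, ?_, ?_⟩
  · simp [Fin.forall_fin_succ, hvv, hvp, hpv, h.left]
  · simp [Fin.forall_fin_succ, huu, huq, hu'.2, h.right]
  · simp [Fin.forall_fin_succ, hvu', hvq, hu'.1, h.pair, Fin.succ_ne_zero, eq_comm]

/-- A nondegenerate symmetric or alternating form on a space of even dimension has a hyperbolic
basis. -/
theorem exists_basis_isHyperbolicSystem [IsAlgClosed K] [CharZero K] [FiniteDimensional K V]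
    (hε : ε = 1 ∨ ε = -1) (hB : ∀ x y, B x y = ε * B y x)
    (hnd : ∀ x, x ≠ 0 → ∃ y, B x y = 1) {m : ℕ} (hm : finrank K V = 2 * m) :
    ∃ b : Basis (Fin m ⊕ Fin m) K V,
      IsHyperbolicSystem B (fun i => b (Sum.inl i)) fun i => b (Sum.inr i) := by
  have key : ∀ j, j ≤ m → ∃ p q : Fin j → V, IsHyperbolicSystem B p q := by
    intro j
    induction j with
    | zero => exact fun _ => ⟨0, 0, fun i => i.elim0, fun i => i.elim0, fun i => i.elim0⟩
    | succ j ih =>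
      intro hj
      obtain ⟨p, q, h⟩ := ih (by omega)
      exact h.exists_succ hε hB hnd (by omega)
  obtain ⟨p, q, h⟩ := key m le_rfl
  have hcard : Fintype.card (Fin m ⊕ Fin m) = finrank K V := by
    rw [Fintype.card_sum, Fintype.card_fin, hm, two_mul]
  refine ⟨basisOfLinearIndependentOfCardEqFinrank' _ (h.linearIndependent) hcard, ?_⟩
  simpa using h

end Hyperbolic

/-! ### Embeddings of multiplicity one are split. -/

section Adapted

open Matrix

variable {K ι ι' τ : Type*} [Field K] [Fintype ι] [DecidableEq ι] [Fintype ι'] [DecidableEq ι']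
  [Fintype τ] [DecidableEq τ]

/-- Under a diagonal embedding of multiplicity one, the natural representation splits as the
natural representation or its dual plus a trivial representation. -/
lemma exists_block_basis {g : LieSubalgebra K (Matrix ι ι K)} {g' : LieSubalgebra K (Matrix ι' ι' K)}
    (δ : g → g') {k l z : ℕ} (hkl : k + l = 1)
    (e : (ι' → K) ≃ₗ[K] ((Fin k → (ι → K)) × (Fin l → (ι → K)) × (Fin z → K)))
    (he : ∀ x v, e ((δ x).1 *ᵥ v) =
      (fun i => x.1 *ᵥ ((e v).1 i), fun j => (-x.1ᵀ) *ᵥ ((e v).2.1 j), 0)) :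
    ∃ (σ : Bool) (M : Matrix ι' (ι ⊕ Fin z) K) (N : Matrix (ι ⊕ Fin z) ι' K),
      N * M = 1 ∧ M * N = 1 ∧ ∀ x, N * (δ x).1 * M = fromBlocks (act σ x.1) 0 0 0 := by
  suffices h : ∃ (σ : Bool) (E : (ι' → K) ≃ₗ[K] (ι ⊕ Fin z → K)), ∀ x v,
      E ((δ x).1 *ᵥ v) = fromBlocks (act σ x.1) 0 0 0 *ᵥ E v by
    obtain ⟨σ, E, hE⟩ := h
    refine ⟨σ, LinearMap.toMatrix' (E.symm : (ι ⊕ Fin z → K) →ₗ[K] (ι' → K)),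
      LinearMap.toMatrix' (E : (ι' → K) →ₗ[K] (ι ⊕ Fin z → K)), ?_, ?_, fun x => ?_⟩
    · rw [← LinearMap.toMatrix'_comp, LinearEquiv.comp_symm, LinearMap.toMatrix'_id]
    · rw [← LinearMap.toMatrix'_comp, LinearEquiv.symm_comp, LinearMap.toMatrix'_id]
    · apply Matrix.toLin'.injective
      apply LinearMap.ext
      intro v
      rw [Matrix.toLin'_mul, Matrix.toLin'_mul, Matrix.toLin'_toMatrix', Matrix.toLin'_toMatrix']
      change E ((δ x).1 *ᵥ E.symm v) = _
      rw [hE, LinearEquiv.apply_symm_apply, Matrix.toLin'_apply]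
  have hcases : (k = 1 ∧ l = 0) ∨ (k = 0 ∧ l = 1) := by omega
  rcases hcases with ⟨rfl, rfl⟩ | ⟨rfl, rfl⟩
  · let F : ((Fin 1 → (ι → K)) × (Fin 0 → (ι → K)) × (Fin z → K)) ≃ₗ[K] (ι ⊕ Fin z → K) :=
      (LinearEquiv.prodCongr (LinearEquiv.funUnique (Fin 1) K (ι → K))
        LinearEquiv.uniqueProd).trans (LinearEquiv.sumArrowLequivProdArrow ι (Fin z) K K).symm
    have hF : ∀ a, F a = Sum.elim (a.1 0) a.2.2 := fun a => by
      funext i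
      cases i <;> rfl
    refine ⟨true, e.trans F, fun x v => ?_⟩
    change F (e _) = _ *ᵥ F (e v)
    rw [he, hF, hF, fromBlocks_mulVec]
    funext i
    cases i <;> simp [act]
  · let F : ((Fin 0 → (ι → K)) × (Fin 1 → (ι → K)) × (Fin z → K)) ≃ₗ[K] (ι ⊕ Fin z → K) :=
      (LinearEquiv.uniqueProd).trans ((LinearEquiv.prodCongr
        (LinearEquiv.funUnique (Fin 1) K (ι → K)) (LinearEquiv.refl K (Fin z → K))).trans
          (LinearEquiv.sumArrowLequivProdArrow ι (Fin z) K K).symm)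
    have hF : ∀ a, F a = Sum.elim (a.2.1 0) a.2.2 := fun a => by
      funext i
      cases i <;> rfl
    refine ⟨false, e.trans F, fun x v => ?_⟩
    change F (e _) = _ *ᵥ F (e v)
    rw [he, hF, hF, fromBlocks_mulVec]
    funext i
    cases i <;> simp [act]

/-- `S` has eigenvalues `1, …, z` on the trivial part. The scalar that makes its trace zero on the
other block is nonpositive, so it differs from all of them. -/
lemma IsSpecialLinear.isSplitEmbedding [CharZero K] {g : LieSubalgebra K (Matrix ι ι K)}
    {g' : LieSubalgebra K (Matrix ι' ι' K)} (hg : IsSpecialLinear g) (hg' : IsSpecialLinear g')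
    (δ : g →ₗ⁅K⁆ g') {z : ℕ} {σ : Bool} {M : Matrix ι' (ι ⊕ Fin z) K}
    {N : Matrix (ι ⊕ Fin z) ι' K} (hNM : N * M = 1) (hMN : M * N = 1)
    (hδ : ∀ x, N * (δ x).1 * M = fromBlocks (act σ x.1) 0 0 0) : IsSplitEmbedding δ := by
  have hn : (Fintype.card ι : K) ≠ 0 := by
    have := hg.two_le_card
    exact Nat.cast_ne_zero.2 (by omega)
  let s : Fin z → K := fun j => ((j : ℕ) + 1 : ℕ)
  refine isSplitEmbedding_of_blocks δ hNM hMN (fun x => act σ x.1) hδ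
    (c₀ := -((∑ j : Fin z, ((j : ℕ) + 1) : ℕ) : K) / Fintype.card ι) (s := s)
    (fun i j hij => ?_) (fun i hi => ?_) ?_ fun y hy Y d hY => ?_
  · have := Nat.cast_injective (R := K) hij
    exact Fin.ext (by omega)
  · dsimp only [s] at hi
    rw [eq_div_iff hn, eq_neg_iff_add_eq_zero] at hi
    have h1 : (((i : ℕ) + 1) * Fintype.card ι + ∑ j : Fin z, ((j : ℕ) + 1) : ℕ) = 0 := by
      exact_mod_cast hi
    have h2 := hg.two_le_card
    have h3 : 0 < ((i : ℕ) + 1) * Fintype.card ι := Nat.mul_pos (by omega) (by omega)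
    omega
  · rw [hg'.mem_iff, trace_mul_comm, ← Matrix.mul_assoc, hNM, Matrix.one_mul, ← diagonal_sum_elim,
      trace_diagonal, Fintype.sum_sum_type]
    simp only [Sum.elim_inl, Sum.elim_inr, Finset.sum_const, Finset.card_univ, nsmul_eq_mul]
    rw [mul_div_cancel₀ _ hn, Nat.cast_sum]
    exact neg_add_cancel _
  · have h1 : (Y - (Y.trace / Fintype.card ι) • 1).trace = 0 := by
      rw [trace_sub, trace_smul, trace_one, smul_eq_mul, div_mul_cancel₀ _ hn, sub_self]
    cases σ
    · refine ⟨⟨-(Y - (Y.trace / Fintype.card ι) • 1)ᵀ, (hg.mem_iff _).2 ?_⟩,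
        Y.trace / Fintype.card ι, ?_⟩
      · rw [trace_neg, trace_transpose, h1, neg_zero]
      · simp [act]
    · exact ⟨⟨_, (hg.mem_iff _).2 h1⟩, Y.trace / Fintype.card ι, by simp [act]⟩

lemma mul_mul_eq_one {α β γ : Type*} [Fintype α] [DecidableEq α] [Fintype β] [DecidableEq β]
    [Fintype γ] [DecidableEq γ] {M : Matrix α β K} {N : Matrix β α K} {Q : Matrix β γ K}
    {R : Matrix γ β K} (hNM : N * M = 1) (hRQ : R * Q = 1) : R * N * (M * Q) = 1 := by
  rw [Matrix.mul_assoc, ← Matrix.mul_assoc N, hNM, Matrix.one_mul, hRQ]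

lemma mul_conj {α β γ : Type*} [Fintype α] [Fintype β] [Fintype γ] (M : Matrix α β K)
    (N : Matrix β α K) (Q : Matrix β γ K) (R : Matrix γ β K) (X : Matrix α α K) :
    R * N * X * (M * Q) = R * (N * X * M) * Q := by
  simp only [Matrix.mul_assoc]

namespace IsIsometryAlgebra

/-- Schur's lemma: `J⁻¹ * A` commutes with `g`, so an eigenspace of it is stable and, by
irreducibility, everything. -/
lemma eq_smul_of_invariant [IsAlgClosed K] [CharZero K] {g : LieSubalgebra K (Matrix ι ι K)}
    {J : Matrix ι ι K} {ε : K} (hg : IsIsometryAlgebra g J ε) {A : Matrix ι ι K}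
    (hA : ∀ x ∈ g, xᵀ * A + A * x = 0) : ∃ c : K, A = c • J := by
  haveI : Nonempty ι := Fintype.card_pos_iff.1 (by have := hg.two_le_card; omega)
  have hcomm : ∀ x ∈ g, J⁻¹ * A * x = x * (J⁻¹ * A) := by
    intro x hx
    have h1 := eq_neg_of_add_eq_zero_right (hA x hx)
    have h2 := eq_neg_of_add_eq_zero_left ((hg.mem_iff x).1 hx)
    have h3 : J⁻¹ * xᵀ = -(x * J⁻¹) := by
      calc J⁻¹ * xᵀ = J⁻¹ * (xᵀ * J) * J⁻¹ := by
            rw [Matrix.mul_assoc, Matrix.mul_assoc, hg.mul_inv_self, Matrix.mul_one]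
        _ = -((J⁻¹ * J) * x * J⁻¹) := by rw [h2]; simp only [mul_neg, neg_mul, Matrix.mul_assoc]
        _ = _ := by rw [hg.inv_mul_self, Matrix.one_mul]
    rw [Matrix.mul_assoc, h1, mul_neg, ← Matrix.mul_assoc, h3, neg_mul, neg_neg, Matrix.mul_assoc]
  obtain ⟨c, hc⟩ := Module.End.exists_eigenvalue (Matrix.toLin' (J⁻¹ * A))
  obtain ⟨v, hv⟩ := hc.exists_hasEigenvector
  have htop := hg.eq_top_of_stable (Module.End.eigenspace (Matrix.toLin' (J⁻¹ * A)) c)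
    (fun x hx v hv => by
      rw [Module.End.mem_eigenspace_iff, toLin'_apply] at hv ⊢
      rw [mulVec_mulVec, hcomm x hx, ← mulVec_mulVec, hv, mulVec_smul]) hv.1 hv.2
  have h1 : J⁻¹ * A = c • 1 := by
    apply Matrix.toLin'.injective
    apply LinearMap.ext
    intro v
    have hv : v ∈ Module.End.eigenspace (Matrix.toLin' (J⁻¹ * A)) c := htop ▸ Submodule.mem_top
    rw [Module.End.mem_eigenspace_iff.1 hv]
    simp
  refine ⟨c, ?_⟩
  rw [← Matrix.one_mul A, ← hg.mul_inv_self, Matrix.mul_assoc, h1, Matrix.mul_smul, Matrix.mul_one]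

/-- The form identifies the dual with the natural representation, so a change of basis by `J`
removes the dual case. -/
lemma exists_block_basis_true {g : LieSubalgebra K (Matrix ι ι K)} {J : Matrix ι ι K} {ε : K}
    (hg : IsIsometryAlgebra g J ε) {X : g → Matrix ι' ι' K} {σ : Bool}
    {M : Matrix ι' (ι ⊕ τ) K} {N : Matrix (ι ⊕ τ) ι' K} (hNM : N * M = 1) (hMN : M * N = 1)
    (hX : ∀ x, N * X x * M = fromBlocks (act σ x.1) 0 0 0) :
    ∃ (M : Matrix ι' (ι ⊕ τ) K) (N : Matrix (ι ⊕ τ) ι' K), N * M = 1 ∧ M * N = 1 ∧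
      ∀ x, N * X x * M = fromBlocks x.1 0 0 0 := by
  cases σ
  · have h1 : fromBlocks J⁻¹ 0 0 1 * fromBlocks J 0 0 (1 : Matrix τ τ K) = 1 := by
      rw [fromBlocks_multiply]
      simp [hg.inv_mul_self]
    have h2 : fromBlocks J 0 0 1 * fromBlocks J⁻¹ 0 0 (1 : Matrix τ τ K) = 1 := by
      rw [fromBlocks_multiply]
      simp [hg.mul_inv_self]
    refine ⟨_, _, mul_mul_eq_one hNM h1, mul_mul_eq_one h2 hMN, fun x => ?_⟩
    have h3 := eq_neg_of_add_eq_zero_left ((hg.mem_iff x.1).1 x.2)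
    rw [mul_conj, hX, fromBlocks_multiply, fromBlocks_multiply]
    simp only [act, Bool.false_eq_true, if_false, Matrix.mul_zero, Matrix.zero_mul, add_zero,
      mul_neg, neg_mul, Matrix.mul_assoc, h3, neg_neg]
    rw [← Matrix.mul_assoc, hg.inv_mul_self, Matrix.one_mul]
  · exact ⟨M, N, hNM, hMN, hX⟩

lemma mem_iff_conj {ν : Type*} [Fintype ν] [DecidableEq ν] {g' : LieSubalgebra K (Matrix ι' ι' K)}
    {J' : Matrix ι' ι' K} {ε : K} (hg' : IsIsometryAlgebra g' J' ε) {M : Matrix ι' ν K}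
    {N : Matrix ν ι' K} (hMN : M * N = 1) (x : Matrix ι' ι' K) :
    x ∈ g' ↔ (N * x * M)ᵀ * (Mᵀ * J' * M) + Mᵀ * J' * M * (N * x * M) = 0 := by
  have h1 : (N * x * M)ᵀ * (Mᵀ * J' * M) + Mᵀ * J' * M * (N * x * M) =
      Mᵀ * (xᵀ * J' + J' * x) * M := by
    calc (N * x * M)ᵀ * (Mᵀ * J' * M) + Mᵀ * J' * M * (N * x * M)
        = Mᵀ * xᵀ * (M * N)ᵀ * J' * M + Mᵀ * J' * (M * N) * x * M := by
          simp only [transpose_mul, Matrix.mul_assoc]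
      _ = _ := by
        rw [hMN, transpose_one]
        simp only [Matrix.mul_one, Matrix.mul_add, Matrix.add_mul, Matrix.mul_assoc]
  rw [hg'.mem_iff, h1]
  refine ⟨fun h => by rw [h, Matrix.mul_zero, Matrix.zero_mul], fun h => ?_⟩
  calc xᵀ * J' + J' * x = (M * N)ᵀ * (xᵀ * J' + J' * x) * (M * N) := by
        rw [hMN, transpose_one, Matrix.one_mul, Matrix.mul_one]
    _ = Nᵀ * (Mᵀ * (xᵀ * J' + J' * x) * M) * N := by
      simp only [transpose_mul, Matrix.mul_assoc]
    _ = 0 := by rw [h, Matrix.mul_zero, Matrix.zero_mul]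

/-- In an adapted basis the form is block diagonal, with the form of the smaller algebra as its
first block. -/
lemma exists_form_eq_fromBlocks [IsAlgClosed K] [CharZero K] {g : LieSubalgebra K (Matrix ι ι K)}
    {J : Matrix ι ι K} {ε : K} (hg : IsIsometryAlgebra g J ε) {g' : LieSubalgebra K (Matrix ι' ι' K)}
    {J' : Matrix ι' ι' K} {ε' : K} (hg' : IsIsometryAlgebra g' J' ε') (δ : g → g')
    {M : Matrix ι' (ι ⊕ τ) K} {N : Matrix (ι ⊕ τ) ι' K} (hNM : N * M = 1) (hMN : M * N = 1)
    (hδ : ∀ x, N * (δ x).1 * M = fromBlocks x.1 0 0 0) :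
    ∃ (c : K) (D : Matrix τ τ K), c ≠ 0 ∧ IsUnit D ∧ Dᵀ = ε' • D ∧
      Mᵀ * J' * M = fromBlocks (c • J) 0 0 D := by
  set F := Mᵀ * J' * M with hF
  have hinv : ∀ x ∈ g, (fromBlocks x 0 0 0)ᵀ * F + F * fromBlocks x 0 0 (0 : Matrix τ τ K) = 0 := by
    intro x hx
    rw [← hδ ⟨x, hx⟩]
    exact (hg'.mem_iff_conj hMN _).1 (δ ⟨x, hx⟩).2
  rw [← fromBlocks_toBlocks F] at hinv
  simp only [fromBlocks_transpose, fromBlocks_multiply, fromBlocks_add, transpose_zero,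
    Matrix.zero_mul, Matrix.mul_zero, add_zero, zero_add] at hinv
  replace hinv := fun x hx => fromBlocks_inj.1 ((hinv x hx).trans fromBlocks_zero.symm)
  have h11 : ∀ x ∈ g, xᵀ * F.toBlocks₁₁ + F.toBlocks₁₁ * x = 0 := fun x hx => (hinv x hx).1
  -- Columns of the off-diagonal block are invariants of the dual representation, hence zero.
  have h12 : F.toBlocks₁₂ = 0 := by
    ext i j
    have : F.toBlocks₁₂.col j = 0 := hg.eq_zero_of_transpose_mulVec_eq_zero fun x hx => by
      have h1 : xᵀ * F.toBlocks₁₂ = 0 := (hinv x hx).2.1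
      funext k
      exact congrFun (congrFun h1 k) j
    exact congrFun this i
  have h21 : F.toBlocks₂₁ = 0 := by
    ext i j
    have : F.toBlocks₂₁.row i = 0 := hg.eq_zero_of_transpose_mulVec_eq_zero fun x hx => by
      have h1 : F.toBlocks₂₁ * x = 0 := (hinv x hx).2.2.1
      rw [mulVec_transpose]
      funext k
      exact congrFun (congrFun h1 i) k
    exact congrFun this j
  obtain ⟨c, hc⟩ := hg.eq_smul_of_invariant h11
  have hFb : F = fromBlocks (c • J) 0 0 F.toBlocks₂₂ := by
    conv_lhs => rw [← fromBlocks_toBlocks F, h12, h21, hc]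
  have hFu : IsUnit F := by
    refine IsUnit.of_mul_eq_one (N * J'⁻¹ * Nᵀ) ?_
    calc Mᵀ * J' * M * (N * J'⁻¹ * Nᵀ) = Mᵀ * J' * (M * N) * J'⁻¹ * Nᵀ := by
          simp only [Matrix.mul_assoc]
      _ = Mᵀ * (J' * J'⁻¹) * Nᵀ := by rw [hMN, Matrix.mul_one, Matrix.mul_assoc Mᵀ]
      _ = 1 := by rw [hg'.mul_inv_self, Matrix.mul_one, ← transpose_mul, hNM, transpose_one]
  have hFt : Fᵀ = ε' • F := by
    rw [hF]
    simp only [transpose_mul, transpose_transpose, hg'.transpose_eq, Matrix.smul_mul,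
      Matrix.mul_smul, Matrix.mul_assoc]
  have hunits : IsUnit (c • J) ∧ IsUnit F.toBlocks₂₂ := by
    rw [hFb] at hFu
    exact isUnit_fromBlocks_zero₂₁.1 hFu
  refine ⟨c, F.toBlocks₂₂, ?_, hunits.2, ?_, hFb⟩
  · rintro rfl
    haveI : Nonempty ι := Fintype.card_pos_iff.1 (by have := hg.two_le_card; omega)
    rw [zero_smul] at hunits
    exact not_isUnit_zero hunits.1
  · have := congrArg toBlocks₂₂ hFt
    exact this

/-- In a hyperbolic basis of the trivial part, `S` acts by `i + 1` and `-(i + 1)` on the `i`-th pair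
and by `0` on the natural part. Opposite values on each pair make `S` skew, and all of these
eigenvalues are distinct. -/
lemma isSplitEmbedding [IsAlgClosed K] [CharZero K] {g : LieSubalgebra K (Matrix ι ι K)}
    {J : Matrix ι ι K} {ε : K} (hg : IsIsometryAlgebra g J ε) {g' : LieSubalgebra K (Matrix ι' ι' K)}
    {J' : Matrix ι' ι' K} {ε' : K} (hg' : IsIsometryAlgebra g' J' ε') (δ : g →ₗ⁅K⁆ g') {m : ℕ}
    (hτ : Fintype.card τ = 2 * m) {σ : Bool} {M : Matrix ι' (ι ⊕ τ) K}
    {N : Matrix (ι ⊕ τ) ι' K} (hNM : N * M = 1) (hMN : M * N = 1)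
    (hδ : ∀ x, N * (δ x).1 * M = fromBlocks (act σ x.1) 0 0 0) : IsSplitEmbedding δ := by
  obtain ⟨M, N, hNM, hMN, hδ⟩ := hg.exists_block_basis_true hNM hMN hδ
  obtain ⟨c, D, hc, hDu, hDt, hF⟩ := hg.exists_form_eq_fromBlocks hg' δ hNM hMN hδ
  let B : (τ → K) →ₗ[K] (τ → K) →ₗ[K] K := Matrix.toLinearMap₂' K D
  have hB : ∀ x y, B x y = x ⬝ᵥ D *ᵥ y := fun x y => Matrix.toLinearMap₂'_apply' D x y
  have hsymm : ∀ x y, B x y = ε' * B y x := by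
    intro x y
    rw [hB, hB, dotProduct_mulVec, ← mulVec_transpose, hDt, smul_mulVec, smul_dotProduct,
      smul_eq_mul, dotProduct_comm]
  have hnd : ∀ x, x ≠ 0 → ∃ y, B x y = 1 := by
    intro x hx
    have h0 : x ᵥ* D ≠ 0 := fun h => hx ((vecMul_injective_iff_isUnit.2 hDu) (h.trans (zero_vecMul D).symm))
    obtain ⟨y, hy⟩ := exists_dotProduct_eq_one h0
    exact ⟨y, by rw [hB, dotProduct_mulVec, dotProduct_comm, hy]⟩
  obtain ⟨b, hb⟩ := exists_basis_isHyperbolicSystem hg'.sign hsymm hnd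
    (by rw [finrank_fintype_fun_eq_card, hτ])
  let Q : Matrix τ (Fin m ⊕ Fin m) K := (Pi.basisFun K τ).toMatrix b
  let R : Matrix (Fin m ⊕ Fin m) τ K := b.toMatrix (Pi.basisFun K τ)
  have hQR : Q * R = 1 := Basis.toMatrix_mul_toMatrix_flip _ _
  have hRQ : R * Q = 1 := Basis.toMatrix_mul_toMatrix_flip _ _
  have hQD : ∀ i j, (Qᵀ * D * Q) i j = B (b i) (b j) := by
    intro i j
    have hQ : ∀ k i, Q k i = b i k := fun k i => by
      simp only [Q, Basis.toMatrix_apply, Pi.basisFun_repr]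
    rw [hB, Matrix.mul_assoc, Matrix.mul_apply]
    refine Finset.sum_congr rfl fun k _ => ?_
    rw [transpose_apply, hQ, Matrix.mul_apply]
    simp only [hQ]
    rfl
  have hQR₁ : fromBlocks (1 : Matrix ι ι K) 0 0 Q * fromBlocks (1 : Matrix ι ι K) 0 0 R = 1 := by
    rw [fromBlocks_multiply]
    simp [hQR]
  have hRQ₁ : fromBlocks (1 : Matrix ι ι K) 0 0 R * fromBlocks (1 : Matrix ι ι K) 0 0 Q = 1 := by
    rw [fromBlocks_multiply]
    simp [hRQ]
  let M₁ := M * fromBlocks (1 : Matrix ι ι K) 0 0 Q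
  let N₁ := fromBlocks (1 : Matrix ι ι K) 0 0 R * N
  have hNM₁ : N₁ * M₁ = 1 := mul_mul_eq_one hNM hRQ₁
  have hMN₁ : M₁ * N₁ = 1 := mul_mul_eq_one hQR₁ hMN
  have hδ₁ : ∀ x, N₁ * (δ x).1 * M₁ = fromBlocks x.1 0 0 0 := by
    intro x
    rw [mul_conj, hδ, fromBlocks_multiply, fromBlocks_multiply]
    simp
  have hF₁ : M₁ᵀ * J' * M₁ = fromBlocks (c • J) 0 0 (Qᵀ * D * Q) := by
    calc M₁ᵀ * J' * M₁
        = (fromBlocks (1 : Matrix ι ι K) 0 0 Q)ᵀ * (Mᵀ * J' * M) *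
            fromBlocks (1 : Matrix ι ι K) 0 0 Q := by
          simp only [M₁, transpose_mul, Matrix.mul_assoc]
      _ = _ := by
        rw [hF, fromBlocks_transpose, fromBlocks_multiply, fromBlocks_multiply]
        simp
  let s : Fin m ⊕ Fin m → K := Sum.elim (fun i => ((i : ℕ) + 1 : ℕ)) fun i => -((i : ℕ) + 1 : ℕ)
  have hcast : ∀ i j : Fin m, (((i : ℕ) + 1 : ℕ) : K) ≠ -(((j : ℕ) + 1 : ℕ) : K) := by
    intro i j h
    rw [eq_neg_iff_add_eq_zero] at h
    have : (((i : ℕ) + 1) + ((j : ℕ) + 1) : ℕ) = 0 := by exact_mod_cast h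
    omega
  have hinj : ∀ i j : Fin m, (((i : ℕ) + 1 : ℕ) : K) = (((j : ℕ) + 1 : ℕ) : K) → i = j := by
    intro i j h
    have := Nat.cast_injective (R := K) h
    exact Fin.ext (by omega)
  refine isSplitEmbedding_of_blocks δ hNM₁ hMN₁ (fun x => x.1) hδ₁ (c₀ := 0) (s := s)
    ?_ ?_ ?_ fun y hy Y d hY => ?_
  · rintro (i | i) (j | j) h
    · exact congrArg _ (hinj i j h)
    · exact absurd h (hcast i j)
    · exact absurd h.symm (hcast j i)
    · exact congrArg _ (hinj i j (neg_injective h))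
  · rintro (i | i) h
    · exact Nat.cast_ne_zero.2 (Nat.succ_ne_zero i) h
    · exact Nat.cast_ne_zero.2 (Nat.succ_ne_zero i) (neg_eq_zero.1 h)
  · rw [hg'.mem_iff_conj hMN₁, hF₁]
    have h1 : N₁ * (M₁ * fromBlocks ((0 : K) • (1 : Matrix ι ι K)) 0 0 (diagonal s) * N₁) * M₁ =
        fromBlocks 0 0 0 (diagonal s) := by
      calc _ = (N₁ * M₁) * fromBlocks ((0 : K) • (1 : Matrix ι ι K)) 0 0 (diagonal s) *
            (N₁ * M₁) := by simp only [Matrix.mul_assoc]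
        _ = _ := by rw [hNM₁, Matrix.one_mul, Matrix.mul_one, zero_smul]
    have h2 : diagonal s * (Qᵀ * D * Q) + Qᵀ * D * Q * diagonal s = 0 := by
      ext i j
      rw [Matrix.add_apply, diagonal_mul, mul_diagonal, hQD, Matrix.zero_apply]
      rcases i with i | i <;> rcases j with j | j
      · rw [hb.left, mul_zero, zero_mul, add_zero]
      · rw [hb.pair]
        by_cases hij : i = j
        · simp [s, hij]
        · simp [hij]
      · rw [hsymm, hb.pair]
        by_cases hij : j = i
        · simp [s, hij]
          ring
        · simp [hij]
      · rw [hb.right, mul_zero, zero_mul, add_zero]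
    rw [h1, fromBlocks_transpose, fromBlocks_multiply, fromBlocks_multiply, fromBlocks_add]
    simp [h2]
  · rw [hg'.mem_iff_conj hMN₁, hY, hF₁, fromBlocks_transpose, fromBlocks_multiply,
      fromBlocks_multiply, fromBlocks_add] at hy
    have h1 : Yᵀ * (c • J) + c • J * Y = 0 := by
      simpa using (fromBlocks_inj.1 (hy.trans fromBlocks_zero.symm)).1
    rw [Matrix.mul_smul, Matrix.smul_mul, ← smul_add] at h1
    exact ⟨⟨Y, (hg.mem_iff Y).2 ((smul_eq_zero.1 h1).resolve_left hc)⟩, 0, by simp⟩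

end IsIsometryAlgebra

end Adapted

/-! ### Root reductivity: statement (iii). -/

section Final

open Matrix

variable {K : Type*} [Field K] [IsAlgClosed K] [CharZero K]

/-- A diagonal embedding whose nontrivial part has multiplicity one is split. -/
theorem isSplitEmbedding_of_multiplicity_eq_one {t : ClassicalType} {r s : ℕ}
    (hr : LieAlgebra.IsSimple K (classical K t r)) (hs : LieAlgebra.IsSimple K (classical K t s))
    (δ : classical K t r →ₗ⁅K⁆ classical K t s) {k l z : ℕ} (hkl : k + l = 1)
    (e : (t.Index s → K) ≃ₗ[K]
      ((Fin k → (t.Index r → K)) × (Fin l → (t.Index r → K)) × (Fin z → K)))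
    (he : ∀ (x : classical K t r) (v : t.Index s → K), e ((δ x).1 *ᵥ v) =
      (fun i => x.1 *ᵥ ((e v).1 i), fun j => (-x.1ᵀ) *ᵥ ((e v).2.1 j), 0)) :
    IsSplitEmbedding δ := by
  obtain ⟨σ, M, N, hNM, hMN, hδ⟩ := exists_block_basis δ hkl e he
  rcases classical_cases t r hr with ⟨ht, hg⟩ | ⟨ht, J, ε, hg⟩ <;>
    rcases classical_cases t s hs with ⟨ht', hg'⟩ | ⟨ht', J', ε', hg'⟩
  · exact hg.isSplitEmbedding hg' δ hNM hMN hδ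
  · exact absurd ht ht'
  · exact absurd ht' ht
  · have hdim : Fintype.card (t.Index s) = Fintype.card (t.Index r) + z := by
      have h1 := e.finrank_eq
      simp only [Module.finrank_prod, Module.finrank_pi_fintype, Module.finrank_self,
        Finset.sum_const, Finset.card_univ, Fintype.card_fin, smul_eq_mul, mul_one] at h1
      rw [h1, ← add_assoc, ← add_mul, hkl, one_mul]
    -- Both levels have the same type `B`, `C` or `D`, so their natural dimensions have the same
    -- parity.
    obtain ⟨m, hm⟩ : ∃ m, z = 2 * m := by
      refine ⟨s - r, ?_⟩
      cases t
      · exact absurd rfl ht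
      · rw [card_index_B, card_index_B] at hdim
        omega
      · rw [card_index_C, card_index_C] at hdim
        omega
      · rw [card_index_D, card_index_D] at hdim
        omega
    exact hg.isSplitEmbedding hg' δ (by rw [Fintype.card_fin, hm]) hNM hMN hδ

lemma hasCentralRadical_of_isKilling (g : Type*) [LieRing g] [LieAlgebra K g]
    [FiniteDimensional K g] [LieAlgebra.IsKilling K g] : LieAlgebra.HasCentralRadical K g := by
  apply LieAlgebra.hasCentralRadical_of_radical_le
  rw [LieAlgebra.HasTrivialRadical.radical_eq_bot]
  exact bot_le

namespace DiagonalIndAlgebra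

variable {L : Type*} [LieRing L] [LieAlgebra K L] {G : DiagonalIndAlgebra K L}

lemma range_le_range_succ (G : DiagonalIndAlgebra K L) (n : ℕ) :
    (G.ι n).range ≤ (G.ι (n + 1)).range := by
  rintro _ ⟨x, rfl⟩
  exact ⟨G.δ n x, G.ι_comp_δ n x⟩

/-- The canonical isomorphism of `𝔤ₙ` with its image in the limit. -/
noncomputable def equivRange (G : DiagonalIndAlgebra K L) (n : ℕ) :
    G.g n ≃ₗ⁅K⁆ (G.ι n).range :=
  LieEquiv.ofInjective (G.ι n) (G.ι_injective n)

lemma inclusion_equivRange (G : DiagonalIndAlgebra K L) (n : ℕ) (x : G.g n) :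
    LieSubalgebra.inclusion (G.range_le_range_succ n) (G.equivRange n x) =
      G.equivRange (n + 1) (G.δ n x) :=
  Subtype.ext (G.ι_comp_δ n x).symm

/-- The exhaustion by the images of the `G.g n` is truncated to start at `N`, where the inclusions
become split. -/
theorem isRootReductive_of_isSplitEmbedding {N : ℕ} (hN : ∀ n ≥ N, IsSplitEmbedding (G.δ n)) :
    IsRootReductive K L := by
  have hkill : ∀ n, LieAlgebra.IsKilling K (G.ι n).range := fun n =>
    LieAlgebra.isKilling_of_equiv (G.equivRange n)
  have hfin : ∀ n, FiniteDimensional K (G.ι n).range := fun n =>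
    Module.Finite.equiv (G.equivRange n).toLinearEquiv
  refine ⟨fun n => (G.ι (N + n)).range, fun n => ⟨hfin _, ?_⟩,
    fun n => ⟨G.range_le_range_succ (N + n), ?_⟩, fun y => ?_⟩
  · haveI := hkill (N + n)
    haveI := hfin (N + n)
    exact hasCentralRadical_of_isKilling _
  · haveI := hkill (N + n)
    haveI := hfin (N + n)
    exact ((hN (N + n) (Nat.le_add_right N n)).comp_equiv (G.equivRange _) (G.equivRange _) _
      (G.inclusion_equivRange _)).isRootInjection (LieSubalgebra.inclusion_injective _)
  · obtain ⟨n, hn⟩ := G.exhausts y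
    exact ⟨n, monotone_nat_of_le_succ G.range_le_range_succ (Nat.le_add_left n N) hn⟩

theorem exists_isSplitEmbedding {H : G.Cartan} {B : G.Borel H} {lam : ∀ n, Dual K (H.h n)}
    (hlam : IsStrictlyDominant B lam) : ∃ N, ∀ n ≥ N, IsSplitEmbedding (G.δ n) := by
  choose k l z e he using fun n => (G.diagonal n).decomposition
  obtain ⟨N, hN⟩ := exists_forall_multiplicity_eq_one hlam (d := fun n => k n + l n)
    fun n x y => trace_mul_of_decomposition (e n) (he n) x y
  exact ⟨N, fun n hn => isSplitEmbedding_of_multiplicity_eq_one (G.simple n) (G.simple (n + 1))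
    (G.δ n) (hN n hn) (e n) (he n)⟩

/-- A diagonal ind-algebra with a strictly dominant weight is root reductive. -/
theorem isRootReductive_and_isRootInjection {H : G.Cartan} {B : G.Borel H}
    {lam : ∀ n, Dual K (H.h n)} (hlam : IsStrictlyDominant B lam) :
    IsRootReductive K L ∧ ∃ N, ∀ n ≥ N, IsRootInjection (G.δ n) := by
  obtain ⟨N, hN⟩ := exists_isSplitEmbedding hlam
  exact ⟨isRootReductive_of_isSplitEmbedding hN, N, fun n hn =>
    (hN n hn).isRootInjection (G.diagonal n).injective⟩

end DiagonalIndAlgebra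

end Final

end DiagonalInd

theorem proposition2p1 {K L : Type*} [Field K] [IsAlgClosed K] [CharZero K]
    [LieRing L] [LieAlgebra K L]
    (G : DiagonalInd.DiagonalIndAlgebra K L) (H : G.Cartan) :
    (G.IsPure → ∀ B : G.Borel H, ∃ lam : ∀ n, Module.Dual K (H.h n),
      DiagonalInd.DiagonalIndAlgebra.IsDominant B lam ∧ lam ≠ 0) ∧
    (∃ B : G.Borel H, ∃ lam : ∀ n, Module.Dual K (H.h n),
      DiagonalInd.DiagonalIndAlgebra.IsDominant B lam ∧ lam ≠ 0) ∧
    (∀ B : G.Borel H, (∃ lam : ∀ n, Module.Dual K (H.h n),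
      DiagonalInd.DiagonalIndAlgebra.IsStrictlyDominant B lam) →
        DiagonalInd.IsRootReductive K L ∧
          ∃ N, ∀ n ≥ N, DiagonalInd.IsRootInjection (G.δ n)) := by
  refine ⟨DiagonalInd.DiagonalIndAlgebra.exists_isDominant_of_isPure,
    DiagonalInd.DiagonalIndAlgebra.exists_borel_isDominant H, ?_⟩
  rintro B ⟨lam, hlam⟩
  exact DiagonalInd.DiagonalIndAlgebra.isRootReductive_and_isRootInjection hlam
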